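/- Let $\mathbb N=\{1,2,3,\dots\}$. Let $\Delta$ be the root system of type $A_3$ with simple roots $\alpha_1,\alpha_2,\alpha_3$, coroots $\alpha^\vee=2\alpha/\langle\alpha,\alpha\rangle$, positive roots $\alpha_1,\alpha_2,\alpha_3,\alpha_1+\alpha_2,\alpha_2+\alpha_3,\alpha_1+\alpha_2+\alpha_3$ (in this order), half sum of positive roots $\rho$, root lattice $Q$, weight lattice $P$, and set $P_+$ of dominant integral weights. Let $L_1$ be the unique lattice with $Q\subsetneq L_1\subsetneq P$ (the weight lattice of $SO(6)\cong SU(4)/\{\pm1\}$), and put, for $\mathbf s=(s_1,\dots,s_6)\in\mathbb C^6$, $$\zeta_3(\mathbf s;SO(6))=\sum_{\lambda\in (P_+\cap L_1)+\rho}\ \prod_{\alpha\in\Delta_+}\frac1{\langle\alpha^\vee,\lambda\rangle^{s_\alpha}}=\sum_{\substack{m_1,m_2,m_3\ge1\\ m_1\equiv m_3\,(2)}}\frac{1}{m_1^{s_1}m_2^{s_2}m_3^{s_3}(m_1+m_2)^{s_4}(m_2+m_3)^{s_5}(m_1+m_2+m_3)^{s_6}} .$$ For $p,q\in\mathbb N$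 and $x,y\in\{1,-1\}$ let $$\mathfrak T(p,s,q;x,y)=\sum_{\substack{l\in\mathbb Z\setminus\{0\},\ m\ge1\\ l+m\ne0}}\frac{x^ly^m}{l^p\,m^s\,(l+m)^q},\qquad \phi(s)=(2^{1-s}-1)\zeta(s),$$ where $\zeta$ is the Riemann zeta-function. **Theorem.** Let $p,q,a,b,c\in\mathbb N$. The twelve functions of $s$ on the left-hand side below and all functions $s\mapsto\mathfrak T(m,s,n;x,y)$ with $m,n\in\mathbb N$, $x,y\in\{\pm1\}$ are given by absolutely convergent series for $\operatorname{Re}s>1$ and have meromorphic continuations to $s\in\mathbb C$; for the continued functions, $$\begin{aligned} &\zeta_3((p,q,s,a,b,c);SO(6))+(-1)^p\zeta_3((p,a,s,q,c,b);SO(6))\\ &+(-1)^{p+a}\zeta_3((q,a,c,p,s,b);SO(6))+(-1)^{p+a+c}\zeta_3((q,s,c,b,a,p);SO(6))\\ &+(-1)^{q}\zeta_3((a,q,b,p,s,c);SO(6))+(-1)^{q+b}\zeta_3((a,s,b,c,q,p);SO(6))\\ &+(-1)^{q+a}\zeta_3((a,p,b,q,c,s);SO(6))+(-1)^{q+a+b}\zeta_3((a,c,b,s,p,q);SO(6))\\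 &+(-1)^{q+a+b+c}\zeta_3((s,c,p,a,b,q);SO(6))+(-1)^{p+q+a}\zeta_3((q,p,c,a,b,s);SO(6))\\ &+(-1)^{p+q+a+c}\zeta_3((q,b,c,s,p,a);SO(6))+(-1)^{p+q+a+b+c}\zeta_3((s,b,p,q,c,a);SO(6))\\ &=\tfrac12\,(J_0+J_2) \end{aligned}$$ holds for every $s\in\mathbb C$ that is not a singularity of one of the functions $\zeta_3(\cdot;SO(6))$, $\mathfrak T$ occurring in it. Here $$\begin{aligned} J_0={}&2(-1)^p\sum_{j=0}^{\lfloor p/2\rfloor}\zeta(2j)\sum_{\omega=0}^{p-2j}\tbinom{\omega+a-1}{\omega}\tbinom{p+c-2j-\omega-1}{c-1}\,\mathfrak T(q+a+\omega,s,p+b+c-2j-\omega;1,1)\\ &+2(-1)^{p+a}\sum_{j=0}^{\lfloor c/2\rfloor}\zeta(2j)\sum_{\omega=0}^{c-2j}\tbinom{\omega+a-1}{\omega}\tbinom{p+c-2j-\omega-1}{p-1}\,\mathfrak T(q,s+a+\omega,p+b+c-2j-\omega;1,1)\\ &+2(-1)^p\sum_{j=0}^{\lfloor a/2\rfloor}\zeta(2j)\sum_{\omega=0}^{p-1}\tbinom{\omega+a-2j}{\omega}\tbinom{p+c-2-\omega}{c-1}\,\mathfrak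 T(q+a-2j+\omega+1,s,p+b+c-1-\omega;1,1)\\ &+2(-1)^{p+a}\sum_{j=0}^{\lfloor a/2\rfloor}\zeta(2j)\sum_{\omega=0}^{c-1}\tbinom{\omega+a-2j}{\omega}\tbinom{p+c-2-\omega}{p-1}\,\mathfrak T(q,s+a-2j+\omega+1,p+b+c-1-\omega;1,1), \end{aligned}$$ and $J_2$ is obtained from $J_0$ by replacing each $\zeta(2j)$ by $\phi(2j)$ and the arguments $(x,y)=(1,1)$ of $\mathfrak T$ in the four lines by $(1,-1)$, $(-1,1)$, $(-1,-1)$, $(-1,-1)$, respectively. -/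

import Mathlib

namespace WeightLatticeZeta

/-- `F` is the meromorphic continuation to the whole complex plane of the series `∑' i, f i s`:
`F` is meromorphic on `ℂ`, and for `1 < Re s` the series converges absolutely with sum `F s`
(in `ℂ`, `HasSum` is unconditional, hence absolute, convergence). The normal form condition fixes
the values of `F` on the discrete set of singular points (removable singularities are removed,
and the value at a pole is `0`), so that `F` is unique. -/
structure IsMeromorphicContinuation {ι : Type*} (f : ι → ℂ → ℂ) (F : ℂ → ℂ) : Prop where
  meromorphic : MeromorphicNFOn F Set.univ
  hasSum : ∀ s : ℂ, 1 < s.re → HasSum (fun i => f i s) (F s)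

/-- The meromorphic continuation of a series of functions is unique. -/
theorem IsMeromorphicContinuation.unique {ι : Type*} {f : ι → ℂ → ℂ} {F G : ℂ → ℂ}
    (hF : IsMeromorphicContinuation f F) (hG : IsMeromorphicContinuation f G) : F = G := by
  have hm : MeromorphicOn (F - G) Set.univ :=
    hF.meromorphic.meromorphicOn.sub hG.meromorphic.meromorphicOn
  have h2 : meromorphicOrderAt (F - G) 2 = ⊤ := by
    rw [meromorphicOrderAt_eq_top_iff]
    apply Filter.Eventually.filter_mono nhdsWithin_le_nhds
    have : {s : ℂ | 1 < s.re} ∈ nhds (2 : ℂ) :=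
      (isOpen_lt continuous_const Complex.continuous_re).mem_nhds (by simp)
    filter_upwards [this] with s hs
    simp [(hF.hasSum s hs).unique (hG.hasSum s hs)]
  have hall : ∀ z, meromorphicOrderAt (F - G) z = ⊤ := by
    intro z
    by_contra hz
    exact (hm.meromorphicOrderAt_ne_top_of_isPreconnected (x := z) isPreconnected_univ
      (Set.mem_univ _) (Set.mem_univ (2 : ℂ)) hz) h2
  funext z
  have hz := meromorphicOrderAt_eq_top_iff.1 (hall z)
  have hz' : F =ᶠ[nhdsWithin z {z}ᶜ] G := by
    filter_upwards [hz] with w hw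
    exact sub_eq_zero.1 hw
  exact ((MeromorphicNFAt.eventuallyEq_nhdsNE_iff_eventuallyEq_nhds
    (hF.meromorphic (Set.mem_univ z)) (hG.meromorphic (Set.mem_univ z))).1 hz').eq_of_nhds

open Classical in
/-- The meromorphic continuation to `ℂ` of `s ↦ ∑' i, f i s`, the zero function if there is
none. -/
noncomputable def continuation {ι : Type*} (f : ι → ℂ → ℂ) : ℂ → ℂ :=
  if h : ∃ F, IsMeromorphicContinuation f F then h.choose else 0

/-! ### The root system of type `A₃` and its lattices -/

/-- The ambient Euclidean space; the root system spans the hyperplane of vectors whose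
coordinates sum to zero. -/
abbrev V := EuclideanSpace ℝ (Fin 4)

/-- The simple roots `α₁, α₂, α₃` of type `A₃`. -/
noncomputable def simpleRoot : Fin 3 → V :=
  ![!₂[1, -1, 0, 0], !₂[0, 1, -1, 0], !₂[0, 0, 1, -1]]

/-- The positive roots `α₁, α₂, α₃, α₁ + α₂, α₂ + α₃, α₁ + α₂ + α₃`, in this order. -/
noncomputable def positiveRoot : Fin 6 → V :=
  ![simpleRoot 0, simpleRoot 1, simpleRoot 2, simpleRoot 0 + simpleRoot 1,
    simpleRoot 1 + simpleRoot 2, simpleRoot 0 + simpleRoot 1 + simpleRoot 2]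

/-- The coroot `α^∨ = 2 α / ⟨α, α⟩`. -/
noncomputable def coroot (α : V) : V := (2 / inner ℝ α α) • α

/-- The fundamental weights `λ₁, λ₂, λ₃`. -/
noncomputable def fundamentalWeight : Fin 3 → V :=
  ![(3 / 4 : ℝ) • simpleRoot 0 + (1 / 2 : ℝ) • simpleRoot 1 + (1 / 4 : ℝ) • simpleRoot 2,
    (1 / 2 : ℝ) • simpleRoot 0 + simpleRoot 1 + (1 / 2 : ℝ) • simpleRoot 2,
    (1 / 4 : ℝ) • simpleRoot 0 + (1 / 2 : ℝ) • simpleRoot 1 + (3 / 4 : ℝ) • simpleRoot 2]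

/-- The fundamental weights are dual to the simple coroots. -/
theorem inner_coroot_fundamentalWeight (i j : Fin 3) :
    inner ℝ (coroot (simpleRoot i)) (fundamentalWeight j) = if i = j then 1 else 0 := by
  fin_cases i <;> fin_cases j <;>
    simp [coroot, simpleRoot, fundamentalWeight, PiLp.inner_apply, Fin.sum_univ_four,
      EuclideanSpace.norm_sq_eq] <;> norm_num

/-- The Weyl vector, half the sum of the positive roots. -/
noncomputable def weylVector : V := (1 / 2 : ℝ) • ∑ i, positiveRoot i

/-- The root lattice `Q`. -/
noncomputable def rootLattice : AddSubgroup V := AddSubgroup.closure (Set.range simpleRoot)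

/-- The weight lattice `P`. -/
noncomputable def weightLattice : AddSubgroup V :=
  AddSubgroup.closure (Set.range fundamentalWeight)

/-- The set `P₊` of dominant integral weights. -/
noncomputable def dominantWeights : AddSubmonoid V :=
  AddSubmonoid.closure (Set.range fundamentalWeight)

/-- The weight lattice `L₁` of `SO(6) = SU(4) / {±1}`: the lattice generated by `Q` and the
highest weight `λ₂` of the six-dimensional vector representation. -/
noncomputable def weightLatticeSO6 : AddSubgroup V :=
  rootLattice ⊔ AddSubgroup.zmultiples (fundamentalWeight 1)

theorem rootLattice_le_weightLattice : rootLattice ≤ weightLattice := by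
  have h : ∀ i, fundamentalWeight i ∈ weightLattice :=
    fun i => AddSubgroup.subset_closure (Set.mem_range_self i)
  rw [rootLattice, AddSubgroup.closure_le]
  rintro _ ⟨i, rfl⟩
  have e : simpleRoot i = (![(2 : ℤ) • fundamentalWeight 0 - fundamentalWeight 1,
      (2 : ℤ) • fundamentalWeight 1 - fundamentalWeight 0 - fundamentalWeight 2,
      (2 : ℤ) • fundamentalWeight 2 - fundamentalWeight 1] : Fin 3 → V) i := by
    fin_cases i <;> simp [fundamentalWeight] <;> module
  rw [SetLike.mem_coe, e]
  fin_cases i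
  · exact sub_mem (zsmul_mem (h 0) _) (h 1)
  · exact sub_mem (sub_mem (zsmul_mem (h 1) _) (h 0)) (h 2)
  · exact sub_mem (zsmul_mem (h 2) _) (h 1)

/-- Every weight is congruent to a multiple of `λ₁` modulo the root lattice. -/
theorem exists_of_mem_weightLattice {v : V} (hv : v ∈ weightLattice) :
    ∃ k : ℤ, v - k • fundamentalWeight 0 ∈ rootLattice := by
  have h : ∀ i, simpleRoot i ∈ rootLattice :=
    fun i => AddSubgroup.subset_closure (Set.mem_range_self i)
  induction hv using AddSubgroup.closure_induction with
  | mem x hx =>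
    obtain ⟨i, rfl⟩ := hx
    fin_cases i
    · exact ⟨1, by simp⟩
    · refine ⟨2, ?_⟩
      have : fundamentalWeight 1 - (2 : ℤ) • fundamentalWeight 0 = -simpleRoot 0 := by
        simp [fundamentalWeight]; module
      simpa [this] using h 0
    · refine ⟨3, ?_⟩
      have : fundamentalWeight 2 - (3 : ℤ) • fundamentalWeight 0
          = -((2 : ℤ) • simpleRoot 0 + simpleRoot 1) := by
        simp [fundamentalWeight]; module
      have h' := neg_mem (add_mem (zsmul_mem (h 0) 2) (h 1))
      rw [← this] at h'
      exact h'
  | zero => exact ⟨0, by simp⟩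
  | add x y _ _ hx hy =>
    obtain ⟨k, hk⟩ := hx
    obtain ⟨l, hl⟩ := hy
    refine ⟨k + l, ?_⟩
    have : x + y - (k + l) • fundamentalWeight 0
        = (x - k • fundamentalWeight 0) + (y - l • fundamentalWeight 0) := by module
    rw [this]
    exact add_mem hk hl
  | neg x _ hx =>
    obtain ⟨k, hk⟩ := hx
    refine ⟨-k, ?_⟩
    have : -x - (-k) • fundamentalWeight 0 = -(x - k • fundamentalWeight 0) := by module
    rw [this]
    exact neg_mem hk

/-- `2 λ₁` is congruent to `λ₂` modulo the root lattice. -/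
theorem zsmul_fundamentalWeight_zero :
    (2 : ℤ) • fundamentalWeight 0 = fundamentalWeight 1 + simpleRoot 0 := by
  simp [fundamentalWeight]; module

/-- The lattice `L₁` lies strictly between `Q` and `P`. -/
theorem lt_weightLatticeSO6_lt :
    rootLattice < weightLatticeSO6 ∧ weightLatticeSO6 < weightLattice := by
  have hP : ∀ i, fundamentalWeight i ∈ weightLattice :=
    fun i => AddSubgroup.subset_closure (Set.mem_range_self i)
  have hQ : ∀ v ∈ rootLattice, ∃ n : ℤ, v 0 = n := by
    intro v hv
    induction hv using AddSubgroup.closure_induction with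
    | mem x hx =>
      obtain ⟨i, rfl⟩ := hx
      fin_cases i
      · exact ⟨1, by simp [simpleRoot]⟩
      · exact ⟨0, by simp [simpleRoot]⟩
      · exact ⟨0, by simp [simpleRoot]⟩
    | zero => exact ⟨0, by simp⟩
    | add x y _ _ hx hy =>
      obtain ⟨k, hk⟩ := hx
      obtain ⟨l, hl⟩ := hy
      exact ⟨k + l, by simp [hk, hl]⟩
    | neg x _ hx =>
      obtain ⟨k, hk⟩ := hx
      exact ⟨-k, by simp [hk]⟩
  have hnot : ∀ n : ℤ, (1 / 2 : ℝ) ≠ n := by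
    intro n hn
    have h2 : (1 : ℝ) = 2 * n := by linarith
    have h3 : (1 : ℤ) = 2 * n := by exact_mod_cast h2
    omega
  have h1 : fundamentalWeight 1 0 = 1 / 2 := by simp [fundamentalWeight, simpleRoot]
  have h0 : fundamentalWeight 0 0 = 3 / 4 := by simp [fundamentalWeight, simpleRoot]
  refine ⟨SetLike.lt_iff_le_and_exists.2 ⟨le_sup_left, fundamentalWeight 1,
    AddSubgroup.mem_sup_right (AddSubgroup.mem_zmultiples _), fun h => ?_⟩,
    SetLike.lt_iff_le_and_exists.2 ⟨sup_le rootLattice_le_weightLattice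
      ((AddSubgroup.zmultiples_le).2 (hP 1)), fundamentalWeight 0, hP 0, fun h => ?_⟩⟩
  · obtain ⟨n, hn⟩ := hQ _ h
    exact hnot n (h1 ▸ hn)
  · obtain ⟨v, hv, w, hw, hvw⟩ := AddSubgroup.mem_sup.1 h
    obtain ⟨k, rfl⟩ := AddSubgroup.mem_zmultiples_iff.1 hw
    obtain ⟨n, hn⟩ := hQ _ hv
    have e := congrArg (fun u : V => u 0) hvw
    simp only [PiLp.add_apply, PiLp.smul_apply, h0, h1, hn, zsmul_eq_mul] at e
    have e' : (1 / 2 : ℝ) = ((2 * n + k - 1 : ℤ) : ℝ) := by push_cast; linarith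
    exact hnot _ e'

/-- The lattice `L₁` is the only lattice strictly between `Q` and `P`. -/
theorem eq_weightLatticeSO6 {L : AddSubgroup V} (h₁ : rootLattice < L) (h₂ : L < weightLattice) :
    L = weightLatticeSO6 := by
  have hr : ∀ i, simpleRoot i ∈ rootLattice :=
    fun i => AddSubgroup.subset_closure (Set.mem_range_self i)
  have h2 := zsmul_fundamentalWeight_zero
  have h4 : (4 : ℤ) • fundamentalWeight 0 ∈ rootLattice := by
    have : (4 : ℤ) • fundamentalWeight 0
        = (3 : ℤ) • simpleRoot 0 + (2 : ℤ) • simpleRoot 1 + simpleRoot 2 := by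
      simp [fundamentalWeight]; module
    rw [this]
    exact add_mem (add_mem (zsmul_mem (hr 0) 3) (zsmul_mem (hr 1) 2)) (hr 2)
  have key : ∀ v ∈ L, ∃ k : ℤ, k • fundamentalWeight 0 ∈ L ∧
      v - k • fundamentalWeight 0 ∈ rootLattice := by
    intro v hv
    obtain ⟨k, hk⟩ := exists_of_mem_weightLattice (h₂.le hv)
    refine ⟨k, ?_, hk⟩
    have := sub_mem hv (h₁.le hk)
    simpa using this
  have even : ∀ k : ℤ, k • fundamentalWeight 0 ∈ L → Even k := by
    intro k hk
    by_contra ho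
    rw [Int.not_even_iff_odd] at ho
    have h0 : fundamentalWeight 0 ∈ L := by
      obtain ⟨m, u, hmu⟩ : ∃ m u : ℤ, m * k + u * 4 = 1 := by
        obtain ⟨n, rfl⟩ := ho
        rcases Int.even_or_odd' n with ⟨j, rfl | rfl⟩
        · exact ⟨1, -j, by ring⟩
        · exact ⟨-1, j + 1, by ring⟩
      have e : fundamentalWeight 0
          = m • (k • fundamentalWeight 0) + u • ((4 : ℤ) • fundamentalWeight 0) := by
        rw [← mul_zsmul', ← mul_zsmul', ← add_zsmul, mul_comm k, mul_comm 4, hmu, one_zsmul]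
      rw [e]
      exact add_mem (zsmul_mem hk _) (zsmul_mem (h₁.le h4) _)
    refine h₂.not_ge fun v hv => ?_
    obtain ⟨l, hl⟩ := exists_of_mem_weightLattice hv
    have := add_mem (h₁.le hl) (zsmul_mem h0 l)
    simpa using this
  apply le_antisymm
  · intro v hv
    obtain ⟨k, hk, hvk⟩ := key v hv
    obtain ⟨j, rfl⟩ := even k hk
    have e : v = (v - (j + j) • fundamentalWeight 0 + j • simpleRoot 0)
        + j • fundamentalWeight 1 := by
      have : (j + j) • fundamentalWeight 0 = j • ((2 : ℤ) • fundamentalWeight 0) := by module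
      rw [this, h2]; module
    rw [e]
    exact add_mem (AddSubgroup.mem_sup_left (add_mem hvk (zsmul_mem (hr 0) j)))
      (AddSubgroup.mem_sup_right (AddSubgroup.zsmul_mem_zmultiples _ j))
  · refine sup_le h₁.le ?_
    rw [AddSubgroup.zmultiples_le]
    obtain ⟨v, hv, hvQ⟩ := SetLike.exists_of_lt h₁
    obtain ⟨k, hk, hvk⟩ := key v hv
    obtain ⟨j, rfl⟩ := even k hk
    have hj : ¬ Even j := by
      rintro ⟨i, rfl⟩
      apply hvQ
      have e : v = (v - (i + i + (i + i)) • fundamentalWeight 0)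
          + i • ((4 : ℤ) • fundamentalWeight 0) := by module
      rw [e]
      exact add_mem hvk (zsmul_mem h4 i)
    rw [Int.not_even_iff_odd] at hj
    obtain ⟨i, rfl⟩ := hj
    have e : fundamentalWeight 1 = (2 * i + 1 + (2 * i + 1)) • fundamentalWeight 0
        - i • ((4 : ℤ) • fundamentalWeight 0) - simpleRoot 0 := by
      rw [eq_sub_iff_add_eq, ← h2]; module
    rw [e]
    exact sub_mem (sub_mem hk (zsmul_mem (h₁.le h4) i)) (h₁.le (hr 0))

/-! ### The zeta-functions -/

/-- The index set `L₊ + ρ` of the zeta-function of the lattice `L`, where `L₊ = P₊ ∩ L`. -/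
def shiftedDominant (L : AddSubgroup V) : Set V :=
  {x | ∃ μ ∈ dominantWeights, μ ∈ L ∧ x = μ + weylVector}

/-- The term `∏_{α > 0} ⟨α^∨, x⟩ ^ (-s_α)` of the zeta-function of a lattice. -/
noncomputable def zetaTerm (s : Fin 6 → ℂ) (x : V) : ℂ :=
  ∏ i, 1 / ((inner ℝ (coroot (positiveRoot i)) x : ℝ) : ℂ) ^ (s i)

/-- The zeta-function `s ↦ ζ₃(v(s); SO(6))` along the complex line `v : ℂ → ℂ⁶`: the meromorphic
continuation in `s` of the series `∑_{x ∈ L₁₊ + ρ} ∏_{α > 0} ⟨α^∨, x⟩ ^ (-v(s)_α)`. -/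
noncomputable def zetaSO6 (v : ℂ → Fin 6 → ℂ) : ℂ → ℂ :=
  continuation fun (x : shiftedDominant weightLatticeSO6) s => zetaTerm (v s) x

/-- `ζ₃(v(s); SO(6))` has a meromorphic continuation in `s` to the whole complex plane. -/
def HasContinuationSO6 (v : ℂ → Fin 6 → ℂ) : Prop :=
  ∃ F, IsMeromorphicContinuation
    (fun (x : shiftedDominant weightLatticeSO6) s => zetaTerm (v s) x) F

/-- The index set `l ≠ 0`, `m ≥ 1`, `l + m ≠ 0` of the series `𝔗`. -/
def polylogIndex : Set (ℤ × ℤ) := {n | n.1 ≠ 0 ∧ 1 ≤ n.2 ∧ n.1 + n.2 ≠ 0}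

/-- The term `x^l y^m / (l^p m^s (l + m)^q)` of `𝔗(p, s, q; x, y)`. -/
noncomputable def polylogTerm (p q : ℕ) (x y : ℂ) (n : ℤ × ℤ) (s : ℂ) : ℂ :=
  x ^ n.1 * y ^ n.2 / ((n.1 : ℂ) ^ p * (n.2 : ℂ) ^ s * ((n.1 : ℂ) + (n.2 : ℂ)) ^ q)

/-- The function `𝔗(p, s, q; x, y)`, continued meromorphically in `s`. -/
noncomputable def polylogT (p : ℕ) (s : ℂ) (q : ℕ) (x y : ℂ) : ℂ :=
  continuation (fun n : polylogIndex => polylogTerm p q x y n) s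

/-- `𝔗(p, s, q; x, y)` has a meromorphic continuation in `s` to the whole complex plane. -/
def HasContinuationT (p q : ℕ) (x y : ℂ) : Prop :=
  ∃ F, IsMeromorphicContinuation (fun n : polylogIndex => polylogTerm p q x y n) F

/-- The alternating zeta-function `φ(s) = ∑ (-1)^n n^{-s} = (2^{1-s} - 1) ζ(s)`. -/
noncomputable def phi (s : ℂ) : ℂ := ((2 : ℂ) ^ (1 - s) - 1) * riemannZeta s

/-! ### The two sides of the functional relation -/

/-- The twelve arguments on the left-hand side, as functions of `s`. -/
def lhsArg (p q a b c : ℕ) : Fin 12 → ℂ → Fin 6 → ℂ :=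
  ![fun s => ![p, q, s, a, b, c], fun s => ![p, a, s, q, c, b],
    fun s => ![q, a, c, p, s, b], fun s => ![q, s, c, b, a, p],
    fun s => ![a, q, b, p, s, c], fun s => ![a, s, b, c, q, p],
    fun s => ![a, p, b, q, c, s], fun s => ![a, c, b, s, p, q],
    fun s => ![s, c, p, a, b, q], fun s => ![q, p, c, a, b, s],
    fun s => ![q, b, c, s, p, a], fun s => ![s, b, p, q, c, a]]

/-- The exponents of `-1` in front of the twelve terms on the left-hand side. -/
def lhsSign (p q a b c : ℕ) : Fin 12 → ℕ :=
  ![0, p, p + a, p + a + c, q, q + b, q + a, q + a + b, q + a + b + c, p + q + a,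
    p + q + a + c, p + q + a + b + c]

/-- The four-fold sum common to both right-hand sides: `h` is the zeta-function whose values at
even integers occur (`ζ` or `φ`), and `(xᵢ, yᵢ)` are the arguments of `𝔗` in the `i`-th sum. -/
noncomputable def rhs (h : ℂ → ℂ) (x₁ y₁ x₂ y₂ x₃ y₃ x₄ y₄ : ℂ) (p q a b c : ℕ) (s : ℂ) : ℂ :=
  2 * (-1) ^ p * ∑ j ∈ Finset.range (p / 2 + 1), h (2 * j) *
      ∑ ω ∈ Finset.range (p - 2 * j + 1),
        ((ω + a - 1).choose ω : ℂ) * ((p + c - 2 * j - ω - 1).choose (c - 1) : ℂ) *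
          polylogT (q + a + ω) s (p + b + c - 2 * j - ω) x₁ y₁
  + 2 * (-1) ^ (p + a) * ∑ j ∈ Finset.range (c / 2 + 1), h (2 * j) *
      ∑ ω ∈ Finset.range (c - 2 * j + 1),
        ((ω + a - 1).choose ω : ℂ) * ((p + c - 2 * j - ω - 1).choose (p - 1) : ℂ) *
          polylogT q (s + a + ω) (p + b + c - 2 * j - ω) x₂ y₂
  + 2 * (-1) ^ p * ∑ j ∈ Finset.range (a / 2 + 1), h (2 * j) *
      ∑ ω ∈ Finset.range p,
        ((ω + a - 2 * j).choose ω : ℂ) * ((p + c - 2 - ω).choose (c - 1) : ℂ) *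
          polylogT (q + a - 2 * j + ω + 1) s (p + b + c - 1 - ω) x₃ y₃
  + 2 * (-1) ^ (p + a) * ∑ j ∈ Finset.range (a / 2 + 1), h (2 * j) *
      ∑ ω ∈ Finset.range c,
        ((ω + a - 2 * j).choose ω : ℂ) * ((p + c - 2 - ω).choose (p - 1) : ℂ) *
          polylogT q (s + a - 2 * j + ω + 1) (p + b + c - 1 - ω) x₄ y₄

/-- The right-hand side `J₀` of the functional relation for `ζ₃(s; A₃)`. -/
noncomputable def J₀ (p q a b c : ℕ) (s : ℂ) : ℂ :=
  rhs riemannZeta 1 1 1 1 1 1 1 1 p q a b c s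

/-- The right-hand side `J₂` of the functional relation for `ζ₃(s, λ₂^∨; SU(4))`. -/
noncomputable def J₂ (p q a b c : ℕ) (s : ℂ) : ℂ :=
  rhs phi 1 (-1) (-1) 1 (-1) (-1) (-1) (-1) p q a b c s

/-- None of the functions `𝔗` occurring in `rhs` has a singularity at the point `s`. -/
def RhsRegular (x₁ y₁ x₂ y₂ x₃ y₃ x₄ y₄ : ℂ) (p q a b c : ℕ) (s : ℂ) : Prop :=
  (∀ j ∈ Finset.range (p / 2 + 1), ∀ ω ∈ Finset.range (p - 2 * j + 1),
    AnalyticAt ℂ (fun z => polylogT (q + a + ω) z (p + b + c - 2 * j - ω) x₁ y₁) s) ∧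
  (∀ j ∈ Finset.range (c / 2 + 1), ∀ ω ∈ Finset.range (c - 2 * j + 1),
    AnalyticAt ℂ (fun z => polylogT q (z + a + ω) (p + b + c - 2 * j - ω) x₂ y₂) s) ∧
  (∀ j ∈ Finset.range (a / 2 + 1), ∀ ω ∈ Finset.range p,
    AnalyticAt ℂ (fun z => polylogT (q + a - 2 * j + ω + 1) z (p + b + c - 1 - ω) x₃ y₃) s) ∧
  (∀ j ∈ Finset.range (a / 2 + 1), ∀ ω ∈ Finset.range c,
    AnalyticAt ℂ (fun z => polylogT q (z + a - 2 * j + ω + 1) (p + b + c - 1 - ω) x₄ y₄) s)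

end WeightLatticeZeta

/-!
The functional relation comes from summing one series in two ways. Over all `(n, l, m) ∈ ℤ³` with
`m ≥ 1` and `n ≡ m (mod 2)`, consider, for `Re s > 1`,
`1 / (n ^ p l ^ q m ^ s (n + l) ^ a (l + m) ^ b (n + l + m) ^ c)`,
the terms with a zero denominator being omitted.

* The six linear forms are the positive coroots of type `A₃`. The half space `m > 0` is a union of
  twelve Weyl chambers, and on each of them the sum is, up to sign, one of the twelve zeta-functions
  (`latticeTerm_chamberMap`, `hasSum_evenLatticeTerm`). The condition `n ≡ m (mod 2)` becomes
  `m₁ ≡ m₃ (mod 2)` on every chamber; by `mem_shiftedDominant`, this is what describes the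
  dominant weights of `SO(6)`.
* For fixed `(l, m)`, the sum over `n` is a sum over the integers of a rational function with poles
  at `0`, `-l`, `-l - m`, twisted by `1` or `(-1) ^ n`. Such a sum is determined by the expansions
  of the function at its poles together with the values `ζ(2 j)` or `φ(2 j)`
  (`hasSum_poleTerm`); the constant terms of the expansions, which belong to the omitted integers,
  are accounted for by `ζ(0) = φ(0) = -1/2`. The expansions are computed in `expansion_zero`,
  `expansion_one` and `expansion_two`. Summing over `(l, m)` gives the series `𝔗`
  (`hasSum_latticeTerm_fibre`, `hasSum_rhsTerm`).

The relation then extends to all regular points by the identity theorem, once the meromorphic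
continuations are known to exist. For these, each series is collected into a Dirichlet series
`∑ c(N) N ^ (-s)`, where `N` is the linear form that carries the exponent `s`. Repeated partial
fractions show that `c` is a nested alternating harmonic sum: it lies in the smallest class of
sequences that contains `1` and is stable under linear combinations, division by `N`,
multiplication by `(-1) ^ N`, and partial summation (`HarmonicSum`). Dirichlet series with such
coefficients continue meromorphically (`HarmonicSum.extendsTo`): if `h(N + 1) = ±(h(N) + g(N))`,
then expanding `(N + 1) ^ (-s)` in powers of `1 / N` expresses the Dirichlet series of `h` at `s`
through that of `g` and the values at `s + 1, s + 2, …`, which gains one unit strip at a time.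
-/

namespace WeightLatticeZeta

open Finset Filter Topology

/-! ### Nested harmonic sums -/

/-- The class of nested (alternating) harmonic sums: the smallest class of sequences that contains
the constant `1` and is closed under linear combinations, division by `n`, multiplication by
`(-1) ^ n`, and formation of the partial sums over `1 ≤ k < n`. Only the values at `n ≥ 1`
matter. -/
inductive HarmonicSum : (ℕ → ℂ) → Prop
  | one : HarmonicSum fun _ => 1
  | add {f g : ℕ → ℂ} : HarmonicSum f → HarmonicSum g → HarmonicSum fun n => f n + g n
  | const_mul (c : ℂ) {f : ℕ → ℂ} : HarmonicSum f → HarmonicSum fun n => c * f n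
  | div {f : ℕ → ℂ} : HarmonicSum f → HarmonicSum fun n => f n / n
  | sign {f : ℕ → ℂ} : HarmonicSum f → HarmonicSum fun n => (-1) ^ n * f n
  | sum {f : ℕ → ℂ} : HarmonicSum f → HarmonicSum fun n => ∑ k ∈ Finset.Ico 1 n, f k
  | congr {f g : ℕ → ℂ} : HarmonicSum f → (∀ n, 1 ≤ n → f n = g n) → HarmonicSum g

namespace HarmonicSum

variable {f g : ℕ → ℂ}

theorem const (c : ℂ) : HarmonicSum fun _ => c :=
  (one.const_mul c).congr fun _ _ => mul_one c

theorem sub (hf : HarmonicSum f) (hg : HarmonicSum g) : HarmonicSum fun n => f n - g n :=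
  (hf.add (hg.const_mul (-1))).congr fun n _ => by ring

theorem div_pow (hf : HarmonicSum f) (k : ℕ) : HarmonicSum fun n => f n / (n : ℂ) ^ k := by
  induction k with
  | zero => simpa using hf
  | succ k ih => exact ih.div.congr fun n _ => by rw [pow_succ, div_div]

theorem sign_pow {ε : ℂ} (hε : ε = 1 ∨ ε = -1) (hf : HarmonicSum f) :
    HarmonicSum fun n => ε ^ n * f n := by
  rcases hε with rfl | rfl
  · simpa using hf
  · exact hf.sign

/-- The product of two partial sums is again a partial sum (the quasi-shuffle relation). -/
theorem sum_mul_sum_Ico (f g : ℕ → ℂ) (n : ℕ) :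
    (∑ k ∈ Ico 1 n, f k) * (∑ k ∈ Ico 1 n, g k) =
      ∑ k ∈ Ico 1 n, ((f k * ∑ j ∈ Ico 1 k, g j) + (∑ j ∈ Ico 1 k, f j) * g k + f k * g k) := by
  induction n with
  | zero => simp
  | succ n ih =>
    rcases Nat.eq_zero_or_pos n with rfl | hn
    · simp
    · rw [sum_Ico_succ_top hn, sum_Ico_succ_top hn, sum_Ico_succ_top hn, ← ih]
      ring

/-- Nested harmonic sums form an algebra. -/
theorem mul (hf : HarmonicSum f) (hg : HarmonicSum g) : HarmonicSum fun n => f n * g n := by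
  induction hf generalizing g with
  | one => simpa using hg
  | add _ _ h₁ h₂ => exact ((h₁ hg).add (h₂ hg)).congr fun n _ => by ring
  | const_mul c _ h => exact ((h hg).const_mul c).congr fun n _ => by ring
  | div _ h => exact (h hg).div.congr fun n _ => by ring
  | sign _ h => exact (h hg).sign.congr fun n _ => by ring
  | congr _ hfg h => exact (h hg).congr fun n hn => by rw [hfg n hn]
  | @sum f hf h =>
    induction hg with
    | one => simpa using hf.sum
    | add _ _ h₁ h₂ => exact (h₁.add h₂).congr fun n _ => by ring
    | const_mul c _ h => exact (h.const_mul c).congr fun n _ => by ring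
    | div _ h => exact h.div.congr fun n _ => by ring
    | sign _ h => exact h.sign.congr fun n _ => by ring
    | congr _ hfg h => exact h.congr fun n hn => by rw [hfg n hn]
    | sum hg h' =>
      exact (((h hg.sum).add h').add (h hg)).sum.congr fun n _ => (sum_mul_sum_Ico _ _ n).symm

/-- Partial sums that include the last term. -/
theorem sum_Icc (hf : HarmonicSum f) : HarmonicSum fun n => ∑ k ∈ Ico 1 (n + 1), f k :=
  (hf.sum.add hf).congr fun _ hn => (sum_Ico_succ_top hn _).symm

/-- A solution of a first-order recurrence whose right-hand side is a nested harmonic sum. -/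
theorem of_recurrence {η : ℂ} (hη : η = 1 ∨ η = -1) {X : ℕ → ℂ} (hg : HarmonicSum g)
    (h : ∀ n, 1 ≤ n → X (n + 1) = η * (X n + g n)) : HarmonicSum X := by
  have hη2 : η * η = 1 := by rcases hη with rfl | rfl <;> norm_num
  refine (((const (η * X 1)).add (hg.sign_pow hη).sum).sign_pow hη).congr fun n hn => ?_
  induction n, hn using Nat.le_induction with
  | base => simp [← mul_assoc, hη2]
  | succ n hn ih =>
    rw [sum_Ico_succ_top hn, h n hn, ← ih]
    have e : η ^ (n + 1) * (η ^ n * g n) = η * g n := by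
      rw [show η ^ (n + 1) * (η ^ n * g n) = η * (η * η) ^ n * g n by rw [mul_pow]; ring, hη2,
        one_pow, mul_one]
    rw [← add_assoc, mul_add, e]
    ring

/-- A variant of `HarmonicSum.of_recurrence`, in which the recurrence starts at `0` and the
inhomogeneous term is taken at the new index. -/
theorem of_recurrence' {η : ℂ} (hη : η = 1 ∨ η = -1) {X : ℕ → ℂ} (hg : HarmonicSum g)
    (h : ∀ n, X (n + 1) = η * X n + g (n + 1)) : HarmonicSum X := by
  have hη2 : η * η = 1 := by rcases hη with rfl | rfl <;> norm_num
  refine (((const (X 0)).add (hg.sign_pow hη).sum_Icc).sign_pow hη).congr fun n hn => ?_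
  clear hn
  induction n with
  | zero => simp
  | succ n ih =>
    rw [sum_Ico_succ_top (by omega), h n, ← ih]
    have e : η ^ (n + 1) * (η ^ (n + 1) * g (n + 1)) = g (n + 1) := by
      rw [← mul_assoc, ← mul_pow, hη2, one_pow, one_mul]
    rw [← add_assoc, mul_add, e]
    ring

/-- The tails of a convergent series of nested harmonic terms. -/
theorem tail (hf : HarmonicSum f) (hs : Summable fun n : ℕ => f (n + 1)) :
    HarmonicSum fun N => ∑' w : ℕ, f (w + 1 + N) := by
  refine ((const (∑' n, f (n + 1))).sub hf.sum_Icc).congr fun N _ => ?_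
  rw [← hs.sum_add_tsum_nat_add N, Finset.sum_Ico_eq_sum_range]
  simp only [Nat.add_sub_cancel, add_comm 1]
  rw [add_sub_cancel_left]
  exact tsum_congr fun w => by congr 1; omega

/-- Nested harmonic sums grow at most polynomially. -/
theorem exists_bound (hf : HarmonicSum f) :
    ∃ A : ℕ, ∃ C : ℝ, 0 ≤ C ∧ ∀ n, 1 ≤ n → ‖f n‖ ≤ C * (n : ℝ) ^ A := by
  induction hf with
  | one => exact ⟨0, 1, by norm_num, by simp⟩
  | @add f g _ _ hf hg =>
    obtain ⟨A, C, hC, hf⟩ := hf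
    obtain ⟨B, D, hD, hg⟩ := hg
    refine ⟨A + B, C + D, by positivity, fun n hn => (norm_add_le _ _).trans ?_⟩
    have h1 : (1 : ℝ) ≤ n := by exact_mod_cast hn
    have hA : (n : ℝ) ^ A ≤ (n : ℝ) ^ (A + B) := pow_le_pow_right₀ h1 (by omega)
    have hB : (n : ℝ) ^ B ≤ (n : ℝ) ^ (A + B) := pow_le_pow_right₀ h1 (by omega)
    rw [add_mul]
    exact add_le_add ((hf n hn).trans (by gcongr)) ((hg n hn).trans (by gcongr))
  | const_mul c _ hf =>
    obtain ⟨A, C, hC, hf⟩ := hf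
    refine ⟨A, ‖c‖ * C, by positivity, fun n hn => ?_⟩
    rw [norm_mul, mul_assoc]
    exact mul_le_mul_of_nonneg_left (hf n hn) (norm_nonneg _)
  | div _ hf =>
    obtain ⟨A, C, hC, hf⟩ := hf
    refine ⟨A, C, hC, fun n hn => ?_⟩
    have h1 : (1 : ℝ) ≤ n := by exact_mod_cast hn
    rw [norm_div, Complex.norm_natCast]
    exact (div_le_self (norm_nonneg _) h1).trans (hf n hn)
  | sign _ hf =>
    obtain ⟨A, C, hC, hf⟩ := hf
    exact ⟨A, C, hC, fun n hn => by simpa using hf n hn⟩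
  | congr _ h hf =>
    obtain ⟨A, C, hC, hf⟩ := hf
    exact ⟨A, C, hC, fun n hn => h n hn ▸ hf n hn⟩
  | sum _ hf =>
    obtain ⟨A, C, hC, hf⟩ := hf
    refine ⟨A + 1, C, hC, fun n hn => (norm_sum_le _ _).trans ?_⟩
    calc ∑ k ∈ Ico 1 n, ‖_‖ ≤ ∑ k ∈ Ico 1 n, C * (n : ℝ) ^ A := by
          refine sum_le_sum fun k hk => (hf k (mem_Ico.1 hk).1).trans ?_
          have : (k : ℝ) ≤ n := by exact_mod_cast (mem_Ico.1 hk).2.le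
          gcongr
      _ = ((n - 1 : ℕ) : ℝ) * (C * (n : ℝ) ^ A) := by simp
      _ ≤ n * (C * (n : ℝ) ^ A) := by gcongr; omega
      _ = C * (n : ℝ) ^ (A + 1) := by ring

end HarmonicSum

/-! ### Meromorphic continuation of Dirichlet series of nested harmonic sums -/

/-- The coefficients of the expansion `(1 + x) ^ (-s) = ∑ r, binomCoeff r s * x ^ r`. -/
noncomputable def binomCoeff : ℕ → ℂ → ℂ
  | 0, _ => 1
  | r + 1, s => -s * binomCoeff r (s + 1) / (r + 1)

theorem differentiable_binomCoeff (r : ℕ) : Differentiable ℂ (binomCoeff r) := by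
  induction r with
  | zero => exact differentiable_const 1
  | succ r ih =>
    have : Differentiable ℂ fun s : ℂ => -s * binomCoeff r (s + 1) / (r + 1) := by fun_prop
    exact this

/-- The remainder of the binomial expansion of `(1 + x) ^ (-s)` after `R` terms. -/
noncomputable def binomRemainder (R : ℕ) (s : ℂ) (x : ℝ) : ℂ :=
  (1 + (x : ℂ)) ^ (-s) - ∑ r ∈ range R, binomCoeff r s * (x : ℂ) ^ r

theorem differentiable_binomRemainder (R : ℕ) {x : ℝ} (hx : 0 ≤ x) :
    Differentiable ℂ fun s => binomRemainder R s x := by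
  have h1 : (1 + (x : ℂ)) ≠ 0 := by
    norm_cast; positivity
  have h2 := differentiable_binomCoeff
  refine Differentiable.sub ?_ (Differentiable.fun_sum fun r _ => (h2 r).mul_const _)
  intro s
  exact (differentiableAt_id.neg).const_cpow (Or.inl h1)

theorem hasDerivAt_binomRemainder (R : ℕ) (s : ℂ) {x : ℝ} (hx : 0 ≤ x) :
    HasDerivAt (binomRemainder (R + 1) s) (-s * binomRemainder R (s + 1) x) x := by
  have h0 : HasDerivAt (fun z : ℂ => 1 + z) 1 (x : ℂ) := (hasDerivAt_id _).const_add 1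
  have hs : (1 + (x : ℂ)) ∈ Complex.slitPlane := by
    left; norm_cast; positivity
  have h1 : HasDerivAt (fun x : ℝ => (1 + (x : ℂ)) ^ (-s))
      (-s * (1 + (x : ℂ)) ^ (-s - 1) * 1) x := (h0.cpow_const hs).comp_ofReal
  have h2 : HasDerivAt (fun x : ℝ => ∑ r ∈ range (R + 1), binomCoeff r s * (x : ℂ) ^ r)
      (∑ r ∈ range (R + 1), binomCoeff r s * (r * (x : ℂ) ^ (r - 1) * 1)) x := by
    refine HasDerivAt.fun_sum fun r _ => HasDerivAt.const_mul _ ?_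
    exact (Complex.ofRealCLM.hasDerivAt (x := x)).fun_pow r
  refine (h1.sub h2).congr_deriv ?_
  rw [sum_range_succ', binomRemainder, mul_sub, mul_sum]
  simp only [Nat.cast_zero, zero_mul, mul_zero, add_zero, mul_one, Nat.add_sub_cancel]
  congr 1
  · congr 2; ring
  · refine sum_congr rfl fun r _ => ?_
    have : (r : ℂ) + 1 ≠ 0 := by exact_mod_cast Nat.succ_ne_zero r
    rw [binomCoeff]
    push_cast
    field_simp

/-- The remainder of order `R` of the binomial series is `O(x ^ R)` on `[0, 1]`, locally uniformly
in the exponent. -/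
theorem exists_norm_binomRemainder_le (R : ℕ) (M : ℝ) : ∃ C : ℝ, 0 ≤ C ∧ ∀ s : ℂ, ‖s‖ ≤ M →
    ∀ x : ℝ, 0 ≤ x → x ≤ 1 → ‖binomRemainder R s x‖ ≤ C * x ^ R := by
  induction R generalizing M with
  | zero =>
    refine ⟨2 ^ M, by positivity, fun s hs x hx hx1 => ?_⟩
    have h1 : (1 : ℝ) ≤ 1 + x := by linarith
    have e : (1 + (x : ℂ)) = ((1 + x : ℝ) : ℂ) := by push_cast; rfl
    simp only [binomRemainder, range_zero, sum_empty, sub_zero, pow_zero, mul_one]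
    rw [e, Complex.norm_cpow_eq_rpow_re_of_pos (by linarith)]
    have hre : (-s).re ≤ M := (Complex.re_le_norm _).trans (by simpa using hs)
    exact (Real.rpow_le_rpow_of_exponent_le h1 hre).trans
      (Real.rpow_le_rpow (by linarith) (by linarith) ((norm_nonneg s).trans hs))
  | succ R ih =>
    obtain ⟨C, hC, h⟩ := ih (M + 1)
    refine ⟨max M 0 * C, by positivity, fun s hs x hx hx1 => ?_⟩
    have hs1 : ‖s + 1‖ ≤ M + 1 := (norm_add_le _ _).trans (by simpa using hs)
    have key := norm_image_sub_le_of_norm_deriv_le_segment' (a := 0) (b := x)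
      (f := binomRemainder (R + 1) s) (f' := fun y => -s * binomRemainder R (s + 1) y)
      (C := max M 0 * (C * x ^ R))
      (fun y hy => (hasDerivAt_binomRemainder R s hy.1).hasDerivWithinAt)
      (fun y hy => by
        rw [norm_mul, norm_neg]
        refine mul_le_mul (hs.trans (le_max_left _ _))
          ((h _ hs1 y hy.1 (hy.2.le.trans hx1)).trans ?_)
          (norm_nonneg _) (le_max_right _ _)
        have := hy.1
        have := hy.2.le
        gcongr) x ⟨hx, le_rfl⟩
    have h0 : binomRemainder (R + 1) s 0 = 0 := by
      simp [binomRemainder, sum_range_succ', binomCoeff]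
    rw [h0, sub_zero, sub_zero] at key
    calc _ ≤ _ := key
      _ = _ := by ring

/-- A series of holomorphic functions on a right half-plane that is dominated, on bounded parts of
smaller half-planes, by a convergent series of constants is holomorphic. -/
theorem differentiableOn_tsum_halfPlane {ι : Type*} {f : ι → ℂ → ℂ} {B : ℝ}
    (hf : ∀ i, DifferentiableOn ℂ (f i) {s | B < s.re})
    (hb : ∀ B' > B, ∀ M : ℝ, ∃ u : ι → ℝ, Summable u ∧
      ∀ i s, B' < s.re → ‖s‖ < M → ‖f i s‖ ≤ u i) :
    DifferentiableOn ℂ (fun s => ∑' i, f i s) {s | B < s.re} := by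
  intro s hs
  obtain ⟨B', hB, hB'⟩ := exists_between (show B < s.re from hs)
  obtain ⟨u, hu, hle⟩ := hb B' hB (‖s‖ + 1)
  have hopen : IsOpen {z : ℂ | B' < z.re ∧ ‖z‖ < ‖s‖ + 1} :=
    (isOpen_lt continuous_const Complex.continuous_re).inter
      (isOpen_lt continuous_norm continuous_const)
  have := Complex.differentiableOn_tsum_of_summable_norm hu
    (fun i => (hf i).mono fun z hz => hB.trans hz.1) hopen (fun i w hw => hle i w hw.1 hw.2)
  exact (this.differentiableAt (hopen.mem_nhds ⟨hB', by linarith⟩)).differentiableWithinAt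

/-- `Z`, which need only be meaningful near `Re s = ∞`, continues meromorphically to the half-plane
`B < Re s`. -/
def ExtendsTo (B : ℝ) (Z : ℂ → ℂ) : Prop :=
  ∃ F : ℂ → ℂ, MeromorphicOn F {s | B < s.re} ∧ ∃ σ : ℝ, ∀ s : ℂ, σ < s.re → F s = Z s

namespace ExtendsTo

variable {B : ℝ} {Z W : ℂ → ℂ}

theorem congr (h : ExtendsTo B Z) {σ : ℝ} (e : ∀ s : ℂ, σ < s.re → Z s = W s) :
    ExtendsTo B W := by
  obtain ⟨F, hF, τ, hτ⟩ := h
  refine ⟨F, hF, max σ τ, fun s hs => ?_⟩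
  rw [hτ s ((le_max_right _ _).trans_lt hs), e s ((le_max_left _ _).trans_lt hs)]

theorem mono (h : ExtendsTo B Z) {B' : ℝ} (hB : B ≤ B') : ExtendsTo B' Z := by
  obtain ⟨F, hF, hτ⟩ := h
  exact ⟨F, hF.mono_set fun _ hs => hB.trans_lt hs, hτ⟩

theorem add (h : ExtendsTo B Z) (h' : ExtendsTo B W) : ExtendsTo B fun s => Z s + W s := by
  obtain ⟨F, hF, σ, hσ⟩ := h
  obtain ⟨G, hG, τ, hτ⟩ := h'
  refine ⟨F + G, hF.add hG, max σ τ, fun s hs => ?_⟩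
  simp [hσ s ((le_max_left _ _).trans_lt hs), hτ s ((le_max_right _ _).trans_lt hs)]

theorem mul (h : ExtendsTo B Z) (h' : ExtendsTo B W) : ExtendsTo B fun s => Z s * W s := by
  obtain ⟨F, hF, σ, hσ⟩ := h
  obtain ⟨G, hG, τ, hτ⟩ := h'
  refine ⟨F * G, hF.mul hG, max σ τ, fun s hs => ?_⟩
  simp [hσ s ((le_max_left _ _).trans_lt hs), hτ s ((le_max_right _ _).trans_lt hs)]

theorem of_differentiable (h : DifferentiableOn ℂ Z {s | B < s.re}) : ExtendsTo B Z :=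
  ⟨Z, fun _ hs => (h.analyticAt ((isOpen_lt continuous_const
    Complex.continuous_re).mem_nhds hs)).meromorphicAt, 0, fun _ _ => rfl⟩

theorem of_meromorphic (h : MeromorphicOn Z {s | B < s.re}) : ExtendsTo B Z :=
  ⟨Z, h, 0, fun _ _ => rfl⟩

theorem sum {ι : Type*} (t : Finset ι) {Z : ι → ℂ → ℂ} (h : ∀ i ∈ t, ExtendsTo B (Z i)) :
    ExtendsTo B fun s => ∑ i ∈ t, Z i s := by
  classical
  induction t using Finset.induction_on with
  | empty => exact of_differentiable (by simp)
  | insert a t ha ih =>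
    refine ((h a (by simp)).add (ih fun i hi => h i (by simp [hi]))).congr (σ := 0) fun s _ => ?_
    rw [Finset.sum_insert ha]

theorem comp_add (h : ExtendsTo B Z) (r : ℝ) : ExtendsTo (B - r) fun s => Z (s + r) := by
  obtain ⟨F, hF, σ, hσ⟩ := h
  refine ⟨fun s => F (s + r), fun s hs => ?_, σ - r, fun s hs => hσ _ ?_⟩
  · have h1 : MeromorphicAt F (s + r) := hF _ (by
      have : B - r < s.re := hs
      simp; linarith)
    exact h1.comp_analyticAt (f := F) (g := fun s => s + (r : ℂ)) (by fun_prop)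
  · simp; linarith

theorem of_comp_add {r : ℝ} (h : ExtendsTo (B - r) fun s => Z (s + r)) : ExtendsTo B Z := by
  have := h.comp_add (-r)
  rw [sub_neg_eq_add, sub_add_cancel] at this
  exact this.congr (σ := 0) fun s _ => by simp

end ExtendsTo

/-- The Dirichlet series `∑_{n ≥ 1} c n * n ^ (-s)`. -/
noncomputable def dirichlet (c : ℕ → ℂ) (s : ℂ) : ℂ :=
  ∑' n : ℕ, c (n + 1) * ((n + 1 : ℕ) : ℂ) ^ (-s)

section Dirichlet

variable {A : ℕ} {C : ℝ} {c : ℕ → ℂ}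

theorem norm_dirichlet_term_le (hC : 0 ≤ C) (hc : ∀ n, 1 ≤ n → ‖c n‖ ≤ C * (n : ℝ) ^ A) {σ : ℝ}
    {s : ℂ} (hs : σ ≤ s.re) (n : ℕ) :
    ‖c (n + 1) * ((n + 1 : ℕ) : ℂ) ^ (-s)‖ ≤ C * ((n + 1 : ℕ) : ℝ) ^ ((A : ℝ) - σ) := by
  have h0 : (0 : ℝ) < ((n + 1 : ℕ) : ℝ) := by positivity
  have h1 : (1 : ℝ) ≤ ((n + 1 : ℕ) : ℝ) := by exact_mod_cast Nat.succ_pos n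
  rw [norm_mul, Complex.norm_natCast_cpow_of_pos (Nat.succ_pos n)]
  calc _ ≤ C * ((n + 1 : ℕ) : ℝ) ^ A * ((n + 1 : ℕ) : ℝ) ^ (-σ) := by
        refine mul_le_mul (hc _ (Nat.succ_pos n)) ?_ (by positivity) (by positivity)
        exact Real.rpow_le_rpow_of_exponent_le h1 (by simpa using hs)
    _ = _ := by rw [mul_assoc, sub_eq_add_neg, Real.rpow_add h0, Real.rpow_natCast]

theorem summable_succ_rpow {t : ℝ} (ht : t < -1) :
    Summable fun n : ℕ => ((n + 1 : ℕ) : ℝ) ^ t :=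
  (summable_nat_add_iff 1).2 (Real.summable_nat_rpow.2 ht)

theorem summable_dirichlet (hC : 0 ≤ C) (hc : ∀ n, 1 ≤ n → ‖c n‖ ≤ C * (n : ℝ) ^ A)
    {s : ℂ} (hs : A + 1 < s.re) :
    Summable fun n : ℕ => c (n + 1) * ((n + 1 : ℕ) : ℂ) ^ (-s) :=
  Summable.of_norm_bounded ((summable_succ_rpow (t := A - s.re) (by linarith)).mul_left C)
    fun n => norm_dirichlet_term_le hC hc le_rfl n

theorem differentiable_dirichlet_term (c : ℕ → ℂ) (n : ℕ) :
    Differentiable ℂ fun s : ℂ => c (n + 1) * ((n + 1 : ℕ) : ℂ) ^ (-s) := by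
  intro s
  refine DifferentiableAt.const_mul ?_ _
  exact (differentiableAt_id.neg).const_cpow (Or.inl (by exact_mod_cast Nat.succ_ne_zero n))

theorem differentiableOn_dirichlet (hC : 0 ≤ C) (hc : ∀ n, 1 ≤ n → ‖c n‖ ≤ C * (n : ℝ) ^ A) :
    DifferentiableOn ℂ (dirichlet c) {s | (A + 1 : ℝ) < s.re} := by
  refine differentiableOn_tsum_halfPlane
    (fun n => (differentiable_dirichlet_term c n).differentiableOn) fun B' hB M => ?_
  exact ⟨_, (summable_succ_rpow (t := A - B') (by linarith)).mul_left C,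
    fun n s hs _ => norm_dirichlet_term_le hC hc hs.le n⟩

/-- The remainder in the translation formula. -/
noncomputable def translationRemainder (c : ℕ → ℂ) (R : ℕ) (s : ℂ) : ℂ :=
  ∑' n : ℕ, c (n + 1) * ((n + 1 : ℕ) : ℂ) ^ (-s) * binomRemainder R s (1 / ((n + 1 : ℕ) : ℝ))

theorem norm_translationRemainder_term_le (hC : 0 ≤ C)
    (hc : ∀ n, 1 ≤ n → ‖c n‖ ≤ C * (n : ℝ) ^ A) (R : ℕ) (σ M : ℝ) :
    ∃ D : ℝ, ∀ n : ℕ, ∀ s : ℂ, σ ≤ s.re → ‖s‖ ≤ M →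
      ‖c (n + 1) * ((n + 1 : ℕ) : ℂ) ^ (-s) * binomRemainder R s (1 / ((n + 1 : ℕ) : ℝ))‖ ≤
        D * ((n + 1 : ℕ) : ℝ) ^ ((A : ℝ) - σ - R) := by
  obtain ⟨D, hD, h⟩ := exists_norm_binomRemainder_le R M
  refine ⟨C * D, fun n s hs hM => ?_⟩
  have h0 : (0 : ℝ) < ((n + 1 : ℕ) : ℝ) := by positivity
  have h1 : (1 : ℝ) ≤ ((n + 1 : ℕ) : ℝ) := by exact_mod_cast Nat.succ_pos n
  rw [norm_mul]
  calc _ ≤ (C * ((n + 1 : ℕ) : ℝ) ^ ((A : ℝ) - σ)) * (D * (1 / ((n + 1 : ℕ) : ℝ)) ^ R) := by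
        refine mul_le_mul (norm_dirichlet_term_le hC hc hs n)
          (h s hM _ (by positivity) ?_) (norm_nonneg _) (by positivity)
        rw [div_le_one h0]; exact h1
    _ = _ := by
        rw [sub_eq_add_neg _ (R : ℝ), Real.rpow_add h0, Real.rpow_neg h0.le, Real.rpow_natCast]
        simp only [one_div, inv_pow]; ring

theorem differentiableOn_translationRemainder (hC : 0 ≤ C)
    (hc : ∀ n, 1 ≤ n → ‖c n‖ ≤ C * (n : ℝ) ^ A) (R : ℕ) :
    DifferentiableOn ℂ (translationRemainder c R) {s | (A + 1 - R : ℝ) < s.re} := by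
  refine differentiableOn_tsum_halfPlane (fun n => ?_) fun B' hB M => ?_
  · exact ((differentiable_dirichlet_term c n).mul
      (differentiable_binomRemainder R (by positivity))).differentiableOn
  · obtain ⟨D, hD⟩ := norm_translationRemainder_term_le hC hc R B' M
    exact ⟨_, (summable_succ_rpow (t := A - B' - R) (by linarith)).mul_left D,
      fun n s hs hM => hD n s hs.le hM.le⟩

/-- The translation formula: the shifted Dirichlet series `∑ c n * (n + 1) ^ (-s)`, expanded in
powers of `1 / n`. -/
theorem hasSum_translation (hC : 0 ≤ C) (hc : ∀ n, 1 ≤ n → ‖c n‖ ≤ C * (n : ℝ) ^ A) (R : ℕ)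
    {s : ℂ} (hs : A + 1 < s.re) :
    HasSum (fun n : ℕ => c (n + 1) * ((n + 2 : ℕ) : ℂ) ^ (-s))
      (∑ r ∈ range R, binomCoeff r s * dirichlet c (s + r) + translationRemainder c R s) := by
  have h1 : ∀ r ∈ range R, HasSum (fun n : ℕ => binomCoeff r s *
      (c (n + 1) * ((n + 1 : ℕ) : ℂ) ^ (-(s + r)))) (binomCoeff r s * dirichlet c (s + r)) := by
    intro r _
    refine HasSum.mul_left _ (summable_dirichlet hC hc ?_).hasSum
    simp only [Complex.add_re, Complex.natCast_re]
    have : (0 : ℝ) ≤ r := by positivity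
    linarith
  have h2 : HasSum (fun n : ℕ => c (n + 1) * ((n + 1 : ℕ) : ℂ) ^ (-s) *
      binomRemainder R s (1 / ((n + 1 : ℕ) : ℝ))) (translationRemainder c R s) := by
    obtain ⟨D, hD⟩ := norm_translationRemainder_term_le hC hc R s.re ‖s‖
    refine (Summable.of_norm_bounded ((summable_succ_rpow (t := A - s.re - R) ?_).mul_left D)
      fun n => hD n s le_rfl le_rfl).hasSum
    have : (0 : ℝ) ≤ R := by positivity
    linarith
  refine ((hasSum_sum h1).add h2).congr_fun ?_
  intro n
  have h0 : ((n + 1 : ℕ) : ℂ) ≠ 0 := by exact_mod_cast Nat.succ_ne_zero n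
  have hpow : ((n + 2 : ℕ) : ℂ) ^ (-s) = ((n + 1 : ℕ) : ℂ) ^ (-s) *
      (1 + ((1 / ((n + 1 : ℕ) : ℝ) : ℝ) : ℂ)) ^ (-s) := by
    have e : (1 + ((1 / ((n + 1 : ℕ) : ℝ) : ℝ) : ℂ)) = ((1 + 1 / ((n + 1 : ℕ) : ℝ) : ℝ) : ℂ) := by
      push_cast; rfl
    rw [e, ← Complex.ofReal_natCast (n + 1), ← Complex.mul_cpow_ofReal_nonneg (by positivity)
      (by positivity)]
    congr 1
    push_cast
    have : (n : ℂ) + 1 ≠ 0 := by exact_mod_cast h0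
    field_simp
    ring
  rw [hpow, binomRemainder]
  have : ∀ r : ℕ, ((n + 1 : ℕ) : ℂ) ^ (-(s + r)) =
      ((n + 1 : ℕ) : ℂ) ^ (-s) * ((1 / ((n + 1 : ℕ) : ℝ) : ℝ) : ℂ) ^ r := by
    intro r
    rw [neg_add, Complex.cpow_add _ _ h0, Complex.cpow_neg _ (r : ℂ), Complex.cpow_natCast]
    push_cast
    rw [one_div, inv_pow]
  simp only [this]
  rw [mul_sub, mul_sum, ← sub_eq_zero]
  rw [show ∀ a b c d : ℂ, a - (b + (c - d)) = (a - c) + (d - b) by intros; ring]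
  rw [← mul_assoc, sub_self, zero_add, sub_eq_zero]
  exact sum_congr rfl fun r _ => by ring

/-- If `h (n + 1) = δ (h n + g n)` with a sign `δ`, the translation formula expresses the Dirichlet
series of `h` at `s` through its values at `s + 1, s + 2, …` and through that of `g`; so the
continuation of the latter yields the continuation of the former, one unit strip at a time. -/
theorem extendsTo_dirichlet_of_recurrence {δ : ℂ} (hδ : δ = 1 ∨ δ = -1) {g h : ℕ → ℂ} (hC : 0 ≤ C)
    (hg : ∀ n, 1 ≤ n → ‖g n‖ ≤ C * (n : ℝ) ^ A) (hh : ∀ n, 1 ≤ n → ‖h n‖ ≤ C * (n : ℝ) ^ A)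
    (hrec : ∀ n, 1 ≤ n → h (n + 1) = δ * (h n + g n)) (hext : ∀ B, ExtendsTo B (dirichlet g))
    (B : ℝ) : ExtendsTo B (dirichlet h) := by
  have identity : ∀ (R : ℕ) (s : ℂ), A + 1 < s.re → dirichlet h s - h 1 =
      δ * ((∑ r ∈ range R, binomCoeff r s * dirichlet h (s + r) + translationRemainder h R s) +
        (∑ r ∈ range R, binomCoeff r s * dirichlet g (s + r) + translationRemainder g R s)) := by
    intro R s hs
    have e := ((hasSum_translation hC hh R hs).add (hasSum_translation hC hg R hs)).mul_left δ
    rw [← e.tsum_eq, dirichlet, (summable_dirichlet hC hh hs).tsum_eq_zero_add]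
    simp only [zero_add, Nat.cast_one, Complex.one_cpow, mul_one, add_sub_cancel_left]
    refine tsum_congr fun n => ?_
    rw [hrec (n + 1) (by omega)]
    ring
  -- everything in the translation formula other than the values of `dirichlet h`
  set E : ℕ → ℂ → ℂ := fun R s => translationRemainder h R s +
    (∑ r ∈ range R, binomCoeff r s * dirichlet g (s + r) + translationRemainder g R s) with hE
  have coeff_ext : ∀ (r : ℕ) (b : ℝ), ExtendsTo b (binomCoeff r) := fun r b =>
    .of_differentiable (differentiable_binomCoeff r).differentiableOn
  have E_ext : ∀ R : ℕ, ExtendsTo (A + 1 - R) (E R) := by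
    intro R
    refine (ExtendsTo.of_differentiable (differentiableOn_translationRemainder hC hh R)).add
      ((ExtendsTo.sum _ fun r _ => (coeff_ext r _).mul ?_).add
        (.of_differentiable (differentiableOn_translationRemainder hC hg R)))
    have := (hext (A + 1 - R + r)).comp_add r
    rw [add_sub_cancel_right] at this
    simpa using this
  have key : ∀ n : ℕ, ExtendsTo (A + 1 - n) (dirichlet h) := by
    intro n
    induction n with
    | zero => simpa using ExtendsTo.of_differentiable (differentiableOn_dirichlet hC hh)
    | succ n ih =>
      have shift : ∀ r : ℕ, ExtendsTo (A + 1 - n - r) fun s => dirichlet h (s + r) := fun r => by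
        simpa using ih.comp_add r
      rcases hδ with rfl | rfl
      · -- the terms with `r = 0` cancel, and the formula is solved for the term with `r = 1`
        refine ExtendsTo.of_comp_add (r := 1) ?_
        have hE2 := E_ext (n + 2)
        have hsum : ExtendsTo ((A : ℝ) + 1 - (n + 2 : ℕ)) fun s => ∑ r ∈ range n,
            binomCoeff (r + 2) s * dirichlet h (s + (r + 2 : ℕ)) :=
          ExtendsTo.sum _ fun r _ =>
            (coeff_ext _ _).mul ((shift (r + 2)).mono (by push_cast; linarith))
        have hinv : ExtendsTo ((A : ℝ) + 1 - (n + 2 : ℕ)) fun s : ℂ => s⁻¹ :=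
          .of_meromorphic fun s _ => (MeromorphicAt.id s).inv
        have hconst : ExtendsTo ((A : ℝ) + 1 - (n + 2 : ℕ)) fun _ : ℂ => h 1 :=
          .of_differentiable (differentiableOn_const _)
        refine ((hinv.mul (hconst.add (hsum.add hE2))).congr (σ := A + 1) fun s hs => ?_).mono
          (by push_cast; linarith)
        have hs0 : s ≠ 0 := by
          rintro rfl
          simp only [Complex.zero_re] at hs
          have : (0 : ℝ) ≤ A := by positivity
          linarith
        have := identity (n + 2) s hs
        rw [sum_range_succ', sum_range_succ'] at this
        simp only [binomCoeff, Nat.cast_zero, add_zero, zero_add, Nat.cast_one, one_mul, mul_one,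
          div_one] at this
        simp only [hE, binomCoeff, Complex.ofReal_one]
        rw [inv_mul_eq_iff_eq_mul₀ hs0]
        push_cast at this ⊢
        simp only [add_assoc, one_add_one_eq_two] at this ⊢
        linear_combination -this
      · -- the term with `r = 0` has the coefficient `2`
        have hE1 := E_ext (n + 1)
        have hsum : ExtendsTo ((A : ℝ) + 1 - (n + 1 : ℕ)) fun s => ∑ r ∈ range n,
            binomCoeff (r + 1) s * dirichlet h (s + (r + 1 : ℕ)) :=
          ExtendsTo.sum _ fun r _ =>
            (coeff_ext _ _).mul ((shift (r + 1)).mono (by push_cast; linarith))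
        have hconst : ∀ a : ℂ, ExtendsTo ((A : ℝ) + 1 - (n + 1 : ℕ)) fun _ : ℂ => a := fun a =>
          .of_differentiable (differentiableOn_const _)
        refine ((hconst (1 / 2)).mul ((hconst (h 1)).add ((hconst (-1)).mul (hsum.add hE1)))).congr
          (σ := A + 1) fun s hs => ?_
        have := identity (n + 1) s hs
        rw [sum_range_succ'] at this
        simp only [binomCoeff, Nat.cast_zero, add_zero, one_mul] at this
        simp only [hE, binomCoeff]
        linear_combination -this / 2
  obtain ⟨n, hn⟩ := exists_nat_ge ((A : ℝ) + 1 - B)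
  exact (key n).mono (by linarith)

end Dirichlet

/-- The Dirichlet series of a nested harmonic sum continues meromorphically to every right
half-plane. -/
theorem HarmonicSum.extendsTo {c : ℕ → ℂ} (hc : HarmonicSum c) (B : ℝ) :
    ExtendsTo B (dirichlet c) := by
  suffices H : ∀ δ : ℂ, δ = 1 ∨ δ = -1 → ∀ B, ExtendsTo B (dirichlet fun n => δ ^ n * c n) by
    simpa using H 1 (.inl rfl) B
  have congr_ext : ∀ {f g : ℕ → ℂ} {B : ℝ}, ExtendsTo B (dirichlet f) →
      (∀ n, 1 ≤ n → f n = g n) → ExtendsTo B (dirichlet g) := fun h e =>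
    h.congr (σ := 0) fun s _ => tsum_congr fun n => by rw [e (n + 1) (by omega)]
  -- the two signs are treated at the same time, so that the sign rule needs no argument
  have main : ∀ {f g : ℕ → ℂ}, HarmonicSum f → HarmonicSum g →
      (∀ n, 1 ≤ n → f (n + 1) = f n + g n) →
      (∀ δ : ℂ, δ = 1 ∨ δ = -1 → ∀ B, ExtendsTo B (dirichlet fun n => δ ^ n * g n)) →
      ∀ δ : ℂ, δ = 1 ∨ δ = -1 → ∀ B, ExtendsTo B (dirichlet fun n => δ ^ n * f n) := by
    intro f g hf hg hfg h δ hδ B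
    obtain ⟨A₁, C₁, hC₁, h₁⟩ := hf.exists_bound
    obtain ⟨A₂, C₂, hC₂, h₂⟩ := hg.exists_bound
    have hn : ‖δ‖ = 1 := by rcases hδ with rfl | rfl <;> simp
    have mono : ∀ (n : ℕ), 1 ≤ n → ∀ C' A', C' ≤ C₁ + C₂ → A' ≤ A₁ + A₂ →
        0 ≤ C' → C' * (n : ℝ) ^ A' ≤ (C₁ + C₂) * (n : ℝ) ^ (A₁ + A₂) := by
      intro n hn C' A' hC' hA' h0
      have h1 : (1 : ℝ) ≤ n := by exact_mod_cast hn
      gcongr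
    refine extendsTo_dirichlet_of_recurrence (A := A₁ + A₂) (C := C₁ + C₂) hδ (by positivity)
      (fun n hn' => ?_) (fun n hn' => ?_) (fun n hn' => ?_) (h δ hδ) B
    · rw [norm_mul, norm_pow, hn, one_pow, one_mul]
      exact (h₂ n hn').trans (mono n hn' _ _ (by linarith) (by omega) hC₂)
    · rw [norm_mul, norm_pow, hn, one_pow, one_mul]
      exact (h₁ n hn').trans (mono n hn' _ _ (by linarith) (by omega) hC₁)
    · rw [hfg n hn']; ring
  clear B
  induction hc with
  | one =>
    refine main .one (.const 0) (by simp) fun δ _ B => ?_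
    exact (ExtendsTo.of_differentiable (differentiableOn_const 0)).congr (σ := 0) fun s _ => by
      simp [dirichlet]
  | @add f g hf hg h₁ h₂ =>
    intro δ hδ B
    obtain ⟨A₁, C₁, hC₁, b₁⟩ := (hf.sign_pow hδ).exists_bound
    obtain ⟨A₂, C₂, hC₂, b₂⟩ := (hg.sign_pow hδ).exists_bound
    refine ((h₁ δ hδ B).add (h₂ δ hδ B)).congr (σ := A₁ + A₂ + 1) fun s hs => ?_
    have hA₁ : (0 : ℝ) ≤ A₁ := by positivity
    have hA₂ : (0 : ℝ) ≤ A₂ := by positivity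
    rw [dirichlet, dirichlet, ← (summable_dirichlet hC₁ b₁ (by linarith)).tsum_add
      (summable_dirichlet hC₂ b₂ (by linarith))]
    exact tsum_congr fun n => by ring
  | const_mul c _ h =>
    intro δ hδ B
    refine ((ExtendsTo.of_differentiable (differentiableOn_const c)).mul (h δ hδ B)).congr
      (σ := 0) fun s _ => ?_
    rw [dirichlet, ← tsum_mul_left]
    exact tsum_congr fun n => by ring
  | div _ h =>
    intro δ hδ B
    have := (h δ hδ (B + 1)).comp_add 1
    rw [add_sub_cancel_right] at this
    refine this.congr (σ := 0) fun s _ => tsum_congr fun n => ?_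
    have h0 : ((n + 1 : ℕ) : ℂ) ≠ 0 := by exact_mod_cast Nat.succ_ne_zero n
    rw [Complex.ofReal_one, neg_add, Complex.cpow_add _ _ h0, Complex.cpow_neg_one]
    ring
  | sign _ h =>
    intro δ hδ B
    refine congr_ext (h (-δ) (by rcases hδ with rfl | rfl <;> simp) B) fun n _ => ?_
    rw [neg_pow]; ring
  | congr _ e h => exact fun δ hδ B => congr_ext (h δ hδ B) fun n hn => by rw [e n hn]
  | sum hf h => exact main hf.sum hf (fun n hn => sum_Ico_succ_top hn _) h

/-! ### From half-planes to the plane -/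

/-- The identity theorem for meromorphic functions in normal form. -/
theorem eqOn_of_meromorphicNFOn {U : Set ℂ} (hc : IsPreconnected U) {F G : ℂ → ℂ}
    (hF : MeromorphicNFOn F U) (hG : MeromorphicNFOn G U) {z₀ : ℂ} (hz₀ : z₀ ∈ U)
    (h : F =ᶠ[𝓝 z₀] G) : Set.EqOn F G U := by
  have hm : MeromorphicOn (F - G) U := hF.meromorphicOn.sub hG.meromorphicOn
  have h2 : meromorphicOrderAt (F - G) z₀ = ⊤ := by
    rw [meromorphicOrderAt_eq_top_iff]
    apply Filter.Eventually.filter_mono nhdsWithin_le_nhds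
    filter_upwards [h] with s hs
    simp [hs]
  intro z hzU
  have hz : meromorphicOrderAt (F - G) z = ⊤ := by
    by_contra hz
    exact (hm.meromorphicOrderAt_ne_top_of_isPreconnected (x := z) hc hzU hz₀ hz) h2
  rw [meromorphicOrderAt_eq_top_iff] at hz
  have hz' : F =ᶠ[𝓝[≠] z] G := by
    filter_upwards [hz] with w hw
    exact sub_eq_zero.1 hw
  exact ((MeromorphicNFAt.eventuallyEq_nhdsNE_iff_eventuallyEq_nhds
    (hF hzU) (hG hzU)).1 hz').eq_of_nhds

theorem isOpen_halfPlane (B : ℝ) : IsOpen {s : ℂ | B < s.re} :=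
  isOpen_lt continuous_const Complex.continuous_re

theorem isPreconnected_halfPlane (B : ℝ) : IsPreconnected {s : ℂ | B < s.re} :=
  (convex_halfSpace_re_gt B).isPreconnected

/-- A holomorphic function on a half-plane that continues to all larger half-planes has a
meromorphic continuation to the plane. -/
theorem exists_meromorphicNFOn_univ {Z : ℂ → ℂ} {b : ℝ} (hZ : DifferentiableOn ℂ Z {s | b < s.re})
    (h : ∀ B, ExtendsTo B Z) :
    ∃ F : ℂ → ℂ, MeromorphicNFOn F Set.univ ∧ ∀ s : ℂ, b < s.re → F s = Z s := by
  -- normal forms of the continuations to the half-planes `-n < Re s`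
  have h1 : ∀ n : ℕ, ∃ G : ℂ → ℂ, MeromorphicNFOn G {s | -(n : ℝ) < s.re} ∧
      ∀ s : ℂ, max b (-(n : ℝ)) < s.re → G s = Z s := by
    intro n
    obtain ⟨F, hF, σ, hσ⟩ := h (-n)
    set U : Set ℂ := {s | -(n : ℝ) < s.re}
    have hG := meromorphicNFOn_toMeromorphicNFOn F U
    refine ⟨toMeromorphicNFOn F U, hG, ?_⟩
    set W : Set ℂ := {s | max b (-(n : ℝ)) < s.re} with hW
    have hWU : W ⊆ U := fun s hs =>
      show -(n : ℝ) < s.re from (le_max_right _ _).trans_lt (show _ < s.re from hs)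
    have hZW : MeromorphicNFOn Z W := fun s hs =>
      (hZ.analyticAt ((isOpen_halfPlane b).mem_nhds
        (show b < s.re from (le_max_left _ _).trans_lt (show _ < s.re from hs)))).meromorphicNFAt
    obtain ⟨t, ht⟩ := exists_gt (max σ (max b (-(n : ℝ))))
    have htW : (t : ℂ) ∈ W := by simpa [hW] using (max_lt_iff.1 ht).2
    refine eqOn_of_meromorphicNFOn (isPreconnected_halfPlane _)
      (fun s hs => hG (hWU hs)) hZW htW ?_
    have hne : toMeromorphicNFOn F U =ᶠ[𝓝[≠] (t : ℂ)] Z := by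
      have e2 := hF.toMeromorphicNFOn_eq_self_on_nhdsNE (hWU htW)
      have e3 : ∀ᶠ s in 𝓝[≠] (t : ℂ), F s = Z s := by
        refine Filter.Eventually.filter_mono nhdsWithin_le_nhds ?_
        filter_upwards [(isOpen_halfPlane σ).mem_nhds
          (show (t : ℂ) ∈ {s : ℂ | σ < s.re} by simpa using (max_lt_iff.1 ht).1)] with s hs
        exact hσ s hs
      filter_upwards [e2, e3] with s h1 h2
      rw [← h2, h1]
    exact (MeromorphicNFAt.eventuallyEq_nhdsNE_iff_eventuallyEq_nhds
      (hG (hWU htW)) (hZW htW)).1 hne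
  choose G hG hGZ using h1
  have agree : ∀ m n : ℕ, m ≤ n → ∀ s : ℂ, -(m : ℝ) < s.re → G m s = G n s := by
    intro m n hmn
    have hmn' : -(n : ℝ) ≤ -(m : ℝ) := by simpa using hmn
    obtain ⟨t, ht⟩ := exists_gt (max b (-(m : ℝ)))
    have htm : max b (-(m : ℝ)) < (t : ℂ).re := by simpa using ht
    refine eqOn_of_meromorphicNFOn (isPreconnected_halfPlane _) (hG m)
      (fun s hs => hG n (hmn'.trans_lt hs)) (z₀ := t) ((le_max_right _ _).trans_lt htm) ?_
    filter_upwards [(isOpen_halfPlane (max b (-(m : ℝ)))).mem_nhds htm] with s hs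
    rw [hGZ m s hs, hGZ n s ((max_le_max le_rfl hmn').trans_lt hs)]
  have idx : ∀ s : ℂ, -((⌈|s.re|⌉₊ + 1 : ℕ) : ℝ) < s.re := fun s => by
    have h1 := Nat.le_ceil |s.re|
    have h2 := neg_abs_le s.re
    push_cast; linarith
  set F : ℂ → ℂ := fun s => G (⌈|s.re|⌉₊ + 1) s with hF
  have F_eq : ∀ (n : ℕ) (s : ℂ), -(n : ℝ) < s.re → F s = G n s := fun n s hs => by
    rcases le_total n (⌈|s.re|⌉₊ + 1) with h | h
    · exact (agree _ _ h s hs).symm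
    · exact agree _ _ h s (idx s)
  refine ⟨F, fun s _ => ?_, fun s hs => ?_⟩
  · refine (meromorphicNFAt_congr ?_).1 (hG _ (idx s))
    filter_upwards [(isOpen_halfPlane _).mem_nhds (idx s)] with z hz
    exact (F_eq _ z hz).symm
  · exact hGZ _ s (max_lt hs (idx s))

/-- A series of Dirichlet type whose coefficients, collected according to the base, form a nested
harmonic sum has a meromorphic continuation. -/
theorem exists_continuation {κ : Type*} {a : ℕ × κ → ℂ} (ha : ∀ k, a (0, k) = 0)
    (hs : ∀ σ : ℝ, 1 < σ → Summable fun i : ℕ × κ => ‖a i‖ * (i.1 : ℝ) ^ (-σ))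
    {c : ℕ → ℂ} (hc : HarmonicSum c) (hac : ∀ n, 1 ≤ n → ∑' k, a (n, k) = c n) :
    ∃ F : ℂ → ℂ, MeromorphicNFOn F Set.univ ∧
      ∀ s : ℂ, 1 < s.re → HasSum (fun i : ℕ × κ => a i * (i.1 : ℂ) ^ (-s)) (F s) := by
  have norm_le : ∀ (i : ℕ × κ) (s : ℂ) (σ : ℝ), σ ≤ s.re →
      ‖a i * (i.1 : ℂ) ^ (-s)‖ ≤ ‖a i‖ * (i.1 : ℝ) ^ (-σ) := by
    rintro ⟨n, k⟩ s σ h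
    rcases Nat.eq_zero_or_pos n with rfl | hn
    · simp [ha]
    · rw [norm_mul, Complex.norm_natCast_cpow_of_pos hn]
      have : (1 : ℝ) ≤ n := by exact_mod_cast hn
      exact mul_le_mul_of_nonneg_left (Real.rpow_le_rpow_of_exponent_le this (by simpa using h))
        (norm_nonneg _)
  have summ : ∀ s : ℂ, 1 < s.re → Summable fun i : ℕ × κ => a i * (i.1 : ℂ) ^ (-s) :=
    fun s h => Summable.of_norm_bounded (hs _ h) fun i => norm_le i s _ le_rfl
  have hZ : DifferentiableOn ℂ (fun s : ℂ => ∑' i : ℕ × κ, a i * (i.1 : ℂ) ^ (-s))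
      {s | (1 : ℝ) < s.re} := by
    refine differentiableOn_tsum_halfPlane (fun i => ?_) fun B' hB M =>
      ⟨_, hs B' hB, fun i s h _ => norm_le i s B' h.le⟩
    obtain ⟨n, k⟩ := i
    rcases Nat.eq_zero_or_pos n with rfl | hn
    · simp [ha]
    · refine Differentiable.differentiableOn fun s => DifferentiableAt.const_mul ?_ _
      exact (differentiableAt_id.neg).const_cpow (Or.inl (by exact_mod_cast hn.ne'))
  obtain ⟨F, hF, hFZ⟩ := exists_meromorphicNFOn_univ hZ fun B =>
    (hc.extendsTo B).congr (σ := 1) fun s h => by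
      rw [(summ s h).tsum_prod, dirichlet, ((summ s h).prod).tsum_eq_zero_add]
      simp only [ha, zero_mul, tsum_zero, zero_add]
      refine tsum_congr fun n => ?_
      rw [← hac _ (Nat.succ_pos n), ← tsum_mul_right]
  exact ⟨F, hF, fun s h => by rw [hFZ s h]; exact (summ s h).hasSum⟩

/-! ### Single sums depending on a parameter -/

theorem sign_mul_self {η : ℂ} (hη : η = 1 ∨ η = -1) : η * η = 1 := by
  rcases hη with rfl | rfl <;> norm_num

theorem norm_sign_pow {η : ℂ} (hη : η = 1 ∨ η = -1) (n : ℕ) : ‖η ^ n‖ = 1 := by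
  rcases hη with rfl | rfl <;> simp

theorem norm_sign_pow_mul {η : ℂ} (hη : η = 1 ∨ η = -1) (n : ℕ) (z : ℂ) : ‖η ^ n * z‖ = ‖z‖ := by
  rw [norm_mul, norm_sign_pow hη, one_mul]

theorem sign_pow_mul_self {η : ℂ} (hη : η = 1 ∨ η = -1) (n : ℕ) : η ^ n * η ^ n = 1 := by
  rw [← mul_pow, sign_mul_self hη, one_pow]

theorem sign_mul {η ε : ℂ} (hη : η = 1 ∨ η = -1) (hε : ε = 1 ∨ ε = -1) :
    η * ε = 1 ∨ η * ε = -1 := by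
  rcases hη with rfl | rfl <;> rcases hε with rfl | rfl <;> simp

theorem cast_add_one_ne_zero' (w : ℕ) : (w : ℂ) + 1 ≠ 0 := by exact_mod_cast Nat.succ_ne_zero w

theorem cast_add_one_add_ne_zero (w N : ℕ) : (w : ℂ) + 1 + N ≠ 0 := by
  have : ((w + 1 + N : ℕ) : ℂ) ≠ 0 := by exact_mod_cast (by omega : w + 1 + N ≠ 0)
  simpa using this

theorem norm_cast_add_one (w : ℕ) : ‖(w : ℂ) + 1‖ = w + 1 := by
  have := Complex.norm_natCast (w + 1)
  simpa using this

theorem norm_cast_add_one_add (w N : ℕ) : ‖(w : ℂ) + 1 + N‖ = w + 1 + N := by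
  have := Complex.norm_natCast (w + 1 + N)
  simpa using this

theorem summable_sqrt_div_sq : Summable fun w : ℕ => √((w : ℝ) + 1) / ((w : ℝ) + 1) ^ 2 := by
  refine (summable_succ_rpow (t := -(3 / 2)) (by norm_num)).congr fun w => ?_
  have h : (0 : ℝ) < (w : ℝ) + 1 := by positivity
  push_cast
  rw [Real.sqrt_eq_rpow, ← Real.rpow_natCast, ← Real.rpow_sub h]
  norm_num

theorem summable_div_pow_mul_pow {u : ℕ → ℂ} {C : ℝ} (hu : ∀ w : ℕ, ‖u w‖ ≤ C * √((w : ℝ) + 1))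
    {α β : ℕ} (h : 2 ≤ α + β) (N : ℕ) :
    Summable fun w : ℕ => u w / (((w : ℂ) + 1) ^ α * ((w : ℂ) + 1 + N) ^ β) := by
  refine Summable.of_norm_bounded (summable_sqrt_div_sq.mul_left C) fun w => ?_
  have h1 : (1 : ℝ) ≤ (w : ℝ) + 1 := by
    have : (0 : ℝ) ≤ w := by positivity
    linarith
  have h0 : (0 : ℝ) < (w : ℝ) + 1 := by positivity
  rw [norm_div, norm_mul, norm_pow, norm_pow, norm_cast_add_one, norm_cast_add_one_add,
    ← mul_div_assoc]
  have hd : ((w : ℝ) + 1) ^ 2 ≤ ((w : ℝ) + 1) ^ α * ((w : ℝ) + 1 + N) ^ β := by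
    calc ((w : ℝ) + 1) ^ 2 ≤ ((w : ℝ) + 1) ^ (α + β) := pow_le_pow_right₀ h1 h
      _ = ((w : ℝ) + 1) ^ α * ((w : ℝ) + 1) ^ β := pow_add _ _ _
      _ ≤ _ := mul_le_mul_of_nonneg_left (pow_le_pow_left₀ h0.le
          (by linarith [(Nat.cast_nonneg N : (0 : ℝ) ≤ N)]) _) (by positivity)
  exact div_le_div₀ ((norm_nonneg _).trans (hu w)) (hu w) (by positivity) hd

/-- A sequence that grows at most like `√n`. -/
def SqrtBound (B : ℕ → ℂ) : Prop := ∃ C : ℝ, ∀ n : ℕ, 1 ≤ n → ‖B n‖ ≤ C * √(n : ℝ)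

theorem SqrtBound.shift {B : ℕ → ℂ} (hB : SqrtBound B) (N : ℕ) :
    ∃ C : ℝ, ∀ w : ℕ, ‖B (w + 1 + N)‖ ≤ C * √((w : ℝ) + 1) := by
  obtain ⟨C, hC⟩ := hB
  have hC0 : 0 ≤ C := by simpa using (norm_nonneg _).trans (hC 1 le_rfl)
  refine ⟨C * √((N : ℝ) + 1), fun w => (hC _ (by omega)).trans ?_⟩
  rw [mul_assoc, ← Real.sqrt_mul (by positivity)]
  gcongr
  push_cast
  have h1 : (0 : ℝ) ≤ w := by positivity
  have h2 : (0 : ℝ) ≤ N := by positivity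
  nlinarith [mul_nonneg h1 h2]

/-- The reduction by partial fractions, `N / (w (w + N)) = 1 / w - 1 / (w + N)`, of sums over `w`
with the denominators `w ^ α (w + N) ^ β`. -/
theorem harmonicSum_tsum_of_base {u : ℕ → ℕ → ℂ}
    (hu : ∀ N, ∃ C : ℝ, ∀ w : ℕ, ‖u w N‖ ≤ C * √((w : ℝ) + 1))
    (h₁ : ∀ α, 2 ≤ α → HarmonicSum fun N => ∑' w : ℕ, u w N / ((w : ℂ) + 1) ^ α)
    (h₂ : ∀ β, 2 ≤ β → HarmonicSum fun N => ∑' w : ℕ, u w N / ((w : ℂ) + 1 + N) ^ β)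
    (h₁₁ : HarmonicSum fun N =>
      ∑' w : ℕ, u w N * (1 / ((w : ℂ) + 1) - 1 / ((w : ℂ) + 1 + N)))
    (α β : ℕ) (h : 2 ≤ α + β) :
    HarmonicSum fun N => ∑' w : ℕ, u w N / (((w : ℂ) + 1) ^ α * ((w : ℂ) + 1 + N) ^ β) := by
  obtain ⟨n, hn⟩ : ∃ n, α + β = n := ⟨_, rfl⟩
  induction n generalizing α β with
  | zero => omega
  | succ n ih =>
    rcases Nat.eq_zero_or_pos α with rfl | hα
    · simpa using h₂ β (by omega)
    rcases Nat.eq_zero_or_pos β with rfl | hβ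
    · simpa using h₁ α (by omega)
    obtain ⟨α, rfl⟩ : ∃ k, α = k + 1 := ⟨α - 1, by omega⟩
    obtain ⟨β, rfl⟩ : ∃ k, β = k + 1 := ⟨β - 1, by omega⟩
    by_cases h2 : α = 0 ∧ β = 0
    · obtain ⟨rfl, rfl⟩ := h2
      refine h₁₁.div.congr fun N hN => ?_
      have hN' : (N : ℂ) ≠ 0 := by exact_mod_cast (by omega : N ≠ 0)
      rw [← tsum_div_const]
      refine tsum_congr fun w => ?_
      have := cast_add_one_ne_zero' w
      have := cast_add_one_add_ne_zero w N
      field_simp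
      ring
    · refine ((ih (α + 1) β (by omega) (by omega)).sub
        (ih α (β + 1) (by omega) (by omega))).div.congr fun N hN => ?_
      have hN' : (N : ℂ) ≠ 0 := by exact_mod_cast (by omega : N ≠ 0)
      obtain ⟨C, hC⟩ := hu N
      rw [← (summable_div_pow_mul_pow hC (by omega) N).tsum_sub
        (summable_div_pow_mul_pow hC (by omega) N), ← tsum_div_const]
      refine tsum_congr fun w => ?_
      have := cast_add_one_ne_zero' w
      have := cast_add_one_add_ne_zero w N
      field_simp
      ring

section Step

variable {B b : ℕ → ℂ} {η : ℂ}

theorem summable_of_bound {u : ℕ → ℂ} {C : ℝ} (hu : ∀ w : ℕ, ‖u w‖ ≤ C / ((w : ℝ) + 1) ^ 2) :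
    Summable u := by
  refine Summable.of_norm_bounded ((summable_succ_rpow (t := -2) (by norm_num)).mul_left C)
    fun w => (hu w).trans_eq ?_
  rw [Real.rpow_neg (by positivity), div_eq_mul_inv]
  norm_num

/-- If the increments `b` of `B` are of size `O(1 / n)`, sums over `w` involving `B (w + N)` reduce
to sums of the same kind that involve `b`. -/
theorem harmonicSum_tsum_shifted (hB : HarmonicSum B) (hs : SqrtBound B)
    (hb : ∃ C : ℝ, ∀ n : ℕ, 1 ≤ n → ‖b n‖ ≤ C / n) (hrec : ∀ n, 1 ≤ n → B (n + 1) = B n + b n)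
    (hsum : ∀ η : ℂ, η = 1 ∨ η = -1 → ∀ α, 1 ≤ α →
      HarmonicSum fun N => ∑' w : ℕ, η ^ (w + 1) * b (w + 1 + N) / ((w : ℂ) + 1) ^ α)
    (hη : η = 1 ∨ η = -1) (α β : ℕ) (h : 2 ≤ α + β) :
    HarmonicSum fun N => ∑' w : ℕ, η ^ (w + 1) * B (w + 1 + N) /
      (((w : ℂ) + 1) ^ α * ((w : ℂ) + 1 + N) ^ β) := by
  have hη2 := sign_mul_self hη
  have hu : ∀ N, ∃ C : ℝ, ∀ w : ℕ, ‖η ^ (w + 1) * B (w + 1 + N)‖ ≤ C * √((w : ℝ) + 1) := by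
    intro N
    obtain ⟨C, hC⟩ := hs.shift N
    exact ⟨C, fun w => by rw [norm_sign_pow_mul hη]; exact hC w⟩
  have sb : ∀ α, 1 ≤ α → ∀ N, Summable fun w : ℕ =>
      η ^ (w + 1) * b (w + 1 + N) / ((w : ℂ) + 1) ^ α := by
    intro α hα N
    obtain ⟨C, hC⟩ := hb
    have hC0 : 0 ≤ C := by simpa using (norm_nonneg _).trans (hC 1 le_rfl)
    refine summable_of_bound (C := C) fun w => ?_
    have h1 : (1 : ℝ) ≤ (w : ℝ) + 1 := by
      have : (0 : ℝ) ≤ w := by positivity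
      linarith
    rw [norm_div, norm_pow, norm_cast_add_one, norm_sign_pow_mul hη]
    calc _ ≤ (C / ((w : ℝ) + 1)) / ((w : ℝ) + 1) := by
          refine div_le_div₀ (by positivity) ((hC _ (by omega)).trans ?_) (by positivity)
            (le_self_pow₀ h1 (by omega))
          push_cast
          exact div_le_div_of_nonneg_left hC0 (by positivity)
            (by linarith [(Nat.cast_nonneg N : (0 : ℝ) ≤ N)])
      _ = _ := by rw [div_div, sq]
  refine harmonicSum_tsum_of_base (u := fun w N => η ^ (w + 1) * B (w + 1 + N)) hu
    (fun α hα => ?_) (fun β hβ => ?_) ?_ α β h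
  · refine (hsum η hη α (by omega)).of_recurrence (.inl rfl) fun N _ => ?_
    obtain ⟨C, hC⟩ := hu N
    have s1 : Summable fun w : ℕ => η ^ (w + 1) * B (w + 1 + N) / ((w : ℂ) + 1) ^ α := by
      simpa using summable_div_pow_mul_pow hC (α := α) (β := 0) (by omega) N
    rw [one_mul, ← s1.tsum_add (sb α (by omega) N)]
    refine tsum_congr fun w => ?_
    rw [← add_assoc, hrec _ (by omega)]
    ring
  · refine ((((hB.sign_pow hη).div_pow β).tail ?_).sign_pow hη).congr fun N _ => ?_
    · obtain ⟨C, hC⟩ := hu 0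
      simpa using summable_div_pow_mul_pow hC (α := β) (β := 0) (by omega) 0
    · rw [← tsum_mul_left]
      refine tsum_congr fun w => ?_
      rw [← mul_div_assoc, ← mul_assoc, pow_add η (w + 1) N, mul_left_comm, sign_pow_mul_self hη]
      push_cast
      ring
  · -- `G n = B n / n`; the sum is split into the parts `V`, which involves increments of `B`
    -- only, and `W`, which involves increments of `G` only
    set G : ℕ → ℂ := fun n => B n / n with hG
    set v : ℕ → ℕ → ℂ := fun N w => η ^ (w + 1) * (B (w + 1 + N) - B (w + 1)) / ((w : ℂ) + 1)
      with hv
    set y : ℕ → ℕ → ℂ := fun N w => η ^ (w + 1) * (G (w + 1) - G (w + 1 + N)) with hy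
    have uvy : ∀ N w : ℕ, η ^ (w + 1) * B (w + 1 + N) *
        (1 / ((w : ℂ) + 1) - 1 / ((w : ℂ) + 1 + N)) = v N w + y N w := by
      intro N w
      simp only [hv, hy, hG]
      push_cast
      ring
    have v_succ : ∀ N w, v (N + 1) w = v N w + η ^ (w + 1) * b (w + 1 + N) / ((w : ℂ) + 1) ^ 1 := by
      intro N w
      simp only [hv]
      rw [← add_assoc, hrec _ (by omega)]
      ring
    have sv : ∀ N, Summable (v N) := by
      intro N
      induction N with
      | zero => simp [hv]
      | succ N ih => exact (ih.add (sb 1 le_rfl N)).congr fun w => (v_succ N w).symm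
    have su : ∀ N : ℕ, Summable fun w : ℕ => η ^ (w + 1) * B (w + 1 + N) *
        (1 / ((w : ℂ) + 1) - 1 / ((w : ℂ) + 1 + N)) := by
      intro N
      obtain ⟨C, hC⟩ := hu N
      refine ((summable_div_pow_mul_pow hC (α := 1) (β := 1) le_rfl N).mul_left (N : ℂ)).congr
        fun w => ?_
      have := cast_add_one_ne_zero' w
      have := cast_add_one_add_ne_zero w N
      field_simp
      ring
    have sy : ∀ N, Summable (y N) := fun N =>
      ((su N).sub (sv N)).congr fun w => by rw [uvy]; ring
    have hV : HarmonicSum fun N => ∑' w, v N w := by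
      refine (hsum η hη 1 le_rfl).of_recurrence (.inl rfl) fun N _ => ?_
      rw [one_mul, ← (sv N).tsum_add (sb 1 le_rfl N)]
      exact tsum_congr fun w => v_succ N w
    have hY : HarmonicSum fun N => ∑' w, y N w := by
      refine (hB.div.add (.const (∑' w, y 1 w - G 1))).of_recurrence' hη fun N => ?_
      have e : η * ∑' w, y N w = G 1 - G (N + 1) + η * ∑' w, y N (w + 1) := by
        rw [(sy N).tsum_eq_zero_add]
        simp only [hy, zero_add, pow_one, add_comm 1 N]
        rw [mul_add, ← mul_assoc, hη2, one_mul]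
      have e2 : ∑' w, y (N + 1) w = η * ∑' w, y N (w + 1) + ∑' w, y 1 w := by
        rw [← tsum_mul_left, ← (((summable_nat_add_iff 1).2 (sy N)).mul_left η).tsum_add (sy 1)]
        refine tsum_congr fun w => ?_
        simp only [hy]
        rw [show w + 1 + 1 + N = w + 1 + (N + 1) by ring, pow_succ η (w + 1)]
        linear_combination -(η ^ (w + 1) * (G (w + 1 + 1) - G (w + 1 + (N + 1)))) * hη2
      rw [e2]
      linear_combination -e
    refine (hV.add hY).congr fun N _ => ?_
    rw [← (sv N).tsum_add (sy N)]
    exact tsum_congr fun w => (uvy N w).symm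

/-- The analogue of `harmonicSum_tsum_shifted` for sums that involve `B w`. -/
theorem harmonicSum_tsum_unshifted (hs : SqrtBound B)
    (hb : ∃ C : ℝ, ∀ n : ℕ, 1 ≤ n → ‖b n‖ ≤ C / n) (hrec : ∀ n, 1 ≤ n → B (n + 1) = B n + b n)
    (hsum : ∀ η : ℂ, η = 1 ∨ η = -1 → ∀ β, 1 ≤ β →
      HarmonicSum fun N => ∑' w : ℕ, η ^ (w + 1) * b (w + 1) / ((w : ℂ) + 1 + N) ^ β)
    (hη : η = 1 ∨ η = -1) (α β : ℕ) (h : 2 ≤ α + β) :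
    HarmonicSum fun N => ∑' w : ℕ, η ^ (w + 1) * B (w + 1) /
      (((w : ℂ) + 1) ^ α * ((w : ℂ) + 1 + N) ^ β) := by
  have hη2 := sign_mul_self hη
  have hu : ∃ C : ℝ, ∀ w : ℕ, ‖η ^ (w + 1) * B (w + 1)‖ ≤ C * √((w : ℝ) + 1) := by
    obtain ⟨C, hC⟩ := hs.shift 0
    exact ⟨C, fun w => by rw [norm_sign_pow_mul hη]; exact hC w⟩
  have sb : ∀ β, 1 ≤ β → ∀ N : ℕ, Summable fun w : ℕ =>
      η ^ (w + 1) * b (w + 1) / ((w : ℂ) + 1 + N) ^ β := by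
    intro β hβ N
    obtain ⟨C, hC⟩ := hb
    have hC0 : 0 ≤ C := by simpa using (norm_nonneg _).trans (hC 1 le_rfl)
    refine summable_of_bound (C := C) fun w => ?_
    have hN : (0 : ℝ) ≤ N := by positivity
    have h1 : (1 : ℝ) ≤ (w : ℝ) + 1 + N := by
      have : (0 : ℝ) ≤ w := by positivity
      linarith
    rw [norm_div, norm_pow, norm_cast_add_one_add, norm_sign_pow_mul hη]
    calc _ ≤ (C / ((w : ℝ) + 1)) / ((w : ℝ) + 1) := by
          refine div_le_div₀ (by positivity) ((hC _ (by omega)).trans ?_) (by positivity)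
            (le_trans (by linarith) (le_self_pow₀ h1 (by omega)))
          push_cast
          exact le_rfl
      _ = _ := by rw [div_div, sq]
  obtain ⟨C, hC⟩ := hu
  have s2 : ∀ α β N : ℕ, 2 ≤ α + β → Summable fun w : ℕ =>
      η ^ (w + 1) * B (w + 1) / (((w : ℂ) + 1) ^ α * ((w : ℂ) + 1 + N) ^ β) :=
    fun α β N h => summable_div_pow_mul_pow hC h N
  refine harmonicSum_tsum_of_base (u := fun w _ => η ^ (w + 1) * B (w + 1)) (fun _ => ⟨C, hC⟩)
    (fun α _ => .const _) (fun β hβ => ?_) ?_ α β h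
  · refine (((HarmonicSum.const (-B 1)).div_pow β).sub (hsum η hη β (by omega))).of_recurrence' hη
      fun N => ?_
    have s3 : ∀ N : ℕ, Summable fun w : ℕ => η ^ (w + 1) * B (w + 1) / ((w : ℂ) + 1 + N) ^ β :=
      fun N => by simpa using s2 0 β N (by omega)
    rw [(s3 N).tsum_eq_zero_add, mul_add, ← tsum_mul_left]
    have e : ∑' w : ℕ, η ^ (w + 1) * B (w + 1) / ((w : ℂ) + 1 + (N + 1 : ℕ)) ^ β =
        ∑' w : ℕ, η * (η ^ (w + 1 + 1) * B (w + 1 + 1) / (((w + 1 : ℕ) : ℂ) + 1 + N) ^ β) -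
        ∑' w : ℕ, η ^ (w + 1) * b (w + 1) / ((w : ℂ) + 1 + (N + 1 : ℕ)) ^ β := by
      rw [← (((summable_nat_add_iff 1).2 (s3 N)).mul_left η).tsum_sub (sb β (by omega) (N + 1))]
      refine tsum_congr fun w => ?_
      rw [hrec (w + 1) (by omega), pow_succ η (w + 1)]
      push_cast
      rw [show (w : ℂ) + 1 + 1 + N = w + 1 + (N + 1) by ring]
      linear_combination
        -(η ^ (w + 1) * (B (w + 1) + b (w + 1)) / ((w : ℂ) + 1 + (N + 1)) ^ β) * hη2
    rw [e]
    push_cast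
    simp only [zero_add, pow_one]
    rw [add_comm (1 : ℂ) N]
    linear_combination (-B 1 / ((N : ℂ) + 1) ^ β) * hη2
  · set y : ℕ → ℕ → ℂ := fun N w => η ^ (w + 1) * B (w + 1) *
        (1 / ((w : ℂ) + 1) - 1 / ((w : ℂ) + 1 + N)) with hy
    set d : ℕ → ℂ := fun w => η ^ (w + 1) *
      (B (w + 1) / ((w : ℂ) + 1) - B (w + 1 + 1) / ((w : ℂ) + 1 + 1)) with hd
    have sy : ∀ N, Summable (y N) := by
      intro N
      refine ((s2 1 1 N le_rfl).mul_left (N : ℂ)).congr fun w => ?_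
      have := cast_add_one_ne_zero' w
      have := cast_add_one_add_ne_zero w N
      simp only [hy]
      field_simp
      ring
    have sd : Summable d := by
      refine ((s2 1 1 1 le_rfl).sub (sb 1 le_rfl 1)).congr fun w => ?_
      have := cast_add_one_ne_zero' w
      have h2 := cast_add_one_add_ne_zero w 1
      simp only [hd, hrec _ (Nat.succ_pos w)]
      push_cast at h2 ⊢
      field_simp
      ring
    refine ((((HarmonicSum.const (B 1)).div_pow 1).add (.const (∑' w, d w - B 1))).add
      (hsum η hη 1 le_rfl)).of_recurrence' hη fun N => ?_
    have e : η * ∑' w, y N w = (1 - 1 / ((N : ℂ) + 1)) * B 1 + η * ∑' w, y N (w + 1) := by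
      rw [(sy N).tsum_eq_zero_add]
      simp only [hy, zero_add, pow_one, Nat.cast_zero, div_one]
      rw [add_comm (1 : ℂ) N, mul_add]
      linear_combination ((1 - 1 / ((N : ℂ) + 1)) * B 1) * hη2
    have e2 : ∑' w, y (N + 1) w = η * ∑' w, y N (w + 1) + ∑' w, d w +
        ∑' w : ℕ, η ^ (w + 1) * b (w + 1) / ((w : ℂ) + 1 + (N + 1 : ℕ)) ^ 1 := by
      have s4 := ((summable_nat_add_iff 1).2 (sy N)).mul_left η
      rw [← tsum_mul_left, ← s4.tsum_add sd, ← (s4.add sd).tsum_add (sb 1 le_rfl (N + 1))]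
      refine tsum_congr fun w => ?_
      simp only [hy, hd, hrec _ (Nat.succ_pos w)]
      push_cast
      rw [show (w : ℂ) + 1 + 1 + N = w + 1 + (N + 1) by ring, pow_succ η (w + 1)]
      linear_combination -(η ^ (w + 1) * (B (w + 1) + b (w + 1)) *
        (1 / ((w : ℂ) + 1 + 1) - 1 / ((w : ℂ) + 1 + (N + 1)))) * hη2
    rw [e2]
    push_cast
    linear_combination -e

/-- Convolution sums over `0 < w < N` that involve `B w` reduce to those that involve the increments
`b` of `B`. -/
theorem harmonicSum_sum_Ico (hB : HarmonicSum B) (hrec : ∀ n, 1 ≤ n → B (n + 1) = B n + b n)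
    (hsum : ∀ η : ℂ, η = 1 ∨ η = -1 → ∀ β, 1 ≤ β →
      HarmonicSum fun N => ∑ w ∈ Ico 1 N, η ^ w * b w / ((N : ℂ) - w) ^ β)
    (hη : η = 1 ∨ η = -1) (α β : ℕ) :
    HarmonicSum fun N => ∑ w ∈ Ico 1 N, η ^ w * B w / ((w : ℂ) ^ α * ((N : ℂ) - w) ^ β) := by
  have hη2 := sign_mul_self hη
  induction α generalizing β with
  | zero =>
    rcases Nat.eq_zero_or_pos β with rfl | hβ
    · simpa using (hB.sign_pow hη).sum
    simp only [pow_zero, one_mul]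
    refine (((HarmonicSum.const (B 1)).div_pow β).add (hsum η hη β hβ)).of_recurrence hη
      fun N hN => ?_
    rw [sum_eq_sum_Ico_succ_bot (by omega), ← sum_Ico_add', mul_add, mul_add, mul_sum, mul_sum,
      add_left_comm, ← sum_add_distrib]
    congr 1
    · push_cast
      rw [add_sub_cancel_right]
      ring
    · refine sum_congr rfl fun w hw => ?_
      rw [hrec w (mem_Ico.1 hw).1]
      push_cast
      ring
  | succ α ih =>
    induction β with
    | zero => simpa using ((hB.sign_pow hη).div_pow (α + 1)).sum
    | succ β ih' =>
      refine ((ih (β + 1)).add ih').div.congr fun N hN => ?_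
      rw [← sum_add_distrib, sum_div]
      refine sum_congr rfl fun w hw => ?_
      rw [mem_Ico] at hw
      have hN' : (N : ℂ) ≠ 0 := by exact_mod_cast (by omega : N ≠ 0)
      have h1 : (w : ℂ) ≠ 0 := by exact_mod_cast (by omega : w ≠ 0)
      have h2 : (N : ℂ) - w ≠ 0 := sub_ne_zero.2 (by exact_mod_cast (by omega : N ≠ w))
      field_simp
      ring

end Step

/-- The partial sums `∑_{1 ≤ k < n} ε ^ k / k ^ i`. -/
noncomputable def altHarmonic (ε : ℂ) (i n : ℕ) : ℂ := ∑ k ∈ Ico 1 n, ε ^ k / (k : ℂ) ^ i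

section AltHarmonic

variable {ε η : ℂ}

theorem altHarmonic_succ (ε : ℂ) (i : ℕ) {n : ℕ} (hn : 1 ≤ n) :
    altHarmonic ε i (n + 1) = altHarmonic ε i n + ε ^ n / (n : ℂ) ^ i :=
  sum_Ico_succ_top hn _

theorem harmonicSum_sign (hε : ε = 1 ∨ ε = -1) : HarmonicSum fun n => ε ^ n :=
  (HarmonicSum.one.sign_pow hε).congr fun _ _ => mul_one _

theorem harmonicSum_altHarmonic (hε : ε = 1 ∨ ε = -1) (i : ℕ) : HarmonicSum (altHarmonic ε i) :=
  ((harmonicSum_sign hε).div_pow i).sum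

theorem norm_sign_div_pow_le (hε : ε = 1 ∨ ε = -1) {i : ℕ} (hi : 1 ≤ i) {n : ℕ} (hn : 1 ≤ n) :
    ‖ε ^ n / (n : ℂ) ^ i‖ ≤ 1 / n := by
  have h1 : (1 : ℝ) ≤ n := by exact_mod_cast hn
  rw [norm_div, norm_sign_pow hε, norm_pow, Complex.norm_natCast]
  exact one_div_le_one_div_of_le (by positivity) (le_self_pow₀ h1 (by omega))

theorem sqrtBound_altHarmonic (hε : ε = 1 ∨ ε = -1) {i : ℕ} (hi : 1 ≤ i) :
    SqrtBound (altHarmonic ε i) := by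
  refine ⟨3, fun n hn => ?_⟩
  induction n, hn using Nat.le_induction with
  | base => simp [altHarmonic]
  | succ n hn ih =>
    rw [altHarmonic_succ ε i hn]
    refine (norm_add_le _ _).trans ((add_le_add ih (norm_sign_div_pow_le hε hi hn)).trans ?_)
    have h1 : (1 : ℝ) ≤ n := by exact_mod_cast hn
    have hs : √(n : ℝ) ≤ n := by
      rw [Real.sqrt_le_left (by linarith)]; nlinarith
    have hs' : √((n : ℝ) + 1) ≤ 2 * n := by
      rw [Real.sqrt_le_left (by linarith)]; nlinarith
    have h2 := Real.mul_self_sqrt (show (0 : ℝ) ≤ n by linarith)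
    have h3 := Real.mul_self_sqrt (show (0 : ℝ) ≤ (n : ℝ) + 1 by linarith)
    have h4 : √(n : ℝ) ≤ √((n : ℝ) + 1) := Real.sqrt_le_sqrt (by linarith)
    push_cast
    rw [← le_sub_iff_add_le', div_le_iff₀ (by linarith)]
    -- `(√(n + 1) - √n) (√(n + 1) + √n) = 1`, and the second factor is at most `3 n`
    nlinarith [mul_le_mul_of_nonneg_left (add_le_add hs' hs) (sub_nonneg.2 h4)]

theorem sqrtBound_one : SqrtBound fun _ => 1 :=
  ⟨1, fun n hn => by simpa using hn⟩

theorem harmonicSum_tsum_one (hη : η = 1 ∨ η = -1) {α β : ℕ} (h : 2 ≤ α + β) :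
    HarmonicSum fun N => ∑' w : ℕ, η ^ (w + 1) / (((w : ℂ) + 1) ^ α * ((w : ℂ) + 1 + N) ^ β) := by
  have := harmonicSum_tsum_shifted (B := fun _ => 1) (b := fun _ => 0) .one sqrtBound_one
    ⟨0, by simp⟩ (by simp) (fun η _ α _ => by simpa using HarmonicSum.const 0) hη α β h
  simpa using this

theorem harmonicSum_tsum_altHarmonic_shifted (hη : η = 1 ∨ η = -1) (hε : ε = 1 ∨ ε = -1) {i : ℕ}
    (hi : 1 ≤ i) {α β : ℕ} (h : 2 ≤ α + β) :
    HarmonicSum fun N => ∑' w : ℕ, η ^ (w + 1) * altHarmonic ε i (w + 1 + N) /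
      (((w : ℂ) + 1) ^ α * ((w : ℂ) + 1 + N) ^ β) := by
  refine harmonicSum_tsum_shifted (harmonicSum_altHarmonic hε i) (sqrtBound_altHarmonic hε hi)
    ⟨1, fun n hn => norm_sign_div_pow_le hε hi hn⟩ (fun n hn => altHarmonic_succ ε i hn)
    (fun η hη α hα => ?_) hη α β h
  refine ((harmonicSum_tsum_one (sign_mul hη hε) (α := α) (β := i) (by omega)).sign_pow hε).congr
    fun N _ => ?_
  rw [← tsum_mul_left]
  refine tsum_congr fun w => ?_
  push_cast
  rw [pow_add ε (w + 1) N, mul_pow]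
  field_simp

theorem harmonicSum_tsum_altHarmonic (hη : η = 1 ∨ η = -1) (hε : ε = 1 ∨ ε = -1) {i : ℕ}
    (hi : 1 ≤ i) {α β : ℕ} (h : 2 ≤ α + β) :
    HarmonicSum fun N => ∑' w : ℕ, η ^ (w + 1) * altHarmonic ε i (w + 1) /
      (((w : ℂ) + 1) ^ α * ((w : ℂ) + 1 + N) ^ β) := by
  refine harmonicSum_tsum_unshifted (sqrtBound_altHarmonic hε hi)
    ⟨1, fun n hn => norm_sign_div_pow_le hε hi hn⟩ (fun n hn => altHarmonic_succ ε i hn)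
    (fun η hη β hβ => ?_) hη α β h
  refine (harmonicSum_tsum_one (sign_mul hη hε) (α := i) (β := β) (by omega)).congr fun N _ => ?_
  refine tsum_congr fun w => ?_
  push_cast
  rw [mul_pow]
  field_simp

theorem harmonicSum_sum_Ico_one (hη : η = 1 ∨ η = -1) (α β : ℕ) :
    HarmonicSum fun N => ∑ w ∈ Ico 1 N, η ^ w / ((w : ℂ) ^ α * ((N : ℂ) - w) ^ β) := by
  have := harmonicSum_sum_Ico (B := fun _ => 1) (b := fun _ => 0) .one (by simp)
    (fun η _ β _ => by simpa using HarmonicSum.const 0) hη α β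
  simpa using this

theorem harmonicSum_sum_Ico_altHarmonic (hη : η = 1 ∨ η = -1) (hε : ε = 1 ∨ ε = -1) (i α β : ℕ) :
    HarmonicSum fun N => ∑ w ∈ Ico 1 N,
      η ^ w * altHarmonic ε i w / ((w : ℂ) ^ α * ((N : ℂ) - w) ^ β) := by
  refine harmonicSum_sum_Ico (harmonicSum_altHarmonic hε i) (fun n hn => altHarmonic_succ ε i hn)
    (fun η hη β hβ => ?_) hη α β
  refine (harmonicSum_sum_Ico_one (sign_mul hη hε) i β).congr fun N _ => sum_congr rfl fun w _ => ?_
  rw [mul_pow]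
  field_simp

/-- Reversal of a sum over `0 < w < N`. -/
theorem sum_Ico_one_reflect (f : ℕ → ℂ) (N : ℕ) :
    ∑ w ∈ Ico 1 N, f (N - w) = ∑ w ∈ Ico 1 N, f w := by
  rcases Nat.eq_zero_or_pos N with rfl | hN
  · simp
  · rw [sum_Ico_reflect f 1 (by omega)]
    congr 2
    omega

theorem sign_pow_sub (hη : η = 1 ∨ η = -1) {w N : ℕ} (h : w ≤ N) :
    η ^ (N - w) = η ^ N * η ^ w := by
  obtain ⟨k, rfl⟩ := Nat.exists_eq_add_of_le h
  rw [Nat.add_sub_cancel_left, pow_add, mul_right_comm, sign_pow_mul_self hη, one_mul]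

theorem harmonicSum_sum_Ico_altHarmonic_sub (hη : η = 1 ∨ η = -1) (hε : ε = 1 ∨ ε = -1)
    (i α β : ℕ) :
    HarmonicSum fun N => ∑ w ∈ Ico 1 N,
      η ^ w * altHarmonic ε i (N - w) / ((w : ℂ) ^ α * ((N : ℂ) - w) ^ β) := by
  refine ((harmonicSum_sum_Ico_altHarmonic hη hε i β α).sign_pow hη).congr fun N _ => ?_
  rw [← sum_Ico_one_reflect, mul_sum]
  refine sum_congr rfl fun w hw => ?_
  have h := (mem_Ico.1 hw).2.le
  rw [sign_pow_sub hη h, Nat.cast_sub h, sub_sub_cancel, mul_comm (((N : ℂ) - w) ^ β),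
    ← mul_div_assoc]
  congr 1
  rw [← mul_assoc, ← mul_assoc, sign_pow_mul_self hη, one_mul]

theorem summable_sign_div (hη : η = 1 ∨ η = -1) {α β : ℕ} (h : 2 ≤ α + β) (N : ℕ) :
    Summable fun w : ℕ => η ^ (w + 1) / (((w : ℂ) + 1) ^ α * ((w : ℂ) + 1 + N) ^ β) := by
  refine summable_div_pow_mul_pow (C := 1) (fun w => ?_) h N
  rw [norm_sign_pow hη, one_mul, Real.one_le_sqrt]
  linarith [(Nat.cast_nonneg w : (0 : ℝ) ≤ w)]

/-- The shifted zeta values `∑_{v ≥ 1} η ^ v / (v + n) ^ r`, in terms of partial sums. -/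
theorem exists_tsum_shift (hη : η = 1 ∨ η = -1) {r : ℕ} (hr : 2 ≤ r) : ∃ c : ℂ, ∀ n : ℕ, 1 ≤ n →
    ∑' v : ℕ, η ^ (v + 1) / ((v : ℂ) + 1 + n) ^ r =
      c * η ^ n - η ^ n * altHarmonic η r n - 1 / (n : ℂ) ^ r := by
  refine ⟨∑' v : ℕ, η ^ (v + 1) / ((v : ℂ) + 1) ^ r, fun n hn => ?_⟩
  have s : Summable fun v : ℕ => η ^ (v + 1) / ((v : ℂ) + 1) ^ r := by
    simpa using summable_sign_div hη (α := r) (β := 0) (by omega) 0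
  have h1 : η ^ n * altHarmonic η r (n + 1) =
      η ^ n * altHarmonic η r n + 1 / (n : ℂ) ^ r := by
    rw [altHarmonic_succ η r hn, mul_add, ← mul_div_assoc, sign_pow_mul_self hη]
  have h2 : altHarmonic η r (n + 1) = ∑ k ∈ range n, η ^ (k + 1) / ((k : ℂ) + 1) ^ r := by
    rw [altHarmonic, sum_Ico_eq_sum_range]
    refine sum_congr rfl fun k _ => ?_
    push_cast
    rw [add_comm 1 k, add_comm (1 : ℂ)]
  rw [sub_sub, ← h1, ← s.sum_add_tsum_nat_add n, h2, mul_comm _ (η ^ n), ← mul_sub,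
    add_sub_cancel_left, ← tsum_mul_left]
  refine tsum_congr fun v => ?_
  rw [show v + n + 1 = v + 1 + n by ring, pow_add η (v + 1) n, ← mul_div_assoc, mul_left_comm,
    sign_pow_mul_self hη]
  push_cast
  ring

/-- The sums `∑_{v ≥ 1} η ^ v (1 / v - 1 / (v + n))`, in terms of partial sums. -/
theorem exists_tsum_sub (hη : η = 1 ∨ η = -1) : ∃ c₁ c₂ : ℂ, ∀ n : ℕ, 1 ≤ n →
    ∑' v : ℕ, η ^ (v + 1) * (1 / ((v : ℂ) + 1) - 1 / ((v : ℂ) + 1 + n)) =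
      c₁ + c₂ * η ^ n + η ^ n * altHarmonic η 1 n + 1 / (n : ℂ) := by
  have hη2 := sign_mul_self hη
  set y : ℕ → ℕ → ℂ := fun N v => η ^ (v + 1) * (1 / ((v : ℂ) + 1) - 1 / ((v : ℂ) + 1 + N)) with hy
  have sy : ∀ N, Summable (y N) := by
    intro N
    refine ((summable_sign_div hη (α := 1) (β := 1) le_rfl N).mul_left (N : ℂ)).congr fun w => ?_
    have := cast_add_one_ne_zero' w
    have := cast_add_one_add_ne_zero w N
    simp only [hy]
    field_simp
    ring
  have rec_y : ∀ N : ℕ, ∑' v, y (N + 1) v =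
      η * ∑' v, y N v + (∑' v, y 1 v - 1) + 1 / ((N : ℂ) + 1) := by
    intro N
    have e : η * ∑' w, y N w = (1 - 1 / ((N : ℂ) + 1)) + η * ∑' w, y N (w + 1) := by
      rw [(sy N).tsum_eq_zero_add]
      simp only [hy, zero_add, pow_one, Nat.cast_zero, div_one]
      rw [add_comm (1 : ℂ) N, mul_add]
      linear_combination (1 - 1 / ((N : ℂ) + 1)) * hη2
    have e2 : ∑' w, y (N + 1) w = η * ∑' w, y N (w + 1) + ∑' w, y 1 w := by
      rw [← tsum_mul_left, ← (((summable_nat_add_iff 1).2 (sy N)).mul_left η).tsum_add (sy 1)]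
      refine tsum_congr fun w => ?_
      simp only [hy]
      push_cast
      rw [show (w : ℂ) + 1 + 1 + N = w + 1 + (N + 1) by ring, pow_succ η (w + 1)]
      linear_combination
        -(η ^ (w + 1) * (1 / ((w : ℂ) + 1 + 1) - 1 / ((w : ℂ) + 1 + (N + 1)))) * hη2
    rw [e2]
    linear_combination -e
  set κ : ℂ := ∑' v, y 1 v - 1 with hκ
  have y0 : ∑' v, y 0 v = 0 := by simp [hy]
  -- for `η = 1` the recurrence at `N = 1` forces `κ = 0`, by telescoping
  obtain ⟨c, hc⟩ : ∃ c, c = η * c + κ := by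
    rcases hη with rfl | rfl
    · refine ⟨0, ?_⟩
      have hs : HasSum (y 1) 1 := by
        rw [(sy 1).hasSum_iff_tendsto_nat]
        have e : ∀ n : ℕ, ∑ v ∈ range n, y 1 v = 1 - 1 / ((n : ℂ) + 1) := by
          intro n
          induction n with
          | zero => simp
          | succ n ih => rw [sum_range_succ, ih]; simp [hy]
        simp only [e]
        simpa using (tendsto_const_nhds (x := (1 : ℂ))).sub
          (tendsto_one_div_add_atTop_nhds_zero_nat (𝕜 := ℂ))
      rw [hκ, hs.tsum_eq]; ring
    · exact ⟨κ / 2, by ring⟩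
  refine ⟨c, -c, fun n hn => ?_⟩
  change ∑' v, y n v = _
  induction n, hn using Nat.le_induction with
  | base =>
    have := rec_y 0
    rw [y0] at this
    simp only [altHarmonic, Ico_self, sum_empty, mul_zero, add_zero, Nat.cast_one, div_one, pow_one]
    rw [this, Nat.cast_zero]
    linear_combination -hc
  | succ n hn ih =>
    rw [rec_y n, ih, altHarmonic_succ η 1 hn]
    have e := sign_pow_mul_self hη n
    have hn' : (n : ℂ) ≠ 0 := by exact_mod_cast (by omega : n ≠ 0)
    push_cast
    rw [pow_one, pow_succ]
    linear_combination -hc - η / n * e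

end AltHarmonic

/-! ### Double sums depending on a parameter -/

/-- A class `P` of functions on `S` that is closed under the operations needed to carry out, by
partial fractions, a summation over `v` of products of powers of `v`, `v + x` and `v + y`: it is
a vector space, closed under division by `x`, `y` and `y - x`, and contains the signs and the
partial sums of the (alternating) harmonic series at `x` and `y`. -/
structure PartialFractionClass {Ω : Type*} (S : Set Ω) (x y : Ω → ℕ) (P : (Ω → ℂ) → Prop) :
    Prop where
  congr : ∀ {f g : Ω → ℂ}, P f → (∀ ω ∈ S, f ω = g ω) → P g
  add : ∀ {f g : Ω → ℂ}, P f → P g → P fun ω => f ω + g ω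
  const_mul : ∀ (c : ℂ) {f : Ω → ℂ}, P f → P fun ω => c * f ω
  div_fst : ∀ {f : Ω → ℂ}, P f → P fun ω => f ω / x ω
  div_snd : ∀ {f : Ω → ℂ}, P f → P fun ω => f ω / y ω
  div_sub : ∀ {f : Ω → ℂ}, P f → P fun ω => f ω / ((y ω : ℂ) - x ω)
  sign_fst : ∀ {η : ℂ}, η = 1 ∨ η = -1 → P fun ω => η ^ x ω
  sign_snd : ∀ {η : ℂ}, η = 1 ∨ η = -1 → P fun ω => η ^ y ω
  altHarmonic_fst : ∀ {η : ℂ}, η = 1 ∨ η = -1 → ∀ {i : ℕ}, 1 ≤ i →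
    P fun ω => η ^ x ω * altHarmonic η i (x ω)
  altHarmonic_snd : ∀ {η : ℂ}, η = 1 ∨ η = -1 → ∀ {i : ℕ}, 1 ≤ i →
    P fun ω => η ^ y ω * altHarmonic η i (y ω)
  ne : ∀ ω ∈ S, 0 < x ω ∧ 0 < y ω ∧ x ω ≠ y ω

/-- The sum over `v ≥ 1` of `η ^ v / (v ^ i (v + x) ^ j (v + y) ^ k)`. -/
noncomputable def innerSum (η : ℂ) (i j k x y : ℕ) : ℂ :=
  ∑' v : ℕ, η ^ (v + 1) / (((v : ℂ) + 1) ^ i * ((v : ℂ) + 1 + x) ^ j * ((v : ℂ) + 1 + y) ^ k)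

section Inner

variable {η : ℂ}

theorem summable_innerSum (hη : η = 1 ∨ η = -1) {i j k : ℕ} (h : 2 ≤ i + j + k) (x y : ℕ) :
    Summable fun v : ℕ =>
      η ^ (v + 1) / (((v : ℂ) + 1) ^ i * ((v : ℂ) + 1 + x) ^ j * ((v : ℂ) + 1 + y) ^ k) := by
  refine summable_of_bound (C := 1) fun v => ?_
  have h1 : (1 : ℝ) ≤ (v : ℝ) + 1 := by
    have : (0 : ℝ) ≤ v := by positivity
    linarith
  have h0 : (0 : ℝ) < (v : ℝ) + 1 := by positivity
  rw [norm_div, norm_mul, norm_mul, norm_pow ((v : ℂ) + 1), norm_pow ((v : ℂ) + 1 + x),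
    norm_pow ((v : ℂ) + 1 + y), norm_cast_add_one, norm_cast_add_one_add, norm_cast_add_one_add,
    norm_sign_pow hη]
  refine one_div_le_one_div_of_le (by positivity) ?_
  have hle : ∀ (z n : ℕ), ((v : ℝ) + 1) ^ n ≤ ((v : ℝ) + 1 + z) ^ n := fun z n =>
    pow_le_pow_left₀ h0.le (by linarith [(Nat.cast_nonneg z : (0 : ℝ) ≤ z)]) n
  calc ((v : ℝ) + 1) ^ 2 ≤ ((v : ℝ) + 1) ^ (i + j + k) := pow_le_pow_right₀ h1 h
    _ = ((v : ℝ) + 1) ^ i * ((v : ℝ) + 1) ^ j * ((v : ℝ) + 1) ^ k := by rw [pow_add, pow_add]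
    _ ≤ _ := by
      have := hle x j
      have := hle y k
      gcongr

variable {Ω : Type*} {S : Set Ω} {x y : Ω → ℕ} {P : (Ω → ℂ) → Prop}

theorem PartialFractionClass.sub (hP : PartialFractionClass S x y P) {f g : Ω → ℂ} (hf : P f)
    (hg : P g) : P fun ω => f ω - g ω :=
  hP.congr (hP.add hf (hP.const_mul (-1) hg)) fun ω _ => by ring

theorem PartialFractionClass.const (hP : PartialFractionClass S x y P) (c : ℂ) : P fun _ => c :=
  hP.congr (hP.const_mul c (hP.sign_fst (.inl rfl))) fun ω _ => by simp

/-- One of the three linear relations between `v`, `v + x` and `v + y` lowers the total degree as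
long as two of the three exponents are positive. -/
theorem PartialFractionClass.innerSum (hP : PartialFractionClass S x y P)
    (hη : η = 1 ∨ η = -1) {i j k : ℕ} (h : 2 ≤ i + j + k) :
    P fun ω => innerSum η i j k (x ω) (y ω) := by
  have inv_fst : ∀ r : ℕ, P fun ω => 1 / (x ω : ℂ) ^ r := by
    intro r
    induction r with
    | zero => simpa using hP.const 1
    | succ r ih => exact hP.congr (hP.div_fst ih) fun ω _ => by rw [pow_succ, div_div]
  have inv_snd : ∀ r : ℕ, P fun ω => 1 / (y ω : ℂ) ^ r := by
    intro r
    induction r with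
    | zero => simpa using hP.const 1
    | succ r ih => exact hP.congr (hP.div_snd ih) fun ω _ => by rw [pow_succ, div_div]
  -- the sums with only one denominator
  have tail_fst : ∀ r : ℕ, 2 ≤ r → P fun ω => WeightLatticeZeta.innerSum η 0 r 0 (x ω) (y ω) := by
    intro r hr
    obtain ⟨c, hc⟩ := exists_tsum_shift hη hr
    refine hP.congr (hP.sub (hP.sub (hP.const_mul c (hP.sign_fst hη))
      (hP.altHarmonic_fst hη (i := r) (by omega))) (inv_fst r)) fun ω hω => ?_
    rw [← hc _ (hP.ne ω hω).1]
    simp [WeightLatticeZeta.innerSum]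
  have tail_snd : ∀ r : ℕ, 2 ≤ r → P fun ω => WeightLatticeZeta.innerSum η 0 0 r (x ω) (y ω) := by
    intro r hr
    obtain ⟨c, hc⟩ := exists_tsum_shift hη hr
    refine hP.congr (hP.sub (hP.sub (hP.const_mul c (hP.sign_snd hη))
      (hP.altHarmonic_snd hη (i := r) (by omega))) (inv_snd r)) fun ω hω => ?_
    rw [← hc _ (hP.ne ω hω).2.1]
    simp [WeightLatticeZeta.innerSum]
  -- the sums with two simple denominators
  set X : ℕ → ℂ := fun n => ∑' v : ℕ, η ^ (v + 1) * (1 / ((v : ℂ) + 1) - 1 / ((v : ℂ) + 1 + n))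
  have sX : ∀ n : ℕ, Summable fun v : ℕ =>
      η ^ (v + 1) * (1 / ((v : ℂ) + 1) - 1 / ((v : ℂ) + 1 + n)) := by
    intro n
    refine ((summable_sign_div hη (α := 1) (β := 1) le_rfl n).mul_left (n : ℂ)).congr fun w => ?_
    have := cast_add_one_ne_zero' w
    have := cast_add_one_add_ne_zero w n
    field_simp
    ring
  obtain ⟨c₁, c₂, hc⟩ := exists_tsum_sub hη
  have X_fst : P fun ω => X (x ω) :=
    hP.congr (hP.add (hP.add (hP.add (hP.const c₁) (hP.const_mul c₂ (hP.sign_fst hη)))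
      (hP.altHarmonic_fst hη (i := 1) le_rfl)) (inv_fst 1)) fun ω hω => by
        rw [pow_one]; exact (hc _ (hP.ne ω hω).1).symm
  have X_snd : P fun ω => X (y ω) :=
    hP.congr (hP.add (hP.add (hP.add (hP.const c₁) (hP.const_mul c₂ (hP.sign_snd hη)))
      (hP.altHarmonic_snd hη (i := 1) le_rfl)) (inv_snd 1)) fun ω hω => by
        rw [pow_one]; exact (hc _ (hP.ne ω hω).2.1).symm
  have hne : ∀ ω ∈ S, (x ω : ℂ) ≠ 0 ∧ (y ω : ℂ) ≠ 0 ∧ (y ω : ℂ) - x ω ≠ 0 := by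
    intro ω hω
    obtain ⟨h1, h2, h3⟩ := hP.ne ω hω
    exact ⟨by exact_mod_cast h1.ne', by exact_mod_cast h2.ne',
      sub_ne_zero.2 (by exact_mod_cast h3.symm)⟩
  obtain ⟨n, hn⟩ : ∃ n, i + j + k = n := ⟨_, rfl⟩
  induction n generalizing i j k with
  | zero => omega
  | succ n ih =>
    have s := fun {i j k : ℕ} (h : 2 ≤ i + j + k) ω => summable_innerSum hη h (x ω) (y ω)
    rcases i with - | i
    · rcases j with - | j
      · exact tail_snd k (by omega)
      rcases k with - | k
      · exact tail_fst (j + 1) (by omega)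
      by_cases h2 : j = 0 ∧ k = 0
      · obtain ⟨rfl, rfl⟩ := h2
        refine hP.congr (hP.div_sub (hP.sub X_snd X_fst)) fun ω hω => ?_
        have h3 := (hne ω hω).2.2
        rw [← (sX (y ω)).tsum_sub (sX (x ω)), ← tsum_div_const]
        refine tsum_congr fun v => ?_
        have := cast_add_one_add_ne_zero v (x ω)
        have := cast_add_one_add_ne_zero v (y ω)
        field_simp
        ring
      · refine hP.congr (hP.div_sub (hP.sub
          (ih (i := 0) (j := j + 1) (k := k) (by omega) (by omega))
          (ih (i := 0) (j := j) (k := k + 1) (by omega) (by omega)))) fun ω hω => ?_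
        have h3 := (hne ω hω).2.2
        rw [WeightLatticeZeta.innerSum, WeightLatticeZeta.innerSum,
          ← (s (by omega) ω).tsum_sub (s (by omega) ω), ← tsum_div_const]
        refine tsum_congr fun v => ?_
        have := cast_add_one_add_ne_zero v (x ω)
        have := cast_add_one_add_ne_zero v (y ω)
        field_simp
        ring
    · rcases j with - | j
      · rcases k with - | k
        · exact hP.congr (hP.const (WeightLatticeZeta.innerSum η (i + 1) 0 0 0 0)) fun ω _ => by
            simp [WeightLatticeZeta.innerSum]
        by_cases h2 : i = 0 ∧ k = 0
        · obtain ⟨rfl, rfl⟩ := h2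
          refine hP.congr (hP.div_snd X_snd) fun ω hω => ?_
          have h3 := (hne ω hω).2.1
          rw [← tsum_div_const]
          refine tsum_congr fun v => ?_
          have := cast_add_one_ne_zero' v
          have := cast_add_one_add_ne_zero v (y ω)
          field_simp
          ring
        · refine hP.congr (hP.div_snd (hP.sub
            (ih (i := i + 1) (j := 0) (k := k) (by omega) (by omega))
            (ih (i := i) (j := 0) (k := k + 1) (by omega) (by omega)))) fun ω hω => ?_
          have h3 := (hne ω hω).2.1
          rw [WeightLatticeZeta.innerSum, WeightLatticeZeta.innerSum,
            ← (s (by omega) ω).tsum_sub (s (by omega) ω), ← tsum_div_const]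
          refine tsum_congr fun v => ?_
          have := cast_add_one_ne_zero' v
          have := cast_add_one_add_ne_zero v (y ω)
          field_simp
          ring
      · by_cases h2 : i = 0 ∧ j = 0 ∧ k = 0
        · obtain ⟨rfl, rfl, rfl⟩ := h2
          refine hP.congr (hP.div_fst X_fst) fun ω hω => ?_
          have h3 := (hne ω hω).1
          rw [← tsum_div_const]
          refine tsum_congr fun v => ?_
          have := cast_add_one_ne_zero' v
          have := cast_add_one_add_ne_zero v (x ω)
          field_simp
          ring
        · refine hP.congr (hP.div_fst (hP.sub
            (ih (i := i + 1) (j := j) (k := k) (by omega) (by omega))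
            (ih (i := i) (j := j + 1) (k := k) (by omega) (by omega)))) fun ω hω => ?_
          have h3 := (hne ω hω).1
          rw [WeightLatticeZeta.innerSum, WeightLatticeZeta.innerSum,
            ← (s (by omega) ω).tsum_sub (s (by omega) ω), ← tsum_div_const]
          refine tsum_congr fun v => ?_
          have := cast_add_one_ne_zero' v
          have := cast_add_one_add_ne_zero v (x ω)
          have := cast_add_one_add_ne_zero v (y ω)
          field_simp
          ring

end Inner

/-- The functions `D (w, N)` all of whose weighted sums over `w ≥ 1`, with weights
`η ^ w / (w ^ α (w + N) ^ β)`, are nested harmonic sums in `N`. -/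
def InfClass (D : ℕ × ℕ → ℂ) : Prop :=
  (∀ N, 1 ≤ N → ∃ C : ℝ, ∀ w : ℕ, ‖D (w + 1, N)‖ ≤ C * √((w : ℝ) + 1)) ∧
  ∀ η : ℂ, η = 1 ∨ η = -1 → ∀ α β : ℕ, 2 ≤ α + β → HarmonicSum fun N =>
    ∑' w : ℕ, η ^ (w + 1) * D (w + 1, N) / (((w : ℂ) + 1) ^ α * ((w : ℂ) + 1 + N) ^ β)

namespace InfClass

variable {D E : ℕ × ℕ → ℂ} {η : ℂ}

theorem congr (hD : InfClass D) (h : ∀ w N, 1 ≤ w → 1 ≤ N → D (w, N) = E (w, N)) : InfClass E := by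
  refine ⟨fun N hN => ?_, fun η hη α β hαβ => (hD.2 η hη α β hαβ).congr fun N hN => ?_⟩
  · obtain ⟨C, hC⟩ := hD.1 N hN
    exact ⟨C, fun w => by rw [← h _ _ (by omega) hN]; exact hC w⟩
  · exact tsum_congr fun w => by rw [h _ _ (by omega) hN]

theorem summable (hD : InfClass D) (hη : η = 1 ∨ η = -1) {α β : ℕ} (h : 2 ≤ α + β) {N : ℕ}
    (hN : 1 ≤ N) : Summable fun w : ℕ =>
      η ^ (w + 1) * D (w + 1, N) / (((w : ℂ) + 1) ^ α * ((w : ℂ) + 1 + N) ^ β) := by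
  obtain ⟨C, hC⟩ := hD.1 N hN
  exact summable_div_pow_mul_pow (fun w => by rw [norm_sign_pow_mul hη]; exact hC w) h N

theorem add (hD : InfClass D) (hE : InfClass E) : InfClass fun ω => D ω + E ω := by
  refine ⟨fun N hN => ?_, fun η hη α β h =>
    ((hD.2 η hη α β h).add (hE.2 η hη α β h)).congr fun N hN => ?_⟩
  · obtain ⟨C, hC⟩ := hD.1 N hN
    obtain ⟨C', hC'⟩ := hE.1 N hN
    exact ⟨C + C', fun w => (norm_add_le _ _).trans
      (by rw [add_mul]; exact add_le_add (hC w) (hC' w))⟩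
  · rw [← (hD.summable hη h hN).tsum_add (hE.summable hη h hN)]
    exact tsum_congr fun w => by ring

theorem mul_snd (hD : InfClass D) {c : ℕ → ℂ} (hc : HarmonicSum c) :
    InfClass fun ω => c ω.2 * D ω := by
  refine ⟨fun N hN => ?_, fun η hη α β h => (hc.mul (hD.2 η hη α β h)).congr fun N _ => ?_⟩
  · obtain ⟨C, hC⟩ := hD.1 N hN
    refine ⟨‖c N‖ * C, fun w => ?_⟩
    rw [norm_mul, mul_assoc]
    exact mul_le_mul_of_nonneg_left (hC w) (norm_nonneg _)
  · rw [← tsum_mul_left]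
    exact tsum_congr fun w => by ring

theorem sign_mul_fst (hD : InfClass D) (hη : η = 1 ∨ η = -1) : InfClass fun ω => η ^ ω.1 * D ω := by
  refine ⟨fun N hN => ?_, fun ε hε α β h =>
    (hD.2 _ (sign_mul hε hη) α β h).congr fun N _ => tsum_congr fun w => ?_⟩
  · simpa only [norm_sign_pow_mul hη] using hD.1 N hN
  · rw [mul_pow, mul_assoc]

theorem div_fst (hD : InfClass D) : InfClass fun ω => D ω / ω.1 := by
  refine ⟨fun N hN => ?_, fun ε hε α β h =>
    (hD.2 _ hε (α + 1) β (by omega)).congr fun N _ => tsum_congr fun w => ?_⟩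
  · obtain ⟨C, hC⟩ := hD.1 N hN
    refine ⟨C, fun w => le_trans ?_ (hC w)⟩
    rw [norm_div, Complex.norm_natCast]
    exact div_le_self (norm_nonneg _) (by exact_mod_cast Nat.succ_pos w)
  · push_cast
    rw [pow_succ ((w : ℂ) + 1) α]
    simp only [div_eq_mul_inv, mul_inv]
    ring

theorem div_add (hD : InfClass D) : InfClass fun ω => D ω / ((ω.1 + ω.2 : ℕ) : ℂ) := by
  refine ⟨fun N hN => ?_, fun ε hε α β h =>
    (hD.2 _ hε α (β + 1) (by omega)).congr fun N _ => tsum_congr fun w => ?_⟩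
  · obtain ⟨C, hC⟩ := hD.1 N hN
    refine ⟨C, fun w => le_trans ?_ (hC w)⟩
    rw [norm_div, Complex.norm_natCast]
    exact div_le_self (norm_nonneg _) (by exact_mod_cast (by omega : 1 ≤ w + 1 + N))
  · push_cast
    rw [pow_succ ((w : ℂ) + 1 + N) β]
    simp only [div_eq_mul_inv, mul_inv]
    ring

theorem one : InfClass fun _ => 1 := by
  refine ⟨fun N _ => ?_, fun η hη α β h => by simpa using harmonicSum_tsum_one hη h⟩
  simpa using sqrtBound_one.shift 0

theorem altHarmonic_fst {ε : ℂ} (hε : ε = 1 ∨ ε = -1) {i : ℕ} (hi : 1 ≤ i) :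
    InfClass fun ω => altHarmonic ε i ω.1 :=
  ⟨fun _ _ => (sqrtBound_altHarmonic hε hi).shift 0,
    fun _ hη _ _ h => harmonicSum_tsum_altHarmonic hη hε hi h⟩

theorem altHarmonic_add {ε : ℂ} (hε : ε = 1 ∨ ε = -1) {i : ℕ} (hi : 1 ≤ i) :
    InfClass fun ω => altHarmonic ε i (ω.1 + ω.2) :=
  ⟨fun N _ => (sqrtBound_altHarmonic hε hi).shift N,
    fun _ hη _ _ h => harmonicSum_tsum_altHarmonic_shifted hη hε hi h⟩

theorem snd {c : ℕ → ℂ} (hc : HarmonicSum c) : InfClass fun ω => c ω.2 :=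
  (one.mul_snd hc).congr fun _ _ _ _ => mul_one _

theorem const_mul (c : ℂ) (hD : InfClass D) : InfClass fun ω => c * D ω :=
  hD.mul_snd (.const c)

theorem div_snd (hD : InfClass D) : InfClass fun ω => D ω / ω.2 :=
  (hD.mul_snd HarmonicSum.one.div).congr fun _ _ _ _ => by ring

theorem sign_fst (hη : η = 1 ∨ η = -1) : InfClass fun ω => η ^ ω.1 :=
  (one.sign_mul_fst hη).congr fun _ _ _ _ => mul_one _

theorem sign_add (hη : η = 1 ∨ η = -1) : InfClass fun ω => η ^ (ω.1 + ω.2) :=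
  ((sign_fst hη).mul_snd (harmonicSum_sign hη)).congr fun w N _ _ => by
    rw [pow_add, mul_comm]

theorem sign_mul_altHarmonic_add (hη : η = 1 ∨ η = -1) {i : ℕ} (hi : 1 ≤ i) :
    InfClass fun ω => η ^ (ω.1 + ω.2) * altHarmonic η i (ω.1 + ω.2) :=
  (((altHarmonic_add hη hi).sign_mul_fst hη).mul_snd (harmonicSum_sign hη)).congr fun w N _ _ => by
    simp only [pow_add]; ring

/-- The class is stable for the inner sums with the poles `0, w, w + N`. -/
theorem partialFractionClass_fst :
    PartialFractionClass {ω : ℕ × ℕ | 1 ≤ ω.1 ∧ 1 ≤ ω.2} Prod.fst (fun ω => ω.1 + ω.2)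
      InfClass where
  congr hf h := hf.congr fun w N hw hN => h (w, N) ⟨hw, hN⟩
  add := add
  const_mul c _ h := const_mul c h
  div_fst := div_fst
  div_snd := div_add
  div_sub hf := hf.div_snd.congr fun w N _ _ => by simp
  sign_fst := sign_fst
  sign_snd := sign_add
  altHarmonic_fst hη _ hi := (altHarmonic_fst hη hi).sign_mul_fst hη
  altHarmonic_snd := sign_mul_altHarmonic_add
  ne ω h := by
    obtain ⟨h1, h2⟩ := h
    exact ⟨by omega, by omega, by omega⟩

/-- The class is stable for the inner sums with the poles `0, N, w + N`. -/
theorem partialFractionClass_snd :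
    PartialFractionClass {ω : ℕ × ℕ | 1 ≤ ω.1 ∧ 1 ≤ ω.2} Prod.snd (fun ω => ω.1 + ω.2)
      InfClass where
  congr hf h := hf.congr fun w N hw hN => h (w, N) ⟨hw, hN⟩
  add := add
  const_mul c _ h := const_mul c h
  div_fst := div_snd
  div_snd := div_add
  div_sub hf := hf.div_fst.congr fun w N _ _ => by simp
  sign_fst hη := snd (harmonicSum_sign hη)
  sign_snd := sign_add
  altHarmonic_fst hη _ _ := snd ((harmonicSum_altHarmonic hη _).sign_pow hη)
  altHarmonic_snd := sign_mul_altHarmonic_add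
  ne ω h := by
    obtain ⟨h1, h2⟩ := h
    exact ⟨by omega, by omega, by omega⟩

end InfClass

/-- The functions `D (w, N)` all of whose weighted sums over `0 < w < N`, with weights
`η ^ w / (w ^ α (N - w) ^ β)`, are nested harmonic sums in `N`. -/
structure FinClass (D : ℕ × ℕ → ℂ) : Prop where
  harmonicSum : ∀ η : ℂ, η = 1 ∨ η = -1 → ∀ α β : ℕ, HarmonicSum fun N =>
    ∑ w ∈ Ico 1 N, η ^ w * D (w, N) / ((w : ℂ) ^ α * ((N : ℂ) - w) ^ β)

namespace FinClass

variable {D E : ℕ × ℕ → ℂ} {η : ℂ}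

theorem congr (hD : FinClass D) (h : ∀ w N, 1 ≤ w → w < N → D (w, N) = E (w, N)) : FinClass E :=
  ⟨fun η hη α β => (hD.harmonicSum η hη α β).congr fun _ _ => sum_congr rfl fun w hw => by
    rw [h _ _ (mem_Ico.1 hw).1 (mem_Ico.1 hw).2]⟩

theorem add (hD : FinClass D) (hE : FinClass E) : FinClass fun ω => D ω + E ω :=
  ⟨fun η hη α β => ((hD.harmonicSum η hη α β).add (hE.harmonicSum η hη α β)).congr fun N _ => by
    rw [← sum_add_distrib]
    exact sum_congr rfl fun w _ => by ring⟩

theorem mul_snd (hD : FinClass D) {c : ℕ → ℂ} (hc : HarmonicSum c) :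
    FinClass fun ω => c ω.2 * D ω :=
  ⟨fun η hη α β => (hc.mul (hD.harmonicSum η hη α β)).congr fun N _ => by
    rw [mul_sum]
    exact sum_congr rfl fun w _ => by ring⟩

theorem sign_mul_fst (hD : FinClass D) (hη : η = 1 ∨ η = -1) : FinClass fun ω => η ^ ω.1 * D ω :=
  ⟨fun _ hε α β => (hD.harmonicSum _ (sign_mul hε hη) α β).congr fun N _ =>
    sum_congr rfl fun w _ => by rw [mul_pow, mul_assoc]⟩

theorem div_fst (hD : FinClass D) : FinClass fun ω => D ω / ω.1 :=
  ⟨fun _ hε α β => (hD.harmonicSum _ hε (α + 1) β).congr fun N _ => sum_congr rfl fun w _ => by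
    rw [pow_succ]
    simp only [div_eq_mul_inv, mul_inv]
    ring⟩

theorem div_sub (hD : FinClass D) : FinClass fun ω => D ω / ((ω.2 : ℂ) - ω.1) :=
  ⟨fun _ hε α β => (hD.harmonicSum _ hε α (β + 1)).congr fun N _ => sum_congr rfl fun w _ => by
    rw [pow_succ]
    simp only [div_eq_mul_inv, mul_inv]
    ring⟩

theorem one : FinClass fun _ => 1 :=
  ⟨fun η hη α β => by simpa using harmonicSum_sum_Ico_one hη α β⟩

theorem snd {c : ℕ → ℂ} (hc : HarmonicSum c) : FinClass fun ω => c ω.2 :=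
  (one.mul_snd hc).congr fun _ _ _ _ => mul_one _

theorem const_mul (c : ℂ) (hD : FinClass D) : FinClass fun ω => c * D ω :=
  hD.mul_snd (.const c)

theorem sub (hD : FinClass D) (hE : FinClass E) : FinClass fun ω => D ω - E ω :=
  (hD.add (hE.const_mul (-1))).congr fun _ _ _ _ => by ring

theorem div_snd (hD : FinClass D) : FinClass fun ω => D ω / ω.2 :=
  (hD.mul_snd HarmonicSum.one.div).congr fun _ _ _ _ => by ring

theorem sign_fst (hη : η = 1 ∨ η = -1) : FinClass fun ω => η ^ ω.1 :=
  (one.sign_mul_fst hη).congr fun _ _ _ _ => mul_one _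

theorem altHarmonic_fst {ε : ℂ} (hε : ε = 1 ∨ ε = -1) (i : ℕ) :
    FinClass fun ω => altHarmonic ε i ω.1 :=
  ⟨fun _ hη α β => harmonicSum_sum_Ico_altHarmonic hη hε i α β⟩

theorem altHarmonic_sub {ε : ℂ} (hε : ε = 1 ∨ ε = -1) (i : ℕ) :
    FinClass fun ω => altHarmonic ε i (ω.2 - ω.1) :=
  ⟨fun _ hη α β => harmonicSum_sum_Ico_altHarmonic_sub hη hε i α β⟩

/-- The class is stable for the inner sums with the poles `0, w, N`. -/
theorem partialFractionClass :
    PartialFractionClass {ω : ℕ × ℕ | 1 ≤ ω.1 ∧ ω.1 < ω.2} Prod.fst Prod.snd FinClass where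
  congr hf h := hf.congr fun w N hw hN => h (w, N) ⟨hw, hN⟩
  add := add
  const_mul c _ h := const_mul c h
  div_fst := div_fst
  div_snd := div_snd
  div_sub := div_sub
  sign_fst := sign_fst
  sign_snd hη := snd (harmonicSum_sign hη)
  altHarmonic_fst hη _ _ := (altHarmonic_fst hη _).sign_mul_fst hη
  altHarmonic_snd hη _ _ := snd ((harmonicSum_altHarmonic hη _).sign_pow hη)
  ne ω h := by
    obtain ⟨h1, h2⟩ := h
    exact ⟨by omega, by omega, by omega⟩

/-- The class is stable for the finite inner sums over `0 < v < w` with the denominators `v`,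
`w - v` and `v + N - w`. -/
theorem sum_Ico (hη : η = 1 ∨ η = -1) (i j k : ℕ) (h : 1 ≤ i + j + k) : FinClass fun ω =>
    ∑ v ∈ Ico 1 ω.1, η ^ v / ((v : ℂ) ^ i * ((ω.1 : ℂ) - v) ^ j * ((v : ℂ) + ω.2 - ω.1) ^ k) := by
  obtain ⟨n, hn⟩ : ∃ n, i + j + k = n := ⟨_, rfl⟩
  have hne : ∀ {w N v : ℕ}, w < N → v ∈ Ico 1 w → (v : ℂ) ≠ 0 ∧ (w : ℂ) - v ≠ 0 ∧
      (v : ℂ) + N - w ≠ 0 ∧ (w : ℂ) ≠ 0 ∧ (N : ℂ) ≠ 0 ∧ (N : ℂ) - w ≠ 0 := by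
    intro w N v hN hv
    rw [mem_Ico] at hv
    refine ⟨by exact_mod_cast (by omega : v ≠ 0), sub_ne_zero.2 (by exact_mod_cast hv.2.ne'),
      sub_ne_zero.2 (by exact_mod_cast (by omega : v + N ≠ w)),
      by exact_mod_cast (by omega : w ≠ 0), by exact_mod_cast (by omega : N ≠ 0),
      sub_ne_zero.2 (by exact_mod_cast hN.ne')⟩
  induction n generalizing i j k with
  | zero => omega
  | succ n ih =>
    rcases i with - | i
    · rcases j with - | j
      · refine ((((snd (harmonicSum_altHarmonic hη k)).sub (altHarmonic_sub hη k)).sign_mul_fst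
          hη).mul_snd (harmonicSum_sign hη)).sub (?_ : FinClass fun ω => 1 / ((ω.2 : ℂ) - ω.1) ^ k)
          |>.congr fun w N hw hN => ?_
        · clear hn h
          induction k with
          | zero => simpa using one
          | succ k ih => exact ih.div_sub.congr fun w N _ _ => by rw [pow_succ, div_div]
        · -- the sum runs over the integers `N - w < m < N`
          obtain ⟨d, rfl⟩ : ∃ d, N = w + d := ⟨N - w, by omega⟩
          have hd : 1 ≤ d := by omega
          have e : altHarmonic η k (w + d) =
              altHarmonic η k d + η ^ d / (d : ℂ) ^ k +
                ∑ v ∈ Ico 1 w, η ^ (v + d) / (v + d : ℂ) ^ k := by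
            rw [← altHarmonic_succ η k hd, altHarmonic, altHarmonic,
              ← sum_Ico_consecutive _ (by omega : 1 ≤ d + 1) (by omega : d + 1 ≤ w + d)]
            congr 1
            rw [add_comm d 1, ← sum_Ico_add']
            refine sum_congr rfl fun v _ => by push_cast; rfl
          simp only [Nat.add_sub_cancel_left]
          rw [e]
          have e2 := sign_pow_mul_self hη d
          have e3 := sign_pow_mul_self hη w
          have e4 : ∑ v ∈ Ico 1 w, η ^ (v + d) / (v + d : ℂ) ^ k =
              η ^ d * ∑ v ∈ Ico 1 w, η ^ v / ((v : ℂ) + (w + d : ℕ) - w) ^ k := by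
            rw [mul_sum]
            refine sum_congr rfl fun v _ => ?_
            push_cast
            rw [pow_add, show (v : ℂ) + (w + d) - w = v + d by ring]
            ring
          rw [e4, pow_add]
          simp only [pow_zero, one_mul]
          push_cast
          rw [show (w : ℂ) + d - w = d by ring]
          set s := ∑ v ∈ Ico 1 w, η ^ v / ((v : ℂ) + (w + d) - w) ^ k
          linear_combination (η ^ w * η ^ w * (1 / (d : ℂ) ^ k + s)) * e2 +
            (1 / (d : ℂ) ^ k + s) * e3
      rcases k with - | k
      · refine ((altHarmonic_fst hη (j + 1)).sign_mul_fst hη).congr fun w N hw hN => ?_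
        simp only [pow_zero, one_mul, mul_one]
        rw [altHarmonic, mul_sum, ← sum_Ico_one_reflect]
        refine sum_congr rfl fun v hv => ?_
        have hv' := (mem_Ico.1 hv).2.le
        rw [sign_pow_sub hη hv', Nat.cast_sub hv', mul_div_assoc, ← mul_assoc,
          sign_pow_mul_self hη, one_mul]
      · refine ((ih 0 (j + 1) k (by omega) (by omega)).add
          (ih 0 j (k + 1) (by omega) (by omega))).div_snd.congr fun w N hw hN => ?_
        rw [← sum_add_distrib, sum_div]
        refine sum_congr rfl fun v hv => ?_
        obtain ⟨h1, h2, h3, h4, h5, h6⟩ := hne hN hv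
        field_simp
        ring
    · rcases j with - | j
      · rcases k with - | k
        · refine (altHarmonic_fst hη (i + 1)).congr fun w N hw hN => ?_
          simp [altHarmonic]
        · refine ((ih (i + 1) 0 k (by omega) (by omega)).sub
            (ih i 0 (k + 1) (by omega) (by omega))).div_sub.congr fun w N hw hN => ?_
          rw [← sum_sub_distrib, sum_div]
          refine sum_congr rfl fun v hv => ?_
          obtain ⟨h1, h2, h3, h4, h5, h6⟩ := hne hN hv
          field_simp
          ring
      · refine ((ih (i + 1) j k (by omega) (by omega)).add
          (ih i (j + 1) k (by omega) (by omega))).div_fst.congr fun w N hw hN => ?_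
        rw [← sum_add_distrib, sum_div]
        refine sum_congr rfl fun v hv => ?_
        obtain ⟨h1, h2, h3, h4, h5, h6⟩ := hne hN hv
        field_simp
        ring

end FinClass

/-! ### The triple series and their continuation -/

/-- The values of the six positive coroots at the weight `m₁ λ₁ + m₂ λ₂ + m₃ λ₃`. -/
def corootValue (m : ℕ × ℕ × ℕ) : Fin 6 → ℕ :=
  ![m.1, m.2.1, m.2.2, m.1 + m.2.1, m.2.1 + m.2.2, m.1 + m.2.1 + m.2.2]

/-- The strictly dominant weights, in terms of their coefficients. -/
def IsPositive (m : ℕ × ℕ × ℕ) : Prop := 1 ≤ m.1 ∧ 1 ≤ m.2.1 ∧ 1 ≤ m.2.2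

instance : DecidablePred IsPositive := fun m => by unfold IsPositive; infer_instance

theorem IsPositive.one_le_corootValue {m : ℕ × ℕ × ℕ} (hm : IsPositive m) (i : Fin 6) :
    1 ≤ corootValue m i := by
  obtain ⟨h1, h2, h3⟩ := hm
  fin_cases i <;> simp [corootValue] <;> omega

/-- The terms of the triple series with integral exponents, twisted by the character
`η ^ (m₁ + m₃)` of the weight lattice modulo `L₁`. -/
noncomputable def tripleTerm (η : ℂ) (k : Fin 6 → ℕ) (m : ℕ × ℕ × ℕ) : ℂ :=
  if IsPositive m then η ^ (m.1 + m.2.2) / ∏ i, (corootValue m i : ℂ) ^ k i else 0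

/-- The average of the terms over the two characters. -/
noncomputable def evenTerm (k : Fin 6 → ℕ) (m : ℕ × ℕ × ℕ) : ℂ :=
  (tripleTerm 1 k m + tripleTerm (-1) k m) / 2

theorem tripleTerm_of_not_isPositive {η : ℂ} {k : Fin 6 → ℕ} {m : ℕ × ℕ × ℕ} (hm : ¬ IsPositive m) :
    tripleTerm η k m = 0 := if_neg hm

theorem summable_inv_sq_prod :
    Summable fun m : ℕ × ℕ × ℕ =>
      1 / (m.1 : ℝ) ^ 2 * (1 / (m.2.1 : ℝ) ^ 2 * (1 / (m.2.2 : ℝ) ^ 2)) := by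
  have h : Summable fun n : ℕ => 1 / (n : ℝ) ^ 2 := Real.summable_one_div_nat_pow.2 (by norm_num)
  exact h.mul_of_nonneg (h.mul_of_nonneg h (fun _ => by positivity) fun _ => by positivity)
    (fun _ => by positivity) fun _ => by positivity

/-- All series over the strictly dominant weights with exponents at least `1` are dominated by
`∑ 1 / (m₁ m₂ m₃) ^ 2`. -/
theorem inv_prod_corootValue_le {m : ℕ × ℕ × ℕ} (hm : IsPositive m) :
    (∏ i, (corootValue m i : ℝ))⁻¹ ≤
      1 / (m.1 : ℝ) ^ 2 * (1 / (m.2.1 : ℝ) ^ 2 * (1 / (m.2.2 : ℝ) ^ 2)) := by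
  obtain ⟨h1, h2, h3⟩ := hm
  obtain ⟨x, y, z⟩ := m
  simp only at h1 h2 h3 ⊢
  have hx : (1 : ℝ) ≤ x := by exact_mod_cast h1
  have hy : (1 : ℝ) ≤ y := by exact_mod_cast h2
  have hz : (1 : ℝ) ≤ z := by exact_mod_cast h3
  rw [← one_div, one_div_mul_one_div, one_div_mul_one_div]
  refine one_div_le_one_div_of_le (by positivity) ?_
  simp only [Fin.prod_univ_six, corootValue]
  simp
  calc (x : ℝ) ^ 2 * (y ^ 2 * z ^ 2) = x * y * z * x * z * y := by ring
    _ ≤ x * y * z * (x + y) * (y + z) * (x + y + z) := by gcongr <;> linarith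

theorem norm_tripleTerm_le {η : ℂ} (hη : η = 1 ∨ η = -1) {i₀ : Fin 6} {k : Fin 6 → ℕ}
    (hk : ∀ i, i ≠ i₀ → 1 ≤ k i) (hk₀ : k i₀ = 0) {σ : ℝ} (hσ : 1 ≤ σ) (m : ℕ × ℕ × ℕ) :
    ‖tripleTerm η k m‖ * (corootValue m i₀ : ℝ) ^ (-σ) ≤
      1 / (m.1 : ℝ) ^ 2 * (1 / (m.2.1 : ℝ) ^ 2 * (1 / (m.2.2 : ℝ) ^ 2)) := by
  by_cases hm : IsPositive m
  · refine le_trans ?_ (inv_prod_corootValue_le hm)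
    have h1 : ∀ i, (1 : ℝ) ≤ corootValue m i := fun i => by exact_mod_cast hm.one_le_corootValue i
    rw [tripleTerm, if_pos hm, norm_div, norm_sign_pow hη, norm_prod]
    simp only [norm_pow, Complex.norm_natCast]
    rw [← mul_prod_erase univ _ (mem_univ i₀), ← mul_prod_erase univ _ (mem_univ i₀), hk₀, pow_zero,
      one_mul, one_div, mul_inv, mul_comm]
    have h2 : ∏ i ∈ univ.erase i₀, (corootValue m i : ℝ) ≤
        ∏ i ∈ univ.erase i₀, (corootValue m i : ℝ) ^ k i := by
      refine prod_le_prod (fun i _ => by positivity) fun i hi => ?_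
      exact le_self_pow₀ (h1 i) (by have := hk i (ne_of_mem_erase hi); omega)
    have h3 : (0 : ℝ) < ∏ i ∈ univ.erase i₀, (corootValue m i : ℝ) :=
      prod_pos fun i _ => by linarith [h1 i]
    have h4 : (0 : ℝ) < corootValue m i₀ := by linarith [h1 i₀]
    refine mul_le_mul ?_ (inv_anti₀ h3 h2) (inv_nonneg.2 (h3.le.trans h2)) (by positivity)
    rw [← Real.rpow_neg_one]
    exact Real.rpow_le_rpow_of_exponent_le (h1 i₀) (by linarith)
  · rw [tripleTerm_of_not_isPositive hm, norm_zero, zero_mul]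
    positivity

theorem norm_evenTerm_le {i₀ : Fin 6} {k : Fin 6 → ℕ}
    (hk : ∀ i, i ≠ i₀ → 1 ≤ k i) (hk₀ : k i₀ = 0) {σ : ℝ} (hσ : 1 ≤ σ) (m : ℕ × ℕ × ℕ) :
    ‖evenTerm k m‖ * (corootValue m i₀ : ℝ) ^ (-σ) ≤
      1 / (m.1 : ℝ) ^ 2 * (1 / (m.2.1 : ℝ) ^ 2 * (1 / (m.2.2 : ℝ) ^ 2)) := by
  have h1 := norm_tripleTerm_le (.inl rfl) hk hk₀ hσ m
  have h2 := norm_tripleTerm_le (.inr rfl) hk hk₀ hσ m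
  have h3 : ‖evenTerm k m‖ ≤ (‖tripleTerm 1 k m‖ + ‖tripleTerm (-1) k m‖) / 2 := by
    rw [evenTerm, norm_div, Complex.norm_ofNat]
    have := norm_add_le (tripleTerm 1 k m) (tripleTerm (-1) k m)
    linarith
  have h4 : (0 : ℝ) ≤ (corootValue m i₀ : ℝ) ^ (-σ) := by positivity
  have := mul_le_mul_of_nonneg_right h3 h4
  linarith

theorem tsum_eq_tsum_succ {f : ℕ → ℂ} (h : f 0 = 0) : ∑' n, f n = ∑' n, f (n + 1) := by
  refine (Function.Injective.tsum_eq (g := fun n : ℕ => n + 1) (add_left_injective 1) ?_).symm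
  intro n hn
  rcases n with - | n
  · exact absurd h hn
  · exact ⟨n, rfl⟩

/-- The continuation of the triple series in the variable `s` at the position `i₀`, in coordinates
`(N, w, v)` in which the corresponding linear form is `N`. -/
theorem exists_continuation_of_coordinates {i₀ : Fin 6} {k : Fin 6 → ℕ}
    (hk : ∀ i, i ≠ i₀ → 1 ≤ k i) (hk₀ : k i₀ = 0) (φ ψ : ℕ × ℕ × ℕ → ℕ × ℕ × ℕ)
    (cond : ℕ × ℕ × ℕ → Prop) [DecidablePred cond] (hφψ : ∀ n, cond n → φ (ψ n) = n)
    (hψφ : ∀ m, ψ (φ m) = m) (hcond : ∀ m, cond (φ m)) (hφ : ∀ m, (φ m).1 = corootValue m i₀)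
    (hH : ∀ η : ℂ, η = 1 ∨ η = -1 → HarmonicSum fun N =>
      ∑' w : ℕ, ∑' v : ℕ, if cond (N, w, v) then tripleTerm η k (ψ (N, w, v)) else 0) :
    ∃ F : ℂ → ℂ, MeromorphicNFOn F Set.univ ∧ ∀ s : ℂ, 1 < s.re →
      HasSum (fun m => evenTerm k m * (corootValue m i₀ : ℂ) ^ (-s)) (F s) := by
  set b : ℂ → ℕ × ℕ × ℕ → ℂ := fun η n => if cond n then tripleTerm η k (ψ n) else 0 with hb
  set a : ℕ × ℕ × ℕ → ℂ := fun n => if cond n then evenTerm k (ψ n) else 0 with ha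
  have hinj : Function.Injective φ := Function.LeftInverse.injective hψφ
  have off : ∀ n, n ∉ Set.range φ → ¬ cond n := fun n hn hc => hn ⟨ψ n, hφψ n hc⟩
  have summ_b : ∀ η : ℂ, η = 1 ∨ η = -1 → ∀ σ : ℝ, 1 ≤ σ →
      Summable fun n : ℕ × ℕ × ℕ => ‖b η n‖ * (n.1 : ℝ) ^ (-σ) := by
    intro η hη σ hσ
    refine (hinj.summable_iff fun n hn => ?_).1 ?_
    · simp [hb, off n hn]
    · refine Summable.of_nonneg_of_le (fun m => mul_nonneg (norm_nonneg _)
        (Real.rpow_nonneg (Nat.cast_nonneg _) _)) (fun m => ?_) summable_inv_sq_prod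
      simpa [hb, hcond, hψφ, hφ] using norm_tripleTerm_le hη hk hk₀ hσ m
  have fib_b : ∀ η : ℂ, η = 1 ∨ η = -1 → ∀ N, 1 ≤ N → Summable fun n : ℕ × ℕ => b η (N, n) := by
    intro η hη N hN
    have h1 := ((summ_b η hη 1 le_rfl).prod_factor N).mul_right ((N : ℝ) ^ (1 : ℝ))
    refine Summable.of_norm (h1.congr fun n => ?_)
    have : (0 : ℝ) < N := by exact_mod_cast hN
    rw [mul_assoc, ← Real.rpow_add this, neg_add_cancel, Real.rpow_zero, mul_one]
  have ab : ∀ n, a n = (b 1 n + b (-1) n) / 2 := by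
    intro n
    simp only [ha, hb, evenTerm]
    split_ifs <;> simp
  suffices H : ∃ F : ℂ → ℂ, MeromorphicNFOn F Set.univ ∧ ∀ s : ℂ, 1 < s.re →
      HasSum (fun n : ℕ × ℕ × ℕ => a n * (n.1 : ℂ) ^ (-s)) (F s) by
    obtain ⟨F, hF, hFs⟩ := H
    refine ⟨F, hF, fun s hs => ?_⟩
    have := (hinj.hasSum_iff fun n hn => by simp [ha, off n hn]).2 (hFs s hs)
    simpa [Function.comp_def, ha, hcond, hψφ, hφ] using this
  refine exists_continuation (κ := ℕ × ℕ) (fun n => ?_) (fun σ hσ => ?_)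
    (((hH 1 (.inl rfl)).add (hH (-1) (.inr rfl))).const_mul (1 / 2)) (fun N hN => ?_)
  · simp only [ha]
    split_ifs with hc
    · have h0 : corootValue (ψ (0, n)) i₀ = 0 := by rw [← hφ, hφψ _ hc]
      have : ¬ IsPositive (ψ (0, n)) := fun h => by
        have := h.one_le_corootValue i₀
        omega
      simp [evenTerm, tripleTerm_of_not_isPositive this]
    · rfl
  · refine (hinj.summable_iff fun n hn => ?_).1 ?_
    · simp [ha, off n hn]
    · refine Summable.of_nonneg_of_le (fun m => mul_nonneg (norm_nonneg _)
        (Real.rpow_nonneg (Nat.cast_nonneg _) _)) (fun m => ?_) summable_inv_sq_prod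
      simpa [ha, hcond, hψφ, hφ] using norm_evenTerm_le hk hk₀ hσ.le m
  · have s1 := fib_b 1 (.inl rfl) N hN
    have s2 := fib_b (-1) (.inr rfl) N hN
    simp only [ab]
    rw [tsum_div_const, s1.tsum_add s2, s1.tsum_prod, s2.tsum_prod]
    ring

section Positions

variable {η : ℂ} {k : Fin 6 → ℕ}

theorem tripleTerm_eq (η : ℂ) (k : Fin 6 → ℕ) (m : ℕ × ℕ × ℕ) : tripleTerm η k m =
    if IsPositive m then η ^ (m.1 + m.2.2) / ((m.1 : ℂ) ^ k 0 * (m.2.1 : ℂ) ^ k 1 *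
      (m.2.2 : ℂ) ^ k 2 * ((m.1 : ℂ) + m.2.1) ^ k 3 * ((m.2.1 : ℂ) + m.2.2) ^ k 4 *
      ((m.1 : ℂ) + m.2.1 + m.2.2) ^ k 5) else 0 := by
  simp [tripleTerm, Fin.prod_univ_six, corootValue]

theorem tripleTerm_zero_fst (a b : ℕ) : tripleTerm η k (0, a, b) = 0 :=
  tripleTerm_of_not_isPositive fun h => by simpa using h.1

theorem tripleTerm_zero_snd (a b : ℕ) : tripleTerm η k (a, 0, b) = 0 :=
  tripleTerm_of_not_isPositive fun h => by simpa using h.2.1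

theorem tripleTerm_zero_trd (a b : ℕ) : tripleTerm η k (a, b, 0) = 0 :=
  tripleTerm_of_not_isPositive fun h => by simpa using h.2.2

/-- The case in which `N` is the first of the three coordinates. -/
theorem harmonicSum_position_zero (hη : η = 1 ∨ η = -1) (hk : ∀ i, i ≠ 0 → 1 ≤ k i)
    (hk₀ : k 0 = 0) :
    HarmonicSum fun N => ∑' w : ℕ, ∑' v : ℕ, tripleTerm η k (N, w, v) := by
  have h1 := hk 1 (by decide)
  have h2 := hk 2 (by decide)
  have h3 := hk 3 (by decide)
  have h4 := hk 4 (by decide)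
  have := (InfClass.partialFractionClass_fst.innerSum hη (i := k 2) (j := k 4) (k := k 5)
    (by omega)).2 1 (.inl rfl) (k 1) (k 3) (by omega)
  refine (this.sign_pow hη).congr fun N hN => ?_
  rw [tsum_eq_tsum_succ (f := fun w => ∑' v : ℕ, tripleTerm η k (N, w, v))
    (by simp [tripleTerm_zero_snd]), ← tsum_mul_left]
  refine tsum_congr fun w => ?_
  rw [tsum_eq_tsum_succ (f := fun v => tripleTerm η k (N, w + 1, v)) (tripleTerm_zero_trd _ _)]
  dsimp only
  rw [innerSum, one_pow, one_mul, ← tsum_div_const, ← tsum_mul_left]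
  refine tsum_congr fun v => ?_
  rw [tripleTerm_eq, if_pos ⟨hN, by simp, by simp⟩, hk₀]
  push_cast
  rw [pow_add, pow_zero, ← mul_div_assoc, ← mul_div_assoc, div_div]
  congr 1
  · ring
  rw [show (v : ℂ) + 1 + (w + 1 + N) = N + (w + 1) + (v + 1) by ring,
    show (v : ℂ) + 1 + (w + 1) = w + 1 + (v + 1) by ring,
    show (w : ℂ) + 1 + N = N + (w + 1) by ring]
  ring

/-- The case in which `N` is the middle one of the three coordinates. -/
theorem harmonicSum_position_one (hη : η = 1 ∨ η = -1) (hk : ∀ i, i ≠ 1 → 1 ≤ k i)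
    (hk₀ : k 1 = 0) :
    HarmonicSum fun N => ∑' w : ℕ, ∑' v : ℕ, tripleTerm η k (w, N, v) := by
  have h0 := hk 0 (by decide)
  have h2 := hk 2 (by decide)
  have h3 := hk 3 (by decide)
  have h4 := hk 4 (by decide)
  have := (InfClass.partialFractionClass_snd.innerSum hη (i := k 2) (j := k 4) (k := k 5)
    (by omega)).2 η hη (k 0) (k 3) (by omega)
  refine this.congr fun N hN => ?_
  rw [tsum_eq_tsum_succ (f := fun w => ∑' v : ℕ, tripleTerm η k (w, N, v))
    (by simp [tripleTerm_zero_fst])]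
  refine tsum_congr fun w => ?_
  rw [tsum_eq_tsum_succ (f := fun v => tripleTerm η k (w + 1, N, v)) (tripleTerm_zero_trd _ _)]
  dsimp only
  rw [innerSum, ← tsum_mul_left, ← tsum_div_const]
  refine tsum_congr fun v => ?_
  rw [tripleTerm_eq, if_pos ⟨by simp, hN, by simp⟩, hk₀]
  push_cast
  rw [pow_add, pow_zero, ← mul_div_assoc, div_div]
  congr 1
  · ring
  rw [show (v : ℂ) + 1 + (w + 1 + N) = w + 1 + N + (v + 1) by ring,
    show (v : ℂ) + 1 + N = N + (v + 1) by ring]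
  ring

/-- The case in which `N` is the sum of the first two coordinates. -/
theorem harmonicSum_position_three (hη : η = 1 ∨ η = -1) (hk : ∀ i, i ≠ 3 → 1 ≤ k i)
    (hk₀ : k 3 = 0) :
    HarmonicSum fun N => ∑' w : ℕ, ∑' v : ℕ,
      if w ≤ N then tripleTerm η k (N - w, w, v) else 0 := by
  have h2 := hk 2 (by decide)
  have h4 := hk 4 (by decide)
  have := (FinClass.partialFractionClass.innerSum hη (i := k 2) (j := k 4) (k := k 5)
    (by omega)).harmonicSum η hη (k 1) (k 0)
  refine (this.sign_pow hη).congr fun N hN => ?_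
  rw [tsum_eq_sum (s := Ico 1 N), mul_sum]
  · refine sum_congr rfl fun w hw => ?_
    rw [mem_Ico] at hw
    simp only [hw.2.le, if_true]
    rw [tsum_eq_tsum_succ (tripleTerm_zero_trd _ _), innerSum, ← tsum_mul_left, ← tsum_div_const,
      ← tsum_mul_left]
    refine tsum_congr fun v => ?_
    rw [tripleTerm_eq, if_pos ⟨by simp; omega, hw.1, by simp⟩, hk₀]
    dsimp only
    rw [pow_add η (N - w), sign_pow_sub hη hw.2.le, Nat.cast_sub hw.2.le]
    push_cast
    rw [pow_zero, ← mul_div_assoc, ← mul_div_assoc, ← mul_div_assoc, div_div, ← mul_assoc]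
    congr 1
    rw [show (N : ℂ) - w + w + (v + 1) = v + 1 + N by ring,
      show (w : ℂ) + (v + 1) = v + 1 + w by ring]
    ring
  · intro w hw
    rw [mem_Ico] at hw
    have : ∀ v, (if w ≤ N then tripleTerm η k (N - w, w, v) else 0) = 0 := by
      intro v
      split_ifs with h
      · refine tripleTerm_of_not_isPositive fun h' => hw ⟨h'.2.1, ?_⟩
        have : 1 ≤ N - w := h'.1
        omega
      · rfl
    simp [this]

/-- The case in which `N` is the sum of the three coordinates. -/
theorem harmonicSum_position_five (hη : η = 1 ∨ η = -1) (hk : ∀ i, i ≠ 5 → 1 ≤ k i)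
    (hk₀ : k 5 = 0) :
    HarmonicSum fun N => ∑' w : ℕ, ∑' v : ℕ,
      if v ≤ w ∧ w ≤ N then tripleTerm η k (N - w, v, w - v) else 0 := by
  have h2 := hk 2 (by decide)
  have := (FinClass.sum_Ico hη (k 1) (k 2) (k 3) (by omega)).harmonicSum 1 (.inl rfl) (k 4) (k 0)
  refine (this.sign_pow hη).congr fun N hN => ?_
  rw [tsum_eq_sum (s := Ico 1 N), mul_sum]
  · refine sum_congr rfl fun w hw => ?_
    rw [mem_Ico] at hw
    rw [tsum_eq_sum (s := Ico 1 w), one_pow, one_mul, sum_div, mul_sum]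
    · refine sum_congr rfl fun v hv => ?_
      rw [mem_Ico] at hv
      rw [if_pos ⟨hv.2.le, hw.2.le⟩, tripleTerm_eq, if_pos ⟨by simp; omega, hv.1, by simp; omega⟩,
        hk₀,
        Nat.cast_sub hw.2.le, Nat.cast_sub hv.2.le, show N - w + (w - v) = N - v by omega,
        sign_pow_sub hη (by omega), pow_zero, div_div, ← mul_div_assoc]
      congr 1
      ring
    · intro v hv
      rw [mem_Ico] at hv
      split_ifs with h
      · refine tripleTerm_of_not_isPositive fun h' => hv ⟨h'.2.1, ?_⟩
        have : 1 ≤ w - v := h'.2.2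
        omega
      · rfl
  · intro w hw
    rw [mem_Ico] at hw
    have : ∀ v, (if v ≤ w ∧ w ≤ N then tripleTerm η k (N - w, v, w - v) else 0) = 0 := by
      intro v
      split_ifs with h
      · refine tripleTerm_of_not_isPositive fun h' => hw ?_
        have h1 : 1 ≤ N - w := h'.1
        have h2 : 1 ≤ w - v := h'.2.2
        omega
      · rfl
    simp [this]

/-- The symmetry of the triple series under the automorphism of the Dynkin diagram. -/
theorem tripleTerm_reflect (x y z : ℕ) :
    tripleTerm η k (x, y, z) = tripleTerm η ![k 2, k 1, k 0, k 4, k 3, k 5] (z, y, x) := by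
  have h : IsPositive (x, y, z) ↔ IsPositive (z, y, x) := by simp only [IsPositive]; tauto
  rw [tripleTerm_eq, tripleTerm_eq]
  refine if_congr h ?_ rfl
  simp
  rw [add_comm x z]
  congr 1
  rw [add_comm (x : ℂ) y, add_comm (y : ℂ) z, show (y : ℂ) + x + z = z + y + x by ring]
  ring

/-- The triple series continues meromorphically in each of its six variables, when the other
five are positive integers. -/
theorem exists_continuation_evenTerm {i₀ : Fin 6} (hk : ∀ i, i ≠ i₀ → 1 ≤ k i) (hk₀ : k i₀ = 0) :
    ∃ F : ℂ → ℂ, MeromorphicNFOn F Set.univ ∧ ∀ s : ℂ, 1 < s.re →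
      HasSum (fun m => evenTerm k m * (corootValue m i₀ : ℂ) ^ (-s)) (F s) := by
  fin_cases i₀
  · exact exists_continuation_of_coordinates hk hk₀ id id (fun _ => True) (by simp) (by simp)
      (by simp) (fun _ => rfl) fun η hη => by simpa using harmonicSum_position_zero hη hk hk₀
  · exact exists_continuation_of_coordinates hk hk₀ (fun m => (m.2.1, m.1, m.2.2))
      (fun m => (m.2.1, m.1, m.2.2)) (fun _ => True) (by simp) (by simp)
      (by simp) (fun _ => rfl) fun η hη => by simpa using harmonicSum_position_one hη hk hk₀
  · refine exists_continuation_of_coordinates hk hk₀ (fun m => (m.2.2, m.2.1, m.1))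
      (fun m => (m.2.2, m.2.1, m.1)) (fun _ => True) (by simp) (by simp)
      (by simp) (fun _ => rfl) fun η hη => ?_
    simp only [tripleTerm_reflect (k := k), if_true]
    refine harmonicSum_position_zero hη (fun i hi => ?_) hk₀
    fin_cases i <;> first | exact absurd rfl hi | exact hk _ (by decide)
  · exact exists_continuation_of_coordinates hk hk₀ (fun m => (m.1 + m.2.1, m.2.1, m.2.2))
      (fun n => (n.1 - n.2.1, n.2.1, n.2.2)) (fun n => n.2.1 ≤ n.1)
      (fun n hn => by simp [Nat.sub_add_cancel hn]) (by simp)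
      (by simp) (fun _ => rfl) fun η hη => by simpa using harmonicSum_position_three hη hk hk₀
  · refine exists_continuation_of_coordinates hk hk₀ (fun m => (m.2.1 + m.2.2, m.2.1, m.1))
      (fun n => (n.2.2, n.2.1, n.1 - n.2.1)) (fun n => n.2.1 ≤ n.1)
      (fun n hn => by simp [Nat.add_sub_cancel' hn]) (by simp)
      (by simp) (fun _ => rfl) fun η hη => ?_
    simp only [tripleTerm_reflect (k := k)]
    refine harmonicSum_position_three hη (fun i hi => ?_) hk₀
    fin_cases i <;> first | exact absurd rfl hi | exact hk _ (by decide)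
  · refine exists_continuation_of_coordinates hk hk₀
      (fun m => (m.1 + m.2.1 + m.2.2, m.2.1 + m.2.2, m.2.1))
      (fun n => (n.1 - n.2.1, n.2.2, n.2.1 - n.2.2)) (fun n => n.2.2 ≤ n.2.1 ∧ n.2.1 ≤ n.1)
      (fun n hn => ?_) (fun m => ?_) (fun m => ?_) (fun _ => rfl)
      fun η hη => by simpa using harmonicSum_position_five hη hk hk₀
    · obtain ⟨x, y, z⟩ := n
      dsimp only at hn
      dsimp only
      ext <;> dsimp only <;> omega
    · obtain ⟨x, y, z⟩ := m
      dsimp only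
      ext <;> dsimp only <;> omega
    · obtain ⟨x, y, z⟩ := m
      dsimp only
      omega

end Positions

/-! ### The dominant weights of `SO(6)` -/

theorem continuation_spec {ι : Type*} {f : ι → ℂ → ℂ} (h : ∃ F, IsMeromorphicContinuation f F) :
    IsMeromorphicContinuation f (continuation f) := by
  rw [continuation, dif_pos h]
  exact h.choose_spec

/-- The weight `m₁ λ₁ + m₂ λ₂ + m₃ λ₃`. -/
noncomputable def weight (m : ℕ × ℕ × ℕ) : V :=
  m.1 • fundamentalWeight 0 + m.2.1 • fundamentalWeight 1 + m.2.2 • fundamentalWeight 2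

theorem coroot_positiveRoot (i : Fin 6) : coroot (positiveRoot i) = positiveRoot i := by
  have h : (inner ℝ (positiveRoot i) (positiveRoot i) : ℝ) = 2 := by
    fin_cases i <;>
      simp [positiveRoot, simpleRoot, Fin.sum_univ_four, EuclideanSpace.norm_sq_eq] <;>
      norm_num
  rw [coroot, h]
  simp

theorem inner_simpleRoot_fundamentalWeight (i j : Fin 3) :
    inner ℝ (simpleRoot i) (fundamentalWeight j) = if i = j then (1 : ℝ) else 0 := by
  rw [← inner_coroot_fundamentalWeight i j]
  congr 1
  fin_cases i
  · exact (coroot_positiveRoot 0).symm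
  · exact (coroot_positiveRoot 1).symm
  · exact (coroot_positiveRoot 2).symm

theorem inner_coroot_weight (i : Fin 6) (m : ℕ × ℕ × ℕ) :
    inner ℝ (coroot (positiveRoot i)) (weight m) = (corootValue m i : ℝ) := by
  rw [coroot_positiveRoot]
  fin_cases i <;>
    simp [positiveRoot, weight, corootValue, inner_add_left, inner_add_right,
      ← Nat.cast_smul_eq_nsmul ℝ,
      inner_smul_right, inner_simpleRoot_fundamentalWeight]

theorem weight_injective : Function.Injective weight := by
  intro m n h
  have h1 : ∀ i, (corootValue m i : ℝ) = corootValue n i := fun i => by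
    rw [← inner_coroot_weight, ← inner_coroot_weight, h]
  have h2 : ∀ i, corootValue m i = corootValue n i := fun i => by exact_mod_cast h1 i
  exact Prod.ext (h2 0) (Prod.ext (h2 1) (h2 2))

theorem weylVector_eq : weylVector = weight (1, 1, 1) := by
  simp only [weylVector, weight, Fin.sum_univ_six, positiveRoot, fundamentalWeight]
  simp
  module

theorem weight_add (m n : ℕ × ℕ × ℕ) : weight (m + n) = weight m + weight n := by
  simp only [weight, Prod.fst_add, Prod.snd_add]
  module

theorem mem_dominantWeights {v : V} : v ∈ dominantWeights ↔ ∃ n, v = weight n := by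
  constructor
  · intro h
    induction h using AddSubmonoid.closure_induction with
    | mem x hx =>
      obtain ⟨i, rfl⟩ := hx
      fin_cases i
      · exact ⟨(1, 0, 0), by simp [weight]⟩
      · exact ⟨(0, 1, 0), by simp [weight]⟩
      · exact ⟨(0, 0, 1), by simp [weight]⟩
    | zero => exact ⟨0, by simp [weight]⟩
    | add x y _ _ hx hy =>
      obtain ⟨m, rfl⟩ := hx
      obtain ⟨n, rfl⟩ := hy
      exact ⟨m + n, (weight_add m n).symm⟩
  · rintro ⟨n, rfl⟩
    have h : ∀ i, fundamentalWeight i ∈ dominantWeights :=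
      fun i => AddSubmonoid.subset_closure (Set.mem_range_self i)
    exact add_mem (add_mem (nsmul_mem (h 0) _) (nsmul_mem (h 1) _)) (nsmul_mem (h 2) _)

theorem exists_int_of_mem_weightLatticeSO6 {v : V} (hv : v ∈ weightLatticeSO6) :
    ∃ n : ℤ, 2 * v 0 = n := by
  obtain ⟨u, hu, w, hw, rfl⟩ := AddSubgroup.mem_sup.1 hv
  have hQ : ∃ n : ℤ, u 0 = n := by
    clear hv hw
    induction hu using AddSubgroup.closure_induction with
    | mem x hx =>
      obtain ⟨i, rfl⟩ := hx
      fin_cases i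
      · exact ⟨1, by simp [simpleRoot]⟩
      · exact ⟨0, by simp [simpleRoot]⟩
      · exact ⟨0, by simp [simpleRoot]⟩
    | zero => exact ⟨0, by simp⟩
    | add x y _ _ hx hy =>
      obtain ⟨k, hk⟩ := hx
      obtain ⟨l, hl⟩ := hy
      exact ⟨k + l, by simp [hk, hl]⟩
    | neg x _ hx =>
      obtain ⟨k, hk⟩ := hx
      exact ⟨-k, by simp [hk]⟩
  obtain ⟨n, hn⟩ := hQ
  obtain ⟨k, rfl⟩ := AddSubgroup.mem_zmultiples_iff.1 hw
  have h1 : fundamentalWeight 1 0 = 1 / 2 := by simp [fundamentalWeight, simpleRoot]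
  refine ⟨2 * n + k, ?_⟩
  simp only [PiLp.add_apply, PiLp.smul_apply, h1, hn, zsmul_eq_mul]
  push_cast
  ring

/-- The lattice `L₁` consists of the weights whose outer coefficients have the same parity. -/
theorem weight_mem_weightLatticeSO6 (m : ℕ × ℕ × ℕ) :
    weight m ∈ weightLatticeSO6 ↔ Even (m.1 + m.2.2) := by
  obtain ⟨x, y, z⟩ := m
  constructor
  · intro h
    obtain ⟨n, hn⟩ := exists_int_of_mem_weightLatticeSO6 h
    have h0 : fundamentalWeight 0 0 = 3 / 4 := by simp [fundamentalWeight, simpleRoot]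
    have h1 : fundamentalWeight 1 0 = 1 / 2 := by simp [fundamentalWeight, simpleRoot]
    have h2 : fundamentalWeight 2 0 = 1 / 4 := by simp [fundamentalWeight, simpleRoot]
    simp only [weight, PiLp.add_apply, PiLp.smul_apply, h0, h1, h2, nsmul_eq_mul] at hn
    have h3 : (3 * x + 2 * y + z : ℝ) = 2 * n := by linarith
    have h4 : (3 * x + 2 * y + z : ℤ) = 2 * n := by exact_mod_cast h3
    rw [Nat.even_iff]
    simp only
    omega
  · intro h
    have hr : ∀ i, simpleRoot i ∈ weightLatticeSO6 := fun i =>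
      AddSubgroup.mem_sup_left (AddSubgroup.subset_closure (Set.mem_range_self i))
    have hw : fundamentalWeight 1 ∈ weightLatticeSO6 :=
      AddSubgroup.mem_sup_right (AddSubgroup.mem_zmultiples _)
    have h00 : (2 : ℕ) • fundamentalWeight 0 ∈ weightLatticeSO6 := by
      have : (2 : ℕ) • fundamentalWeight 0 = fundamentalWeight 1 + simpleRoot 0 := by
        simp [fundamentalWeight]; module
      rw [this]; exact add_mem hw (hr 0)
    have h02 : fundamentalWeight 0 + fundamentalWeight 2 ∈ weightLatticeSO6 := by
      have : fundamentalWeight 0 + fundamentalWeight 2 =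
          simpleRoot 0 + simpleRoot 1 + simpleRoot 2 := by
        simp [fundamentalWeight]; module
      rw [this]; exact add_mem (add_mem (hr 0) (hr 1)) (hr 2)
    obtain ⟨j, hj⟩ : ∃ j : ℤ, (x : ℤ) - z = 2 * j := by
      obtain ⟨t, ht⟩ := h
      simp only at ht
      exact ⟨t - z, by omega⟩
    have e : weight (x, y, z) = y • fundamentalWeight 1 +
        (z : ℤ) • (fundamentalWeight 0 + fundamentalWeight 2) +
        j • ((2 : ℕ) • fundamentalWeight 0) := by
      have : (x : ℤ) = 2 * j + z := by omega
      simp only [weight]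
      rw [← natCast_zsmul _ x, this]
      module
    rw [e]
    exact add_mem (add_mem (nsmul_mem hw _) (zsmul_mem h02 _)) (zsmul_mem h00 _)

theorem mem_shiftedDominant {x : V} : x ∈ shiftedDominant weightLatticeSO6 ↔
    ∃ m : ℕ × ℕ × ℕ, (IsPositive m ∧ Even (m.1 + m.2.2)) ∧ weight m = x := by
  constructor
  · rintro ⟨μ, hμ, hL, rfl⟩
    obtain ⟨n, rfl⟩ := mem_dominantWeights.1 hμ
    refine ⟨n + (1, 1, 1), ⟨⟨by simp, by simp, by simp⟩, ?_⟩, by rw [weight_add, weylVector_eq]⟩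
    have := (weight_mem_weightLatticeSO6 n).1 hL
    rw [Nat.even_iff] at this ⊢
    simp only [Prod.fst_add, Prod.snd_add]
    omega
  · rintro ⟨⟨a, b, c⟩, ⟨⟨h1, h2, h3⟩, h⟩, rfl⟩
    simp only at h1 h2 h3 h
    have e : (a, b, c) = (a - 1, b - 1, c - 1) + ((1, 1, 1) : ℕ × ℕ × ℕ) := by
      ext <;> simp <;> omega
    refine ⟨weight (a - 1, b - 1, c - 1), mem_dominantWeights.2 ⟨_, rfl⟩, ?_, ?_⟩
    · rw [weight_mem_weightLatticeSO6]
      rw [Nat.even_iff] at h ⊢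
      simp only
      omega
    · rw [weylVector_eq, ← weight_add, ← e]

theorem evenTerm_mul_cpow {i₀ : Fin 6} {k : Fin 6 → ℕ} (hk₀ : k i₀ = 0) (s : ℂ) {m : ℕ × ℕ × ℕ}
    (hm : IsPositive m ∧ Even (m.1 + m.2.2)) :
    evenTerm k m * (corootValue m i₀ : ℂ) ^ (-s) =
      zetaTerm (Function.update (fun i => (k i : ℂ)) i₀ s) (weight m) := by
  simp only [zetaTerm, inner_coroot_weight, Complex.ofReal_natCast]
  rw [evenTerm, tripleTerm, tripleTerm, if_pos hm.1, if_pos hm.1, hm.2.neg_one_pow, one_pow,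
    add_self_div_two, ← mul_prod_erase univ _ (mem_univ i₀), ← mul_prod_erase univ _ (mem_univ i₀),
    hk₀, pow_zero, one_mul, Function.update_self, Complex.cpow_neg, one_div, one_div, mul_comm]
  congr 1
  rw [← prod_inv_distrib]
  refine prod_congr rfl fun i hi => ?_
  rw [Function.update_of_ne (ne_of_mem_erase hi), Complex.cpow_natCast, one_div]

/-- The series over the dominant weights of `SO(6)`, as a triple series. -/
theorem hasSum_zetaTerm_iff {i₀ : Fin 6} {k : Fin 6 → ℕ} (hk₀ : k i₀ = 0) (s A : ℂ) :
    HasSum (fun x : shiftedDominant weightLatticeSO6 =>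
        zetaTerm (Function.update (fun i => (k i : ℂ)) i₀ s) x) A ↔
      HasSum (fun m => evenTerm k m * (corootValue m i₀ : ℂ) ^ (-s)) A := by
  set T : Set (ℕ × ℕ × ℕ) := {m | IsPositive m ∧ Even (m.1 + m.2.2)} with hT
  have hrange : shiftedDominant weightLatticeSO6 = weight '' T := by
    ext x
    exact mem_shiftedDominant
  let e : T ≃ shiftedDominant weightLatticeSO6 :=
    (Equiv.Set.image weight T weight_injective).trans (Equiv.setCongr hrange.symm)
  have hsupp : Function.support (fun m => evenTerm k m * (corootValue m i₀ : ℂ) ^ (-s)) ⊆ T := by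
    intro m hm
    by_contra h
    refine hm ?_
    have : evenTerm k m = 0 := by
      by_cases hp : IsPositive m
      · have ho : ¬ Even (m.1 + m.2.2) := fun he => h ⟨hp, he⟩
        rw [Nat.not_even_iff_odd] at ho
        rw [evenTerm, tripleTerm, tripleTerm, if_pos hp, if_pos hp, ho.neg_one_pow, one_pow]
        ring
      · rw [evenTerm, tripleTerm_of_not_isPositive hp, tripleTerm_of_not_isPositive hp]
        simp
    simp [this]
  rw [← e.hasSum_iff, ← hasSum_subtype_iff_of_support_subset hsupp]
  refine iff_of_eq (congrArg (HasSum · A) (funext fun m => ?_))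
  exact (evenTerm_mul_cpow hk₀ s m.2).symm

/-- The position of the variable `s` in the twelve zeta-functions. -/
def lhsPosition : Fin 12 → Fin 6 := ![2, 2, 4, 1, 4, 1, 5, 3, 0, 5, 3, 0]

/-- The integral exponents of the twelve zeta-functions, with `0` at the position of `s`. -/
def lhsExponent (p q a b c : ℕ) : Fin 12 → Fin 6 → ℕ :=
  ![![p, q, 0, a, b, c], ![p, a, 0, q, c, b], ![q, a, c, p, 0, b], ![q, 0, c, b, a, p],
    ![a, q, b, p, 0, c], ![a, 0, b, c, q, p], ![a, p, b, q, c, 0], ![a, c, b, 0, p, q],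
    ![0, c, p, a, b, q], ![q, p, c, a, b, 0], ![q, b, c, 0, p, a], ![0, b, p, q, c, a]]

theorem lhsArg_eq (p q a b c : ℕ) (i : Fin 12) (s : ℂ) : lhsArg p q a b c i s =
    Function.update (fun j => (lhsExponent p q a b c i j : ℂ)) (lhsPosition i) s := by
  funext j
  fin_cases i <;> fin_cases j <;> simp [lhsArg, lhsExponent, lhsPosition, Function.update]

theorem lhsExponent_position (p q a b c : ℕ) (i : Fin 12) :
    lhsExponent p q a b c i (lhsPosition i) = 0 := by
  fin_cases i <;> rfl

theorem one_le_lhsExponent {p q a b c : ℕ} (hp : 1 ≤ p) (hq : 1 ≤ q) (ha : 1 ≤ a) (hb : 1 ≤ b)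
    (hc : 1 ≤ c) (i : Fin 12) (j : Fin 6) (hj : j ≠ lhsPosition i) :
    1 ≤ lhsExponent p q a b c i j := by
  fin_cases i <;> fin_cases j <;> first | exact absurd rfl hj | assumption

theorem hasContinuationSO6_lhsArg {p q a b c : ℕ} (hp : 1 ≤ p) (hq : 1 ≤ q) (ha : 1 ≤ a)
    (hb : 1 ≤ b) (hc : 1 ≤ c) (i : Fin 12) : HasContinuationSO6 (lhsArg p q a b c i) := by
  obtain ⟨F, hF, hFs⟩ := exists_continuation_evenTerm (one_le_lhsExponent hp hq ha hb hc i)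
    (lhsExponent_position p q a b c i)
  refine ⟨F, hF, fun s hs => ?_⟩
  simp only [lhsArg_eq]
  exact (hasSum_zetaTerm_iff (lhsExponent_position p q a b c i) s _).2 (hFs s hs)

theorem hasSum_zetaSO6_lhsArg {p q a b c : ℕ} (hp : 1 ≤ p) (hq : 1 ≤ q) (ha : 1 ≤ a)
    (hb : 1 ≤ b) (hc : 1 ≤ c) (i : Fin 12) {s : ℂ} (hs : 1 < s.re) :
    HasSum (fun m => evenTerm (lhsExponent p q a b c i) m *
      (corootValue m (lhsPosition i) : ℂ) ^ (-s)) (zetaSO6 (lhsArg p q a b c i) s) := by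
  have := (continuation_spec (hasContinuationSO6_lhsArg hp hq ha hb hc i)).hasSum s hs
  simp only [lhsArg_eq] at this
  have h := (hasSum_zetaTerm_iff (lhsExponent_position p q a b c i) s _).1 this
  simpa only [zetaSO6, lhsArg_eq] using h

/-! ### The series `𝔗` -/

section Polylog

variable {x y : ℂ} {p q : ℕ}

theorem sign_ne_zero' (hx : x = 1 ∨ x = -1) : x ≠ 0 := by
  rcases hx with rfl | rfl <;> norm_num

theorem sign_inv (hx : x = 1 ∨ x = -1) : x⁻¹ = x := by
  rcases hx with rfl | rfl <;> norm_num

theorem sign_zpow_neg (hx : x = 1 ∨ x = -1) (l : ℤ) : x ^ (-l) = x ^ l := by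
  rw [zpow_neg, ← inv_zpow, sign_inv hx]

theorem norm_sign_zpow (hx : x = 1 ∨ x = -1) (l : ℤ) : ‖x ^ l‖ = 1 := by
  rcases hx with rfl | rfl <;> simp

theorem inv_abs_intCast_pow_le (l : ℤ) (hp : 1 ≤ p) : (|(l : ℝ)| ^ p)⁻¹ ≤ |(l : ℝ)|⁻¹ := by
  rcases eq_or_ne l 0 with rfl | hl
  · simp [show p ≠ 0 by omega]
  · have : (1 : ℝ) ≤ |(l : ℝ)| := by exact_mod_cast Int.one_le_abs hl
    exact inv_anti₀ (by linarith) (le_self_pow₀ this (by omega))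

theorem norm_div_intCast_pow_mul_le {z : ℂ} (hz : ‖z‖ ≤ 1) (hp : 1 ≤ p) (hq : 1 ≤ q) (l m : ℤ) :
    ‖z / ((l : ℂ) ^ p * (m : ℂ) ^ q)‖ ≤ 1 / (l : ℝ) ^ 2 + 1 / (m : ℝ) ^ 2 := by
  have h : ‖z / ((l : ℂ) ^ p * (m : ℂ) ^ q)‖ ≤ (|(l : ℝ)| ^ p)⁻¹ * (|(m : ℝ)| ^ q)⁻¹ := by
    rw [norm_div, norm_mul, norm_pow, norm_pow, Complex.norm_intCast, Complex.norm_intCast,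
      div_eq_mul_inv, mul_inv]
    exact mul_le_of_le_one_left (by positivity) hz
  refine h.trans ((mul_le_mul (inv_abs_intCast_pow_le l hp) (inv_abs_intCast_pow_le m hq)
    (by positivity) (by positivity)).trans ?_)
  rw [← sq_abs (l : ℝ), ← sq_abs (m : ℝ), one_div, one_div, ← inv_pow, ← inv_pow]
  nlinarith [sq_nonneg (|(l : ℝ)|⁻¹ - |(m : ℝ)|⁻¹), sq_nonneg |(l : ℝ)|⁻¹, sq_nonneg |(m : ℝ)|⁻¹]

theorem summable_inv_intCast_sq : Summable fun l : ℤ => 1 / (l : ℝ) ^ 2 :=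
  Real.summable_one_div_int_pow.2 (by norm_num)

theorem summable_intCast_pow_mul (hx : x = 1 ∨ x = -1) (hp : 1 ≤ p) (hq : 1 ≤ q) (N : ℤ) :
    Summable fun l : ℤ => x ^ l / ((l : ℂ) ^ p * ((l : ℂ) + N) ^ q) := by
  have h : Summable fun l : ℤ => 1 / ((l + N : ℤ) : ℝ) ^ 2 :=
    summable_inv_intCast_sq.comp_injective (add_left_injective N)
  refine Summable.of_norm_bounded (summable_inv_intCast_sq.add h) fun l => ?_
  have := norm_div_intCast_pow_mul_le (norm_sign_zpow hx l).le hp hq l (l + N)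
  simpa using this

theorem harmonicSum_tsum_intCast (hx : x = 1 ∨ x = -1) (hp : 1 ≤ p) (hq : 1 ≤ q) :
    HarmonicSum fun N => ∑' l : ℤ, x ^ l / ((l : ℂ) ^ p * ((l : ℂ) + N) ^ q) := by
  have h1 := harmonicSum_tsum_one hx (α := p) (β := q) (by omega)
  have h2 := (harmonicSum_sum_Ico_one hx p q).const_mul ((-1) ^ p)
  have h3 := ((harmonicSum_tsum_one hx (α := q) (β := p) (by omega)).sign_pow hx).const_mul
    ((-1) ^ (p + q))
  refine ((h1.add h2).add h3).congr fun N hN => ?_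
  set f : ℤ → ℂ := fun l => x ^ l / ((l : ℂ) ^ p * ((l : ℂ) + N) ^ q) with hf
  have sf : Summable f := by simpa using summable_intCast_pow_mul hx hp hq N
  have s1 : Summable fun n : ℕ => f n := sf.comp_injective Nat.cast_injective
  have s2 : Summable fun n : ℕ => f (-(n + 1 : ℤ)) :=
    sf.comp_injective fun a b h => by simpa using h
  rw [tsum_of_nat_of_neg_add_one s1 s2, ← s2.sum_add_tsum_nat_add N,
    tsum_eq_tsum_succ (f := fun n : ℕ => f n) (by simp [hf, show p ≠ 0 by omega]), ← add_assoc]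
  congr 1
  · congr 1
    · refine tsum_congr fun w => ?_
      simp only [hf]
      rw [zpow_natCast]
      push_cast
      rfl
    · have e : ∀ n : ℕ, f (-(n + 1 : ℤ)) =
          (-1) ^ p * (x ^ (1 + n) / (((1 + n : ℕ) : ℂ) ^ p * (N - ((1 + n : ℕ) : ℂ)) ^ q)) := by
        intro n
        simp only [hf]
        rw [sign_zpow_neg hx, show (n + 1 : ℤ) = ((1 + n : ℕ) : ℤ) by push_cast; ring,
          zpow_natCast]
        push_cast
        rw [neg_pow (1 + (n : ℂ)), mul_assoc, ← div_div, neg_add_eq_sub, mul_div_assoc']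
        rcases neg_one_pow_eq_or ℂ p with h | h <;> rw [h] <;> ring
      rw [sum_congr rfl fun n _ => e n, ← mul_sum,
        sum_Ico_eq_sum_range (fun w => x ^ w / ((w : ℂ) ^ p * ((N : ℂ) - w) ^ q))]
      obtain ⟨M, rfl⟩ : ∃ M, N = M + 1 := ⟨N - 1, by omega⟩
      rw [sum_range_succ, Nat.add_sub_cancel, add_comm 1 M, sub_self,
        zero_pow (by omega : q ≠ 0), mul_zero, div_zero, add_zero]
  · rw [← tsum_mul_left, ← tsum_mul_left]
    refine tsum_congr fun v => ?_
    simp only [hf]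
    rw [sign_zpow_neg hx, show (((v + N : ℕ) : ℤ) + 1 : ℤ) = ((N + (v + 1) : ℕ) : ℤ) by
      push_cast; ring, zpow_natCast, pow_add x N]
    push_cast
    rw [show -((N : ℂ) + (v + 1)) + N = -(v + 1) by ring,
      show (N : ℂ) + (v + 1) = v + 1 + N by ring, neg_pow ((v : ℂ) + 1 + N), neg_pow ((v : ℂ) + 1),
      pow_add]
    rcases neg_one_pow_eq_or ℂ p with h | h <;> rcases neg_one_pow_eq_or ℂ q with h' | h' <;>
      rw [h, h'] <;> ring

/-- The terms of `𝔗`, extended by zero to all pairs of integers. -/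
noncomputable def polylogFun (p q : ℕ) (x y : ℂ) (s : ℂ) (n : ℤ × ℤ) : ℂ :=
  if 1 ≤ n.2 then polylogTerm p q x y n s else 0

theorem eq_zero_or_add_eq_zero {n : ℤ × ℤ} (hn : n ∉ polylogIndex) (hm : 1 ≤ n.2) :
    (n.1 : ℂ) = 0 ∨ (n.1 : ℂ) + n.2 = 0 := by
  by_contra h
  rw [not_or] at h
  exact hn ⟨by exact_mod_cast h.1, hm, by exact_mod_cast h.2⟩

theorem polylogFun_eq_zero (hp : 1 ≤ p) (hq : 1 ≤ q) (x y s : ℂ) {n : ℤ × ℤ}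
    (hn : n ∉ polylogIndex) : polylogFun p q x y s n = 0 := by
  rw [polylogFun]
  split_ifs with hm
  · rcases eq_zero_or_add_eq_zero hn hm with h | h
    · simp [polylogTerm, h, show p ≠ 0 by omega]
    · simp [polylogTerm, h, show q ≠ 0 by omega]
  · rfl

theorem hasSum_polylogTerm_iff (hp : 1 ≤ p) (hq : 1 ≤ q) (s A : ℂ) :
    HasSum (fun n : polylogIndex => polylogTerm p q x y n s) A ↔
      HasSum (polylogFun p q x y s) A := by
  rw [← hasSum_subtype_iff_of_support_subset (s := polylogIndex) (f := polylogFun p q x y s)]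
  · refine iff_of_eq (congrArg (HasSum · A) (funext fun n => ?_))
    exact (if_pos n.2.2.1).symm
  · intro n hn
    by_contra h
    exact hn (polylogFun_eq_zero hp hq x y s h)

theorem hasContinuationT (hp : 1 ≤ p) (hq : 1 ≤ q) (hx : x = 1 ∨ x = -1) (hy : y = 1 ∨ y = -1) :
    HasContinuationT p q x y := by
  set a : ℕ × ℤ → ℂ := fun i =>
    if i.1 = 0 then 0 else y ^ i.1 * (x ^ i.2 / ((i.2 : ℂ) ^ p * ((i.2 : ℂ) + i.1) ^ q)) with ha
  have hg : Function.Injective fun i : ℕ × ℤ => ((i.2, (i.1 : ℤ)) : ℤ × ℤ) := by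
    rintro ⟨a, b⟩ ⟨c, d⟩ h
    simp only [Prod.mk.injEq, Nat.cast_inj] at h
    rw [h.1, h.2]
  have hs : ∀ σ : ℝ, 1 < σ → Summable fun i => ‖a i‖ * (i.1 : ℝ) ^ (-σ) := by
    intro σ hσ
    have h1 : Summable fun N : ℕ => (N : ℝ) ^ (-σ) := Real.summable_nat_rpow.2 (by linarith)
    have h2 : Summable fun i : ℕ × ℤ => (i.1 : ℝ) ^ (-σ) * (1 / (i.2 : ℝ) ^ 2) :=
      h1.mul_of_nonneg summable_inv_intCast_sq (fun _ => by positivity) fun _ => by positivity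
    let e : ℕ × ℤ ≃ ℕ × ℤ := Equiv.prodShear (Equiv.refl ℕ) fun N => Equiv.addRight (N : ℤ)
    refine Summable.of_nonneg_of_le (fun i => mul_nonneg (norm_nonneg _)
      (Real.rpow_nonneg (Nat.cast_nonneg _) _)) (fun i => ?_) (h2.add (e.summable_iff.2 h2))
    simp only [ha, e, Function.comp_apply, Equiv.prodShear_apply, Equiv.refl_apply,
      Equiv.coe_addRight]
    rw [← mul_add, mul_comm]
    refine mul_le_mul_of_nonneg_left ?_ (by positivity)
    split_ifs with h0
    · rw [norm_zero]
      positivity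
    · rw [norm_sign_pow_mul hy]
      simpa using norm_div_intCast_pow_mul_le (norm_sign_zpow hx i.2).le hp hq i.2 (i.2 + i.1)
  have hc : ∀ N, 1 ≤ N → ∑' k, a (N, k) =
      y ^ N * ∑' l : ℤ, x ^ l / ((l : ℂ) ^ p * ((l : ℂ) + N) ^ q) := by
    intro N hN
    simp only [ha, if_neg (by omega : N ≠ 0)]
    rw [tsum_mul_left]
  obtain ⟨F, hF, hFs⟩ := exists_continuation (fun k => by simp [ha]) hs
    ((harmonicSum_tsum_intCast hx hp hq).sign_pow hy) hc
  refine ⟨F, hF, fun s hs => ?_⟩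
  rw [hasSum_polylogTerm_iff hp hq, ← hg.hasSum_iff]
  · refine (iff_of_eq (congrArg (HasSum · (F s)) (funext fun i => ?_))).1 (hFs s hs)
    rcases Nat.eq_zero_or_pos i.1 with h0 | h0
    · simp [ha, polylogFun, h0]
    · have h1 : (1 : ℤ) ≤ (i.1 : ℤ) := by exact_mod_cast h0
      simp only [ha, polylogFun, polylogTerm, Function.comp_apply, if_pos h1,
        if_neg h0.ne', zpow_natCast, Int.cast_natCast, Complex.cpow_neg]
      ring
  · rintro ⟨l, m⟩ hm
    refine if_neg fun h => hm ⟨(m.toNat, l), ?_⟩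
    simp only [Prod.mk.injEq, true_and]
    simp only at h
    omega

theorem hasSum_polylogT (hp : 1 ≤ p) (hq : 1 ≤ q) (hx : x = 1 ∨ x = -1) (hy : y = 1 ∨ y = -1)
    {s : ℂ} (hs : 1 < s.re) : HasSum (polylogFun p q x y s) (polylogT p s q x y) :=
  (hasSum_polylogTerm_iff hp hq s _).1
    ((continuation_spec (hasContinuationT hp hq hx hy)).hasSum s hs)

end Polylog

/-! ### Sums of rational functions over the integers -/

theorem hasSum_of_eq {α : Type*} {f g : α → ℂ} {A B : ℂ} (hf : HasSum f A) (h : ∀ i, g i = f i)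
    (hAB : B = A) : HasSum g B := by
  obtain rfl : g = f := funext h
  rwa [hAB]

theorem hasSum_comp_equiv {α β : Type*} (e : α ≃ β) {f : β → ℂ} {A : ℂ} (hf : HasSum f A) :
    HasSum (fun i => f (e i)) A := e.hasSum_iff.2 hf

open PowerSeries in
/-- The expansion of `1 / (X + d)` in powers of `X`. -/
noncomputable def invLinear (d : ℂ) : PowerSeries ℂ :=
  C d⁻¹ * rescale (-d⁻¹) (mk 1)

open PowerSeries in
theorem linear_mul_invLinear {d : ℂ} (hd : d ≠ 0) : (X + C d) * invLinear d = 1 := by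
  have h : (1 + C d⁻¹ * X) * rescale (-d⁻¹) (mk 1 : PowerSeries ℂ) = 1 := by
    have := congrArg (rescale (-d⁻¹)) (mk_one_mul_one_sub_eq_one ℂ)
    rw [map_mul, map_sub, map_one, rescale_X, map_neg] at this
    linear_combination this
  have h1 : (C d : PowerSeries ℂ) * C d⁻¹ = 1 := by rw [← map_mul, mul_inv_cancel₀ hd, map_one]
  rw [invLinear]
  linear_combination h + rescale (-d⁻¹) (mk 1 : PowerSeries ℂ) * h1

open PowerSeries in
theorem coeff_invLinear_pow (d : ℂ) (a n : ℕ) :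
    coeff n (invLinear d ^ (a + 1)) = (-1) ^ n * (a + n).choose a * d⁻¹ ^ (a + 1 + n) := by
  rw [invLinear, mul_pow, ← map_pow, ← map_pow, mk_one_pow_eq_mk_choose_add, coeff_C_mul,
    coeff_rescale, coeff_mk, neg_pow, pow_add d⁻¹ (a + 1)]
  ring

theorem constantCoeff_invLinear (d : ℂ) : PowerSeries.constantCoeff (invLinear d) = d⁻¹ := by
  simp [invLinear, ← PowerSeries.coeff_zero_eq_constantCoeff_apply]

/-- The generating series of the sums `∑_{n ≠ 0} ε ^ n / n ^ k`, where `h` is the zeta-function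
whose values at even integers are half of them; the constant coefficient is `2 h(0)`. -/
noncomputable def zetaSeries (h : ℂ → ℂ) : PowerSeries ℂ :=
  PowerSeries.mk fun k => if Even k then 2 * h k else 0

/-- `h` interpolates the sums `∑_{n ≥ 1} ε ^ n / n ^ k` at the even integers, and the value
`-1 / 2` at `0`. -/
structure IsTwistedZeta (ε : ℂ) (h : ℂ → ℂ) : Prop where
  zero : h 0 = -1 / 2
  hasSum : ∀ k : ℕ, Even k → 2 ≤ k → HasSum (fun n : ℕ => ε ^ (n + 1) / ((n : ℂ) + 1) ^ k) (h k)

theorem isTwistedZeta_riemannZeta : IsTwistedZeta 1 riemannZeta where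
  zero := riemannZeta_zero
  hasSum k _ hk := by
    have h := (summable_sign_div (η := 1) (.inl rfl) (α := k) (β := 0) (by omega) 0).hasSum
    simp only [pow_zero, mul_one] at h
    have h0 : (1 : ℂ) / ((0 : ℕ) : ℂ) ^ k = 0 := by simp [show k ≠ 0 by omega]
    convert h using 1
    rw [zeta_nat_eq_tsum_of_gt_one (by omega), tsum_eq_tsum_succ h0]
    simp

theorem isTwistedZeta_phi : IsTwistedZeta (-1) phi where
  zero := by simp [phi, riemannZeta_zero]; norm_num
  hasSum k _ hk := by
    have h1 := (isTwistedZeta_riemannZeta.hasSum k ‹_› hk)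
    simp only [one_pow] at h1
    -- the even terms contribute `2 ^ (-k) ζ(k)`
    have h2 : HasSum (fun n : ℕ => if Even (n + 1) then 1 / ((n : ℂ) + 1) ^ k else 0)
        ((2 : ℂ)⁻¹ ^ k * riemannZeta k) := by
      have hi : Function.Injective fun n : ℕ => 2 * n + 1 := fun a b h => by
        simp only at h; omega
      rw [← hi.hasSum_iff]
      · refine (iff_of_eq (congrArg (HasSum · _) (funext fun n => ?_))).1 (h1.mul_left _)
        simp only [Function.comp_apply]
        rw [if_pos ⟨n + 1, by ring⟩]
        push_cast
        rw [show (2 : ℂ) * n + 1 + 1 = 2 * (n + 1) by ring, mul_pow, inv_pow, one_div, one_div,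
          mul_inv]
      · intro n hn
        refine if_neg fun ⟨r, hr⟩ => hn ⟨r - 1, ?_⟩
        simp only
        omega
    refine hasSum_of_eq ((h2.mul_left 2).sub h1) (fun n => ?_) ?_
    · split_ifs with h
      · rw [h.neg_one_pow]; ring
      · rw [(Nat.not_even_iff_odd.1 h).neg_one_pow]; ring
    · rw [phi, Complex.cpow_sub _ _ two_ne_zero, Complex.cpow_one, Complex.cpow_natCast, inv_pow]
      ring

theorem hasSum_int_pow {ε : ℂ} (hε : ε = 1 ∨ ε = -1) {h : ℂ → ℂ} (hh : IsTwistedZeta ε h) {k : ℕ}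
    (hk : 2 ≤ k) :
    HasSum (fun n : ℤ => ε ^ n * (n : ℂ)⁻¹ ^ k) (PowerSeries.coeff k (zetaSeries h)) := by
  obtain ⟨A, hA⟩ : ∃ A, HasSum (fun n : ℕ => ε ^ (n + 1) / ((n : ℂ) + 1) ^ k) A := by
    have := (summable_sign_div hε (α := k) (β := 0) (by omega) 0).hasSum
    simp only [pow_zero, mul_one] at this
    exact ⟨_, this⟩
  have h1 := HasSum.of_add_one_of_neg_add_one (f := fun n : ℤ => ε ^ n * (n : ℂ)⁻¹ ^ k)
    (m := A) (m' := (-1) ^ k * A) ?_ ?_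
  · refine hasSum_of_eq h1 (fun n => rfl) ?_
    simp only [zetaSeries, PowerSeries.coeff_mk, Int.cast_zero, inv_zero]
    rw [zero_pow (by omega)]
    split_ifs with he
    · rw [he.neg_one_pow, hA.unique (hh.hasSum k he hk)]; ring
    · rw [(Nat.not_even_iff_odd.1 he).neg_one_pow]; ring
  · refine hasSum_of_eq hA (fun n => ?_) rfl
    rw [← Nat.cast_succ, zpow_natCast, inv_pow, ← div_eq_mul_inv]
    push_cast
    rfl
  · refine hasSum_of_eq (hA.mul_left ((-1) ^ k)) (fun n => ?_) rfl
    rw [sign_zpow_neg hε, ← Nat.cast_succ, zpow_natCast, Int.cast_neg, inv_neg, neg_pow, inv_pow,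
      Nat.succ_eq_add_one]
    push_cast
    ring

/-- The cotangent-type series `∑_n ε ^ n (1 / n - 1 / (n - 1))` vanishes; the terms with a zero
denominator are understood as zero. -/
theorem hasSum_int_inv_sub_one {ε : ℂ} (hε : ε = 1 ∨ ε = -1) :
    HasSum (fun n : ℤ => ε ^ n * ((n : ℂ)⁻¹ - ((n : ℂ) - 1)⁻¹)) 0 := by
  have hs : Summable fun n : ℤ => ε ^ n * ((n : ℂ)⁻¹ - ((n : ℂ) - 1)⁻¹) := by
    have h : Summable fun l : ℤ => 1 / ((l - 1 : ℤ) : ℝ) ^ 2 :=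
      summable_inv_intCast_sq.comp_injective (sub_left_injective (b := 1))
    refine Summable.of_norm_bounded (summable_inv_intCast_sq.add h) fun n => ?_
    rw [norm_mul, norm_sign_zpow hε, one_mul]
    by_cases h0 : n = 0
    · subst h0; norm_num
    by_cases h1 : n = 1
    · subst h1; norm_num
    have := norm_div_intCast_pow_mul_le (z := -1) (by simp) le_rfl le_rfl n (n - 1)
    have h0' : (n : ℂ) ≠ 0 := by exact_mod_cast h0
    have h1' : (n : ℂ) - 1 ≠ 0 := by
      rw [sub_ne_zero]; exact_mod_cast h1
    have e : (n : ℂ)⁻¹ - ((n : ℂ) - 1)⁻¹ = -1 / ((n : ℂ) ^ 1 * ((n - 1 : ℤ) : ℂ) ^ 1) := by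
      push_cast
      field_simp
      ring
    rwa [e]
  rcases hε with rfl | rfl
  · -- both halves telescope, with sums `1` and `-1`
    simp only [one_zpow, one_mul] at hs ⊢
    have t0 := tendsto_one_div_add_atTop_nhds_zero_nat (𝕜 := ℂ)
    have p1 : HasSum (fun n : ℕ => (((n : ℤ) : ℂ)⁻¹ - (((n : ℤ) : ℂ) - 1)⁻¹)) 1 := by
      have hs' : Summable fun n : ℕ => (((n : ℤ) : ℂ)⁻¹ - (((n : ℤ) : ℂ) - 1)⁻¹) :=
        hs.comp_injective Nat.cast_injective
      rw [hs'.hasSum_iff_tendsto_nat, ← tendsto_add_atTop_iff_nat 2]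
      have e : ∀ n : ℕ, ∑ i ∈ range (n + 2), (((i : ℤ) : ℂ)⁻¹ - (((i : ℤ) : ℂ) - 1)⁻¹) =
          1 + 1 / ((n : ℂ) + 1) := by
        intro n
        induction n with
        | zero => simp [sum_range_succ]
        | succ n ih =>
          rw [sum_range_succ, ih]
          push_cast
          rw [show (n : ℂ) + 2 - 1 = n + 1 by ring, show (n : ℂ) + 1 + 1 = n + 2 by ring]
          ring
      simp only [e]
      simpa using t0.const_add 1
    have p2 : HasSum (fun n : ℕ => (((-(n + 1 : ℤ) : ℤ) : ℂ)⁻¹ - (((-(n + 1 : ℤ) : ℤ) : ℂ) - 1)⁻¹))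
        (-1) := by
      have hi : Function.Injective fun n : ℕ => -(n + 1 : ℤ) := fun a b h => by simpa using h
      have hs' : Summable fun n : ℕ =>
          (((-(n + 1 : ℤ) : ℤ) : ℂ)⁻¹ - (((-(n + 1 : ℤ) : ℤ) : ℂ) - 1)⁻¹) := hs.comp_injective hi
      rw [hs'.hasSum_iff_tendsto_nat]
      have e : ∀ n : ℕ, ∑ i ∈ range n, ((((-(i + 1 : ℤ) : ℤ) : ℂ)⁻¹ -
          (((-(i + 1 : ℤ) : ℤ) : ℂ) - 1)⁻¹)) = -1 + 1 / ((n : ℂ) + 1) := by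
        intro n
        induction n with
        | zero => simp
        | succ n ih =>
          rw [sum_range_succ, ih]
          push_cast
          rw [show -((n : ℂ) + 1) - 1 = -(n + 1 + 1) by ring, inv_neg, inv_neg]
          ring
      simp only [e]
      simpa using t0.const_add (-1)
    exact hasSum_of_eq (HasSum.of_nat_of_neg_add_one
      (f := fun n : ℤ => (n : ℂ)⁻¹ - ((n : ℂ) - 1)⁻¹) p1 p2) (fun _ => rfl) (add_neg_cancel _).symm
  · -- the reflection `n ↦ 1 - n` changes the sign
    obtain ⟨A, hA⟩ := hs
    have h1 : HasSum (fun n : ℤ => (-1 : ℂ) ^ n * ((n : ℂ)⁻¹ - ((n : ℂ) - 1)⁻¹)) (-A) := by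
      refine hasSum_of_eq (hasSum_comp_equiv (Equiv.subLeft (1 : ℤ)) hA).neg (fun n => ?_) rfl
      simp only [Equiv.subLeft_apply]
      rw [sub_eq_add_neg 1 n, zpow_add₀ (by norm_num), sign_zpow_neg (.inr rfl)]
      push_cast
      rw [show (1 : ℂ) + -n = -(n - 1) by ring, show -((n : ℂ) - 1) - 1 = -n by ring, inv_neg,
        inv_neg, zpow_one]
      ring
    have h2 : A = 0 := by linear_combination hA.unique h1 / 2
    rwa [h2] at hA

theorem hasSum_int_inv_sub {ε : ℂ} (hε : ε = 1 ∨ ε = -1) (d : ℤ) :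
    HasSum (fun n : ℤ => ε ^ n * ((n : ℂ)⁻¹ - ((n : ℂ) - d)⁻¹)) 0 := by
  have h0 := sign_ne_zero' hε
  have step : ∀ d : ℤ,
      HasSum (fun n : ℤ => ε ^ n * (((n : ℂ) - d)⁻¹ - ((n : ℂ) - (d + 1))⁻¹)) 0 := by
    intro d
    have := (hasSum_comp_equiv (Equiv.subRight d) (hasSum_int_inv_sub_one hε)).mul_left (ε ^ d)
    refine hasSum_of_eq this (fun n => ?_) (mul_zero _).symm
    simp only [Equiv.subRight_apply]
    rw [← mul_assoc, ← zpow_add₀ h0, add_sub_cancel]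
    push_cast
    rw [sub_sub]
  induction d using Int.induction_on with
  | zero => simp
  | succ i ih =>
    refine hasSum_of_eq (ih.add (step i)) (fun n => ?_) (add_zero _).symm
    push_cast
    ring
  | pred i ih =>
    refine hasSum_of_eq (ih.sub (step (-i - 1))) (fun n => ?_) (sub_zero _).symm
    push_cast
    rw [sub_add_cancel]
    ring

theorem hasSum_int_inv_sub_inv {ε : ℂ} (hε : ε = 1 ∨ ε = -1) (c d : ℤ) :
    HasSum (fun n : ℤ => ε ^ n * (((n : ℂ) - c)⁻¹ - ((n : ℂ) - d)⁻¹)) 0 := by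
  refine hasSum_of_eq ((hasSum_int_inv_sub hε d).sub (hasSum_int_inv_sub hε c)) (fun n => ?_)
    (sub_zero _).symm
  ring

theorem prod_pow_add_single {ι M : Type*} [DecidableEq ι] [CommMonoid M] (s : Finset ι)
    (x : ι → M) (e : ι → ℕ) (i : ι) : ∏ k ∈ s, x k ^ (e + Pi.single i 1 : ι → ℕ) k =
      (∏ k ∈ s, x k ^ e k) * if i ∈ s then x i else 1 := by
  simp only [Pi.add_apply, pow_add, prod_mul_distrib]
  congr 1
  rw [← prod_ite_eq' s i x]
  refine prod_congr rfl fun k _ => ?_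
  by_cases hk : k = i
  · subst hk; simp
  · simp [hk]

theorem hasSum_ite_image {ι : Type*} [Fintype ι] {P : ι → ℤ} (hP : Function.Injective P) {f : ℤ → ℂ}
    {A : ℂ} (hf : HasSum f A) :
    HasSum (fun n => if n ∈ univ.image P then 0 else f n) (A - ∑ i, f (P i)) := by
  have h1 : HasSum (fun n => if n ∈ univ.image P then f n else 0) (∑ i, f (P i)) := by
    rw [← sum_image (f := f) (s := univ) hP.injOn]
    exact hasSum_of_eq (hasSum_sum_of_ne_finset_zero (s := univ.image P)
      (f := fun n => if n ∈ univ.image P then f n else 0) fun n hn => if_neg hn) (fun _ => rfl)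
      (sum_congr rfl fun n hn => (if_pos hn).symm)
  refine hasSum_of_eq (hf.sub h1) (fun n => ?_) rfl
  split_ifs <;> simp

section Poles

variable {ι : Type*} [Fintype ι] [DecidableEq ι] {P : ι → ℤ} {ε : ℂ} {h : ℂ → ℂ}

/-- The value `ε ^ n ∏ i, (n - P i) ^ (-e i)` of a twisted rational function, `0` at the points
`P i`. -/
noncomputable def poleTerm (ε : ℂ) (P : ι → ℤ) (e : ι → ℕ) (n : ℤ) : ℂ :=
  if n ∈ univ.image P then 0 else ε ^ n * ∏ i, ((n : ℂ) - P i)⁻¹ ^ e i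

/-- The expansion at `P i` of the product of the factors `(n - P j) ^ (-e j)` with `j ≠ i`. -/
noncomputable def cofactor (P : ι → ℤ) (e : ι → ℕ) (i : ι) : PowerSeries ℂ :=
  ∏ j ∈ univ.erase i, invLinear ((P i : ℂ) - P j) ^ e j

/-- The sum over the integers of a twisted rational function, in terms of its expansions at the
poles. -/
noncomputable def poleSum (ε : ℂ) (h : ℂ → ℂ) (P : ι → ℤ) (e : ι → ℕ) : ℂ :=
  ∑ i, ε ^ P i * PowerSeries.coeff (e i) (zetaSeries h * cofactor P e i)

theorem poleTerm_add_single (e : ι → ℕ) {i j : ι} (hij : P i ≠ P j) (n : ℤ) :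
    poleTerm ε P (e + Pi.single i 1 + Pi.single j 1) n =
      (poleTerm ε P (e + Pi.single i 1) n - poleTerm ε P (e + Pi.single j 1) n) *
        ((P i : ℂ) - P j)⁻¹ := by
  simp only [poleTerm, prod_pow_add_single, mem_univ, if_true]
  split_ifs with hn
  · simp
  · have h1 : ∀ i, (n : ℂ) - P i ≠ 0 := fun i h0 => hn <| by
      rw [mem_image]
      exact ⟨i, mem_univ i, by rw [sub_eq_zero] at h0; exact_mod_cast h0.symm⟩
    have h2 : (P i : ℂ) - P j ≠ 0 := by rw [sub_ne_zero]; exact_mod_cast hij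
    have h3 := h1 i
    have h4 := h1 j
    field_simp
    ring

theorem poleSum_add_single (hP : Function.Injective P) (e : ι → ℕ) {i j : ι} (hij : i ≠ j) :
    poleSum ε h P (e + Pi.single i 1 + Pi.single j 1) =
      (poleSum ε h P (e + Pi.single i 1) - poleSum ε h P (e + Pi.single j 1)) *
        ((P i : ℂ) - P j)⁻¹ := by
  have hne : ∀ {k l}, k ≠ l → (P k : ℂ) - P l ≠ 0 := fun hkl => by
    rw [sub_ne_zero]; exact_mod_cast hP.ne hkl
  rw [poleSum, poleSum, poleSum, ← sum_sub_distrib, sum_mul]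
  refine sum_congr rfl fun k _ => ?_
  rw [eq_mul_inv_iff_mul_eq₀ (hne hij)]
  simp only [cofactor, prod_pow_add_single, mem_erase, mem_univ, and_true, ne_eq]
  set G := zetaSeries h * ∏ l ∈ univ.erase k, invLinear ((P k : ℂ) - P l) ^ e l with hG
  simp only [← mul_assoc, ← hG]
  have X_mul : ∀ (n : ℕ) (F : PowerSeries ℂ),
      PowerSeries.coeff n F = PowerSeries.coeff (n + 1) (PowerSeries.X * F) := fun n F =>
    (PowerSeries.coeff_succ_X_mul n F).symm
  have mul_C : ∀ (n : ℕ) (F : PowerSeries ℂ) (z : ℂ),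
      PowerSeries.coeff n F * z = PowerSeries.coeff n (F * PowerSeries.C z) := fun n F z =>
    (PowerSeries.coeff_mul_C n F z).symm
  rw [mul_assoc, ← mul_sub]
  congr 1
  by_cases hik : i = k
  · subst hik
    have h1 : (j = i) = False := by simp [hij.symm]
    simp only [not_true_eq_false, if_false, h1, not_false_eq_true, if_true, mul_one, Pi.add_apply,
      Pi.single_eq_same, Pi.single_eq_of_ne hij, add_zero]
    rw [X_mul (e i) (G * _), mul_C, ← map_sub]
    congr 1
    linear_combination G * linear_mul_invLinear (hne hij)
  · by_cases hjk : j = k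
    · subst hjk
      simp only [not_true_eq_false, if_false, hik, not_false_eq_true, if_true, mul_one,
        Pi.add_apply, Pi.single_eq_same, Pi.single_eq_of_ne (Ne.symm hij), add_zero]
      rw [X_mul (e j) (G * _), mul_C, ← map_sub]
      congr 1
      have h1 := linear_mul_invLinear (hne (Ne.symm hij))
      have h2 : (PowerSeries.C ((P i : ℂ) - P j)) = -PowerSeries.C ((P j : ℂ) - P i) := by
        rw [← map_neg, neg_sub]
      rw [h2]
      linear_combination -G * h1
    · simp only [hik, hjk, not_false_eq_true, if_true, Pi.add_apply,
        Pi.single_eq_of_ne (Ne.symm hik), Pi.single_eq_of_ne (Ne.symm hjk), add_zero]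
      rw [mul_C, ← map_sub]
      congr 1
      have h1 := linear_mul_invLinear (hne (Ne.symm hik))
      have h2 := linear_mul_invLinear (hne (Ne.symm hjk))
      have h3 : (PowerSeries.C ((P i : ℂ) - P j)) =
          PowerSeries.C ((P k : ℂ) - P j) - PowerSeries.C ((P k : ℂ) - P i) := by
        rw [← map_sub]; congr 1; ring
      rw [h3]
      linear_combination G * invLinear ((P k : ℂ) - P i) * h2 - G * invLinear ((P k : ℂ) - P j) * h1

theorem poleSum_single (h0 : h 0 = -1 / 2) (i : ι) {r : ℕ}
    (hr : 1 ≤ r) : poleSum ε h P (Pi.single i r) =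
      ε ^ P i * PowerSeries.coeff r (zetaSeries h) - ∑ k, ε ^ P k * ((P k : ℂ) - P i)⁻¹ ^ r := by
  have hz : PowerSeries.coeff 0 (zetaSeries h) = -1 := by
    simp [zetaSeries, h0]; norm_num
  rw [poleSum, ← add_sum_erase _ _ (mem_univ i), ← add_sum_erase (a := i)
    (f := fun k => ε ^ P k * ((P k : ℂ) - P i)⁻¹ ^ r) _ (mem_univ i), sub_self, inv_zero,
    zero_pow (by omega), mul_zero, zero_add, sub_eq_add_neg, ← sum_neg_distrib, Pi.single_eq_same]
  congr 1
  · congr 2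
    rw [cofactor, prod_eq_one, mul_one]
    intro j hj
    rw [Pi.single_eq_of_ne (ne_of_mem_erase hj), pow_zero]
  · refine sum_congr rfl fun k hk => ?_
    have hki := ne_of_mem_erase hk
    rw [Pi.single_eq_of_ne hki, PowerSeries.coeff_zero_eq_constantCoeff_apply, map_mul,
      ← PowerSeries.coeff_zero_eq_constantCoeff_apply, hz, cofactor, map_prod,
      prod_eq_single_of_mem i (mem_erase.2 ⟨hki.symm, mem_univ i⟩)]
    · rw [map_pow, constantCoeff_invLinear, Pi.single_eq_same]; ring
    · intro j _ hj
      rw [Pi.single_eq_of_ne hj, pow_zero, map_one]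

theorem poleTerm_single (i : ι) (r : ℕ) (n : ℤ) : poleTerm ε P (Pi.single i r) n =
    if n ∈ univ.image P then 0 else ε ^ n * ((n : ℂ) - P i)⁻¹ ^ r := by
  rw [poleTerm, prod_eq_single i]
  · rw [Pi.single_eq_same]
  · intro j _ hj
    rw [Pi.single_eq_of_ne hj, pow_zero]
  · exact fun hi => absurd (mem_univ i) hi

/-- The sum over the integers of a twisted rational function decaying at least quadratically. Both
sides satisfy the recurrence coming from
`1 / ((n - P i) (n - P j)) = (1 / (n - P i) - 1 / (n - P j)) / (P i - P j)`, which reduces the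
identity to a single pole, or to two simple poles. -/
theorem hasSum_poleTerm (hP : Function.Injective P) (hε : ε = 1 ∨ ε = -1)
    (hh : IsTwistedZeta ε h) (e : ι → ℕ) (he : 2 ≤ ∑ i, e i) :
    HasSum (poleTerm ε P e) (poleSum ε h P e) := by
  obtain ⟨N, hN⟩ : ∃ N, ∑ i, e i = N := ⟨_, rfl⟩
  induction N generalizing e with
  | zero => omega
  | succ N ih =>
    by_cases h2 : ∃ i j, i ≠ j ∧ e i ≠ 0 ∧ e j ≠ 0
    · obtain ⟨i, j, hij, hi, hj⟩ := h2
      obtain ⟨e', rfl⟩ : ∃ e' : ι → ℕ, e = e' + Pi.single i 1 + Pi.single j 1 := by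
        refine ⟨e - Pi.single i 1 - Pi.single j 1, funext fun k => ?_⟩
        simp only [Pi.add_apply, Pi.sub_apply]
        by_cases hk : k = i
        · subst hk; simp [hij]; omega
        · by_cases hk' : k = j
          · subst hk'; simp [hij.symm]; omega
          · simp [hk, hk']
      simp only [Pi.add_apply, sum_add_distrib, sum_pi_single', mem_univ, if_true] at hN he
      rw [poleSum_add_single hP e' hij]
      have key : HasSum (fun n => poleTerm ε P (e' + Pi.single i 1) n -
          poleTerm ε P (e' + Pi.single j 1) n)
          (poleSum ε h P (e' + Pi.single i 1) - poleSum ε h P (e' + Pi.single j 1)) := by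
        rcases Nat.eq_zero_or_pos (∑ k, e' k) with h0 | h0
        · have he' : e' = 0 := by
            funext k
            simpa using (sum_eq_zero_iff.1 h0) k (mem_univ k)
          subst he'
          simp only [zero_add, poleTerm_single, poleSum_single hh.zero _ le_rfl, pow_one]
          have := hasSum_ite_image hP (hasSum_int_inv_sub_inv hε (P i) (P j))
          have hz : PowerSeries.coeff 1 (zetaSeries h) = 0 := by simp [zetaSeries]
          rw [hz]
          refine hasSum_of_eq this (fun n => ?_) ?_
          · split_ifs
            · simp
            · ring
          · simp only [mul_sub, sum_sub_distrib]
            ring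
        · refine (ih _ ?_ ?_).sub (ih _ ?_ ?_) <;>
            simp only [Pi.add_apply, sum_add_distrib, sum_pi_single', mem_univ, if_true] <;> omega
      exact hasSum_of_eq (key.mul_right _) (poleTerm_add_single e' (hP.ne hij)) rfl
    · obtain ⟨i, hi⟩ : ∃ i, e i ≠ 0 := by
        by_contra hne
        push Not at hne
        simp [hne] at he
      have he' : e = Pi.single i (e i) := by
        funext k
        by_cases hk : k = i
        · subst hk; simp
        · rw [Pi.single_eq_of_ne hk]
          by_contra hk'
          exact h2 ⟨k, i, hk, hk', hi⟩
      have hr : 2 ≤ e i := by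
        rw [he', sum_pi_single'] at he
        simpa using he
      rw [he', poleSum_single hh.zero i (by omega)]
      have h3 := (hasSum_comp_equiv (Equiv.subRight (P i)) (hasSum_int_pow hε hh hr)).mul_left
        (ε ^ P i)
      have h4 : HasSum (fun n : ℤ => ε ^ n * ((n : ℂ) - P i)⁻¹ ^ e i)
          (ε ^ P i * PowerSeries.coeff (e i) (zetaSeries h)) := by
        refine hasSum_of_eq h3 (fun n => ?_) rfl
        simp only [Equiv.subRight_apply]
        rw [← mul_assoc, ← zpow_add₀ (sign_ne_zero' hε), add_sub_cancel]
        push_cast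
        rfl
      exact hasSum_of_eq (hasSum_ite_image hP h4) (poleTerm_single i (e i)) rfl

end Poles

/-! ### The expansions at the three poles -/

section PartialFractions

variable {R : Type*} [CommRing R]

/-- The part of the partial fraction decomposition of `u ^ (P + 1) * v ^ (Q + 1)` consisting of
powers of `u`, where `u v = f (u - v)`. -/
def principalPart (P Q : ℕ) (u f : R) : R :=
  ∑ ω ∈ range (P + 1),
    (-1) ^ (P + ω) * ((P + Q - ω).choose Q : R) * f ^ (P + Q + 1 - ω) * u ^ (ω + 1)

theorem principalPart_zero_left (Q : ℕ) (u f : R) : principalPart 0 Q u f = f ^ (Q + 1) * u := by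
  simp [principalPart]

theorem principalPart_succ_zero (P : ℕ) (u f : R) :
    principalPart (P + 1) 0 u f = (-1) ^ (P + 1) * f ^ (P + 2) * u + u * principalPart P 0 u f := by
  rw [principalPart, sum_range_succ', principalPart, mul_sum, add_comm]
  congr 1
  · simp
  · refine sum_congr rfl fun ω hω => ?_
    rw [show P + 1 + 0 + 1 - (ω + 1) = P + 0 + 1 - ω by omega, Nat.choose_zero_right,
      Nat.choose_zero_right]
    ring

theorem principalPart_succ_succ (P Q : ℕ) (u f : R) : principalPart (P + 1) (Q + 1) u f =
    f * (principalPart (P + 1) Q u f - principalPart P (Q + 1) u f) := by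
  have h : principalPart P (Q + 1) u f = ∑ ω ∈ range (P + 2), (-1) ^ (P + ω) *
      ((P + (Q + 1) - ω).choose (Q + 1) : R) * f ^ (P + (Q + 1) + 1 - ω) * u ^ (ω + 1) := by
    rw [sum_range_succ _ (P + 1), principalPart, Nat.choose_eq_zero_of_lt (by omega)]
    simp
  rw [h, principalPart, principalPart, ← sum_sub_distrib, mul_sum]
  refine sum_congr rfl fun ω hω => ?_
  obtain ⟨k, hk⟩ : ∃ k, P + 1 = ω + k := Nat.exists_eq_add_of_le (by have := mem_range.1 hω; omega)
  rw [show P + 1 + (Q + 1) - ω = k + Q + 1 by omega, show P + 1 + Q - ω = k + Q by omega,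
    show P + (Q + 1) - ω = k + Q by omega, show P + 1 + (Q + 1) + 1 - ω = k + Q + 2 by omega,
    show P + 1 + Q + 1 - ω = k + Q + 1 by omega, show P + (Q + 1) + 1 - ω = k + Q + 1 by omega,
    Nat.choose_succ_succ']
  push_cast
  ring

theorem mul_pow_succ_eq {u v f : R} (h : u * v = f * (u - v)) (Q : ℕ) :
    u * v ^ (Q + 1) = f ^ (Q + 1) * u + principalPart Q 0 v (-f) := by
  induction Q with
  | zero => rw [principalPart_zero_left]; linear_combination h
  | succ Q ih =>
    have h2 : (-1 : R) ^ (Q + 1) * (-f) ^ (Q + 2) = -f ^ (Q + 2) := by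
      rw [neg_pow f, ← mul_assoc, ← pow_add, show Q + 1 + (Q + 2) = 2 * (Q + 1) + 1 by ring,
        pow_succ, pow_mul]
      simp
    rw [principalPart_succ_zero, h2]
    linear_combination v * ih + f ^ (Q + 1) * h

/-- Partial fractions. -/
theorem pow_succ_mul_pow_succ_eq {u v f : R} (h : u * v = f * (u - v)) (P Q : ℕ) :
    u ^ (P + 1) * v ^ (Q + 1) = principalPart P Q u f + principalPart Q P v (-f) := by
  have h' : v * u = -f * (v - u) := by linear_combination h
  induction P generalizing Q with
  | zero => rw [principalPart_zero_left, zero_add, pow_one, mul_pow_succ_eq h]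
  | succ P ihP =>
    induction Q with
    | zero =>
      have := mul_pow_succ_eq h' (P + 1)
      rw [neg_neg] at this
      rw [principalPart_zero_left, zero_add, pow_one, mul_comm, this, add_comm]
    | succ Q ihQ =>
      have := ihP (Q + 1)
      rw [principalPart_succ_succ, principalPart_succ_succ]
      linear_combination f * ihQ - f * this + u ^ (P + 1) * v ^ (Q + 1) * h

end PartialFractions

section Expansions

theorem coeff_zetaSeries_mul (h : ℂ → ℂ) (G : PowerSeries ℂ) (n : ℕ) :
    PowerSeries.coeff n (zetaSeries h * G) =
      ∑ j ∈ range (n / 2 + 1), 2 * h (2 * j) * PowerSeries.coeff (n - 2 * j) G := by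
  rw [PowerSeries.coeff_mul, Finset.Nat.sum_antidiagonal_eq_sum_range_succ
    (fun i j => PowerSeries.coeff i (zetaSeries h) * PowerSeries.coeff j G)]
  symm
  refine sum_of_injOn (fun j => 2 * j) (fun a _ b _ h => by simpa using h) (fun j hj => ?_)
    (fun k hk hk' => ?_) fun j hj => ?_
  · simp only [coe_range, Set.mem_Iio] at hj ⊢
    omega
  · have : ¬ Even k := by
      rintro ⟨r, rfl⟩
      refine hk' ⟨r, ?_, by ring⟩
      simp only [coe_range, Set.mem_Iio, mem_range] at hk ⊢
      omega
    simp [zetaSeries, this]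
  · simp [zetaSeries]

theorem coeff_invLinear_pow_mul (d₁ d₂ : ℂ) (a c n : ℕ) :
    PowerSeries.coeff n (invLinear d₁ ^ (a + 1) * invLinear d₂ ^ (c + 1)) =
      (-1) ^ n * ∑ ω ∈ range (n + 1), ((a + ω).choose a : ℂ) * ((c + (n - ω)).choose c : ℂ) *
        (d₁⁻¹ ^ (a + 1 + ω) * d₂⁻¹ ^ (c + 1 + (n - ω))) := by
  rw [PowerSeries.coeff_mul, Finset.Nat.sum_antidiagonal_eq_sum_range_succ
    (fun i j => PowerSeries.coeff i (invLinear d₁ ^ (a + 1)) *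
      PowerSeries.coeff j (invLinear d₂ ^ (c + 1))), mul_sum]
  refine sum_congr rfl fun ω hω => ?_
  have h : (-1 : ℂ) ^ n = (-1) ^ ω * (-1) ^ (n - ω) := by
    rw [← pow_add, Nat.add_sub_cancel' (by have := mem_range.1 hω; omega)]
  rw [coeff_invLinear_pow, coeff_invLinear_pow, h]
  ring

theorem invLinear_mul_eq {d₁ d₂ : ℂ} (h₁ : d₁ ≠ 0) (h₂ : d₂ ≠ 0) (h : d₂ - d₁ ≠ 0) :
    invLinear d₁ * invLinear d₂ =
      PowerSeries.C (d₂ - d₁)⁻¹ * (invLinear d₁ - invLinear d₂) := by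
  have e1 := linear_mul_invLinear h₁
  have e2 := linear_mul_invLinear h₂
  have e3 : PowerSeries.C (d₂ - d₁)⁻¹ * (PowerSeries.C d₂ - PowerSeries.C d₁) = 1 := by
    rw [← map_sub, ← map_mul, inv_mul_cancel₀ h, map_one]
  linear_combination PowerSeries.C (d₂ - d₁)⁻¹ * invLinear d₁ * e2 -
    PowerSeries.C (d₂ - d₁)⁻¹ * invLinear d₂ * e1 - invLinear d₁ * invLinear d₂ * e3

theorem coeff_principalPart (P Q n : ℕ) (d f : ℂ) :
    PowerSeries.coeff n (principalPart P Q (invLinear d) (PowerSeries.C f)) =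
      ∑ ω ∈ range (P + 1), (-1) ^ (P + ω + n) * ((ω + n).choose ω : ℂ) *
        ((P + Q - ω).choose Q : ℂ) * f ^ (P + Q + 1 - ω) * d⁻¹ ^ (ω + 1 + n) := by
  rw [principalPart, map_sum]
  refine sum_congr rfl fun ω _ => ?_
  have h : ((-1) ^ (P + ω) * ((P + Q - ω).choose Q : PowerSeries ℂ) *
      PowerSeries.C f ^ (P + Q + 1 - ω)) =
      PowerSeries.C ((-1) ^ (P + ω) * ((P + Q - ω).choose Q : ℂ) * f ^ (P + Q + 1 - ω)) := by
    simp
  rw [h, PowerSeries.coeff_C_mul, coeff_invLinear_pow, pow_add (-1 : ℂ) (P + ω) n]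
  ring

end Expansions

section FunctionalSum

variable {ε s : ℂ} {h : ℂ → ℂ} {p q a b c : ℕ} {l m : ℤ}

theorem polylogFun_eq {P Q : ℕ} {x y : ℂ} (hm : 1 ≤ m) (k : ℕ) :
    polylogFun P Q x y (s + k) (l, m) = x ^ l * y ^ m *
      ((l : ℂ)⁻¹ ^ P * ((m : ℂ) ^ s)⁻¹ * (m : ℂ)⁻¹ ^ k * ((l : ℂ) + m)⁻¹ ^ Q) := by
  have hm' : (m : ℂ) ≠ 0 := by exact_mod_cast (by omega : m ≠ 0)
  rw [polylogFun, if_pos (by exact hm), polylogTerm]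
  dsimp only
  rw [Complex.cpow_add _ _ hm', Complex.cpow_natCast, div_eq_mul_inv, mul_inv, mul_inv, mul_inv,
    inv_pow, inv_pow, inv_pow]
  ring

theorem polylogFun_eq' {P Q : ℕ} {x y : ℂ} (hm : 1 ≤ m) :
    polylogFun P Q x y s (l, m) = x ^ l * y ^ m *
      ((l : ℂ)⁻¹ ^ P * ((m : ℂ) ^ s)⁻¹ * ((l : ℂ) + m)⁻¹ ^ Q) := by
  have := polylogFun_eq (s := s) (l := l) (P := P) (Q := Q) (x := x) (y := y) hm 0
  simpa using this

/-- The contribution of the pole `n = 0`. -/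
theorem expansion_zero (hm : 1 ≤ m) (ha : 1 ≤ a) (hc : 1 ≤ c) :
    ε ^ m * ((l : ℂ)⁻¹ ^ q * ((m : ℂ) ^ s)⁻¹ * ((l : ℂ) + m)⁻¹ ^ b) *
      PowerSeries.coeff p (zetaSeries h * (invLinear l ^ a * invLinear ((l : ℂ) + m) ^ c)) =
    2 * (-1) ^ p * ∑ j ∈ range (p / 2 + 1), h (2 * j) * ∑ ω ∈ range (p - 2 * j + 1),
        ((ω + a - 1).choose ω : ℂ) * ((p + c - 2 * j - ω - 1).choose (c - 1) : ℂ) *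
          polylogFun (q + a + ω) (p + b + c - 2 * j - ω) 1 ε s (l, m) := by
  obtain ⟨a, rfl⟩ := Nat.exists_eq_add_of_le' ha
  obtain ⟨c, rfl⟩ := Nat.exists_eq_add_of_le' hc
  rw [coeff_zetaSeries_mul, mul_sum, mul_sum]
  refine sum_congr rfl fun j hj => ?_
  have hj' : 2 * j ≤ p := by have := mem_range.1 hj; omega
  have hpar : (-1 : ℂ) ^ (p - 2 * j) = (-1) ^ p := by
    obtain ⟨k, rfl⟩ := Nat.exists_eq_add_of_le hj'
    rw [Nat.add_sub_cancel_left, pow_add, pow_mul]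
    simp
  rw [coeff_invLinear_pow_mul, hpar, mul_sum, mul_sum, mul_sum, mul_sum, mul_sum]
  refine sum_congr rfl fun ω hω => ?_
  have hω' : ω ≤ p - 2 * j := by have := mem_range.1 hω; omega
  rw [polylogFun_eq' hm, one_zpow, show ω + (a + 1) - 1 = a + ω by omega, Nat.choose_symm_add,
    show p + (c + 1) - 2 * j - ω - 1 = c + (p - 2 * j - ω) by omega, Nat.add_sub_cancel,
    show p + b + (c + 1) - 2 * j - ω = b + (c + 1 + (p - 2 * j - ω)) by omega, pow_add _ b,
    add_assoc q, pow_add _ q]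
  ring

/-- The contribution of the pole `n = -l - m`. -/
theorem expansion_two (hε : ε = 1 ∨ ε = -1) (hm : 1 ≤ m) (hp : 1 ≤ p) (ha : 1 ≤ a) :
    ε ^ m * ((l : ℂ)⁻¹ ^ q * ((m : ℂ) ^ s)⁻¹ * ((l : ℂ) + m)⁻¹ ^ b) *
      (ε ^ (-(l + m)) * PowerSeries.coeff c
        (zetaSeries h * (invLinear (-m) ^ a * invLinear (-((l : ℂ) + m)) ^ p))) =
    2 * (-1) ^ (p + a) * ∑ j ∈ range (c / 2 + 1), h (2 * j) * ∑ ω ∈ range (c - 2 * j + 1),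
        ((ω + a - 1).choose ω : ℂ) * ((p + c - 2 * j - ω - 1).choose (p - 1) : ℂ) *
          polylogFun q (p + b + c - 2 * j - ω) ε 1 (s + a + ω) (l, m) := by
  obtain ⟨a, rfl⟩ := Nat.exists_eq_add_of_le' ha
  obtain ⟨p, rfl⟩ := Nat.exists_eq_add_of_le' hp
  have hsign : ε ^ m * ε ^ (-(l + m)) = ε ^ l := by
    rw [← zpow_add₀ (sign_ne_zero' hε), ← sign_zpow_neg hε l]
    congr 1
    ring
  rw [coeff_zetaSeries_mul, mul_sum, mul_sum, mul_sum]
  refine sum_congr rfl fun j hj => ?_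
  have hj' : 2 * j ≤ c := by have := mem_range.1 hj; omega
  rw [coeff_invLinear_pow_mul, mul_sum, mul_sum, mul_sum, mul_sum, mul_sum, mul_sum]
  refine sum_congr rfl fun ω hω => ?_
  have hω' : ω ≤ c - 2 * j := by have := mem_range.1 hω; omega
  obtain ⟨r, hr⟩ := Nat.exists_eq_add_of_le hω'
  have e : s + (a + 1 : ℕ) + ω = s + ((a + 1 + ω : ℕ) : ℂ) := by push_cast; ring
  have hpar : (-1 : ℂ) ^ (ω + r) * ((-1) ^ (a + 1 + ω) * (-1) ^ (p + 1 + r)) =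
      (-1) ^ (p + 1 + (a + 1)) := by
    rw [← pow_add, ← pow_add, show ω + r + (a + 1 + ω + (p + 1 + r)) =
      p + 1 + (a + 1) + 2 * (ω + r) by ring, pow_add _ (p + 1 + (a + 1)), pow_mul]
    simp
  rw [e, polylogFun_eq hm, one_zpow, show ω + (a + 1) - 1 = a + ω by omega, Nat.choose_symm_add,
    show p + 1 + c - 2 * j - ω - 1 = p + r by omega, Nat.add_sub_cancel,
    show p + 1 + b + c - 2 * j - ω = b + (p + 1 + r) by omega, pow_add _ b, hr,
    Nat.add_sub_cancel_left, ← hpar, inv_neg, inv_neg, neg_pow ((m : ℂ)⁻¹),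
    neg_pow (((l : ℂ) + m)⁻¹),
    ← hsign]
  ring

/-- The contribution of the pole `n = -l`. The product of the two other factors is decomposed into
partial fractions before it is expanded, which produces the last two lines of the right-hand
side. -/
theorem expansion_one (hε : ε = 1 ∨ ε = -1) (hm : 1 ≤ m) (hl : l ≠ 0) (hlm : l + m ≠ 0)
    (hp : 1 ≤ p) (hc : 1 ≤ c) :
    ε ^ m * ((l : ℂ)⁻¹ ^ q * ((m : ℂ) ^ s)⁻¹ * ((l : ℂ) + m)⁻¹ ^ b) *
      (ε ^ (-l) * PowerSeries.coeff a
        (zetaSeries h * (invLinear (-l) ^ p * invLinear m ^ c))) =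
    2 * (-1) ^ p * ∑ j ∈ range (a / 2 + 1), h (2 * j) * ∑ ω ∈ range p,
        ((ω + a - 2 * j).choose ω : ℂ) * ((p + c - 2 - ω).choose (c - 1) : ℂ) *
          polylogFun (q + a - 2 * j + ω + 1) (p + b + c - 1 - ω) ε ε s (l, m) +
    2 * (-1) ^ (p + a) * ∑ j ∈ range (a / 2 + 1), h (2 * j) * ∑ ω ∈ range c,
        ((ω + a - 2 * j).choose ω : ℂ) * ((p + c - 2 - ω).choose (p - 1) : ℂ) *
          polylogFun q (p + b + c - 1 - ω) ε ε (s + a - 2 * j + ω + 1) (l, m) := by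
  obtain ⟨c, rfl⟩ := Nat.exists_eq_add_of_le' hc
  obtain ⟨p, rfl⟩ := Nat.exists_eq_add_of_le' hp
  have hl' : (l : ℂ) ≠ 0 := by exact_mod_cast hl
  have hm' : (m : ℂ) ≠ 0 := by exact_mod_cast (by omega : m ≠ 0)
  have hlm' : (m : ℂ) - -l ≠ 0 := by
    rw [sub_neg_eq_add, add_comm]; exact_mod_cast hlm
  have hpf := pow_succ_mul_pow_succ_eq (invLinear_mul_eq (neg_ne_zero.2 hl') hm' hlm') p c
  rw [sub_neg_eq_add, add_comm (m : ℂ), ← map_neg] at hpf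
  rw [hpf, coeff_zetaSeries_mul, mul_sum, mul_sum, mul_sum, mul_sum, ← sum_add_distrib]
  refine sum_congr rfl fun j hj => ?_
  obtain ⟨n, rfl⟩ : ∃ n, a = n + 2 * j :=
    ⟨a - 2 * j, by have := mem_range.1 hj; omega⟩
  rw [map_add, coeff_principalPart, coeff_principalPart, mul_add, mul_add, mul_add]
  simp only [mul_sum]
  congr 1
  · refine sum_congr rfl fun ω hω => ?_
    have hω' : ω ≤ p := by have := mem_range.1 hω; omega
    have hpar : (-1 : ℂ) ^ (p + ω + n) * (-1) ^ (ω + 1 + n) = (-1) ^ (p + 1) := by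
      rw [← pow_add, show p + ω + n + (ω + 1 + n) = p + 1 + 2 * (ω + n) by ring,
        pow_add _ (p + 1), pow_mul]
      simp
    rw [polylogFun_eq' hm, Nat.add_sub_cancel, show ω + (n + 2 * j) - 2 * j = ω + n by omega,
      show p + 1 + (c + 1) - 2 - ω = p + c - ω by omega, Nat.add_sub_cancel,
      show q + (n + 2 * j) - 2 * j + ω + 1 = q + (ω + 1 + n) by omega,
      show p + 1 + b + (c + 1) - 1 - ω = b + (p + c + 1 - ω) by omega, pow_add _ b, pow_add _ q,
      ← hpar, inv_neg, neg_pow ((l : ℂ)⁻¹), sign_zpow_neg hε]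
    ring
  · refine sum_congr rfl fun ω hω => ?_
    have hω' : ω ≤ c := by have := mem_range.1 hω; omega
    have e : s + (n + 2 * j : ℕ) - 2 * j + ω + 1 = s + ((ω + 1 + n : ℕ) : ℂ) := by push_cast; ring
    obtain ⟨r, hr⟩ := Nat.exists_eq_add_of_le hω'
    have hpar : (-1 : ℂ) ^ (c + ω + n) * (-1) ^ (p + r + 1) = (-1) ^ (p + 1 + (n + 2 * j)) := by
      rw [← pow_add, show c + ω + n + (p + r + 1) = p + 1 + n + 2 * (ω + r) by omega,
        pow_add _ (p + 1 + n), pow_mul, ← add_assoc (p + 1), pow_add _ (p + 1 + n), pow_mul]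
      simp
    rw [e, polylogFun_eq hm, show ω + (n + 2 * j) - 2 * j = ω + n by omega,
      show p + 1 + (c + 1) - 2 - ω = p + r by omega, Nat.add_sub_cancel,
      show p + 1 + b + (c + 1) - 1 - ω = b + (p + r + 1) by omega, pow_add _ b,
      Nat.add_sub_cancel, show c + p - ω = p + r by omega, show c + p + 1 - ω = p + r + 1 by omega,
      ← hpar, neg_pow (((l : ℂ) + m)⁻¹), sign_zpow_neg hε]
    ring

end FunctionalSum

/-! ### The sum over the fibres -/

section Fibre

variable {ε s : ℂ} {h : ℂ → ℂ} {p q a b c : ℕ}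

/-- The term at `(n, l, m)` of the sum over all signs of the three coordinates; the index is
`((l, m), n)`. -/
noncomputable def latticeTerm (ε : ℂ) (p q a b c : ℕ) (s : ℂ) (x : (ℤ × ℤ) × ℤ) : ℂ :=
  if 1 ≤ x.1.2 then ε ^ (x.2 + x.1.2) * (((x.1.2 : ℂ) ^ s)⁻¹ * (x.2 : ℂ)⁻¹ ^ p * (x.1.1 : ℂ)⁻¹ ^ q *
    ((x.2 : ℂ) + x.1.1)⁻¹ ^ a * ((x.1.1 : ℂ) + x.1.2)⁻¹ ^ b *
    ((x.2 : ℂ) + x.1.1 + x.1.2)⁻¹ ^ c) else 0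

/-- The term at `(l, m)` of the right-hand side, a combination of terms of series `𝔗`. -/
noncomputable def rhsTerm (ε : ℂ) (h : ℂ → ℂ) (p q a b c : ℕ) (s : ℂ) (n : ℤ × ℤ) : ℂ :=
  2 * (-1) ^ p * ∑ j ∈ range (p / 2 + 1), h (2 * j) * ∑ ω ∈ range (p - 2 * j + 1),
      ((ω + a - 1).choose ω : ℂ) * ((p + c - 2 * j - ω - 1).choose (c - 1) : ℂ) *
        polylogFun (q + a + ω) (p + b + c - 2 * j - ω) 1 ε s n
  + 2 * (-1) ^ (p + a) * ∑ j ∈ range (c / 2 + 1), h (2 * j) * ∑ ω ∈ range (c - 2 * j + 1),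
      ((ω + a - 1).choose ω : ℂ) * ((p + c - 2 * j - ω - 1).choose (p - 1) : ℂ) *
        polylogFun q (p + b + c - 2 * j - ω) ε 1 (s + a + ω) n
  + 2 * (-1) ^ p * ∑ j ∈ range (a / 2 + 1), h (2 * j) * ∑ ω ∈ range p,
      ((ω + a - 2 * j).choose ω : ℂ) * ((p + c - 2 - ω).choose (c - 1) : ℂ) *
        polylogFun (q + a - 2 * j + ω + 1) (p + b + c - 1 - ω) ε ε s n
  + 2 * (-1) ^ (p + a) * ∑ j ∈ range (a / 2 + 1), h (2 * j) * ∑ ω ∈ range c,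
      ((ω + a - 2 * j).choose ω : ℂ) * ((p + c - 2 - ω).choose (p - 1) : ℂ) *
        polylogFun q (p + b + c - 1 - ω) ε ε (s + a - 2 * j + ω + 1) n

theorem hasSum_rhsTerm (hε : ε = 1 ∨ ε = -1) (hp : 1 ≤ p) (hq : 1 ≤ q) (hb : 1 ≤ b) (hc : 1 ≤ c)
    (hs : 1 < s.re) :
    HasSum (rhsTerm ε h p q a b c s) (rhs h 1 ε ε 1 ε ε ε ε p q a b c s) := by
  have h1 : (1 : ℂ) = 1 ∨ (1 : ℂ) = -1 := .inl rfl
  refine (((HasSum.mul_left _ (hasSum_sum fun j hj => (hasSum_sum fun ω hω =>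
    (hasSum_polylogT ?_ ?_ h1 hε ?_).mul_left _).mul_left _)).add
    (HasSum.mul_left _ (hasSum_sum fun j hj => (hasSum_sum fun ω hω =>
    (hasSum_polylogT ?_ ?_ hε h1 ?_).mul_left _).mul_left _))).add
    (HasSum.mul_left _ (hasSum_sum fun j hj => (hasSum_sum fun ω hω =>
    (hasSum_polylogT ?_ ?_ hε hε ?_).mul_left _).mul_left _))).add
    (HasSum.mul_left _ (hasSum_sum fun j hj => (hasSum_sum fun ω hω =>
    (hasSum_polylogT ?_ ?_ hε hε ?_).mul_left _).mul_left _))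
  all_goals
    rw [mem_range] at hj hω
    beta_reduce
  any_goals first | omega | exact hs
  · have e : (s + a + ω).re = s.re + a + ω := by simp
    have h1 : (0 : ℝ) ≤ a := by positivity
    have h2 : (0 : ℝ) ≤ ω := by positivity
    linarith
  · have e : (s + a - 2 * j + ω + 1).re = s.re + a - 2 * j + ω + 1 := by simp
    have hj' : (2 * j : ℝ) ≤ a := by exact_mod_cast (by omega : 2 * j ≤ a)
    have hω' : (0 : ℝ) ≤ ω := by positivity
    linarith

theorem rhsTerm_eq_zero (hp : 1 ≤ p) (hq : 1 ≤ q) (hb : 1 ≤ b) (hc : 1 ≤ c) {n : ℤ × ℤ}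
    (hn : n ∉ polylogIndex) : rhsTerm ε h p q a b c s n = 0 := by
  rw [rhsTerm, sum_eq_zero, sum_eq_zero, sum_eq_zero, sum_eq_zero]
  · simp
  all_goals
    intro j hj
    rw [sum_eq_zero, mul_zero]
    intro ω hω
    rw [mem_range] at hj hω
    rw [polylogFun_eq_zero (by omega) (by omega) _ _ _ hn, mul_zero]

/-- The sum over `n` for fixed `(l, m)`. -/
theorem hasSum_latticeTerm_fibre (hε : ε = 1 ∨ ε = -1) (hh : IsTwistedZeta ε h) (hp : 1 ≤ p)
    (hq : 1 ≤ q) (ha : 1 ≤ a) (hb : 1 ≤ b) (hc : 1 ≤ c) (n : ℤ × ℤ) :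
    HasSum (fun k => latticeTerm ε p q a b c s (n, k)) (rhsTerm ε h p q a b c s n) := by
  by_cases hn : n ∈ polylogIndex
  swap
  · refine hasSum_of_eq hasSum_zero (fun k => ?_) (rhsTerm_eq_zero hp hq hb hc hn)
    rw [latticeTerm]
    split_ifs with hm
    · rcases eq_zero_or_add_eq_zero hn hm with h' | h'
      · simp [h', show q ≠ 0 by omega]
      · simp [h', show b ≠ 0 by omega]
    · rfl
  obtain ⟨l, m⟩ := n
  obtain ⟨hl, hm, hlm⟩ := hn
  simp only at hl hm hlm
  set P : Fin 3 → ℤ := ![0, -l, -(l + m)] with hP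
  set e : Fin 3 → ℕ := ![p, a, c] with he
  have hinj : Function.Injective P := by
    intro i j hij
    fin_cases i <;> fin_cases j <;> simp [hP] at hij ⊢ <;> omega
  have key := hasSum_poleTerm hinj hε hh e (by simp [he, Fin.sum_univ_three]; omega)
  have e0 : univ.erase (0 : Fin 3) = {1, 2} := by decide
  have e1 : univ.erase (1 : Fin 3) = {0, 2} := by decide
  have e2 : univ.erase (2 : Fin 3) = {1, 0} := by decide
  have c0 : cofactor P e 0 = invLinear l ^ a * invLinear ((l : ℂ) + m) ^ c := by
    rw [cofactor, e0, prod_pair (by decide)]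
    simp [hP, he, add_comm]
  have c1 : cofactor P e 1 = invLinear (-l) ^ p * invLinear m ^ c := by
    rw [cofactor, e1, prod_pair (by decide)]
    simp [hP, he]
  have c2 : cofactor P e 2 = invLinear (-m) ^ a * invLinear (-((l : ℂ) + m)) ^ p := by
    rw [cofactor, e2, prod_pair (by decide)]
    simp [hP, he, add_comm]
  refine hasSum_of_eq (key.mul_left
    (ε ^ m * ((l : ℂ)⁻¹ ^ q * ((m : ℂ) ^ s)⁻¹ * ((l : ℂ) + m)⁻¹ ^ b))) (fun k => ?_) ?_
  · rw [latticeTerm, if_pos (by exact hm), poleTerm, Fin.prod_univ_three]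
    dsimp only
    simp only [hP, he, Matrix.cons_val_zero, Matrix.cons_val_one, Matrix.cons_val, Int.cast_zero,
      Int.cast_neg, Int.cast_add, sub_zero, sub_neg_eq_add]
    split_ifs with hk
    · rw [mem_image] at hk
      obtain ⟨i, -, rfl⟩ := hk
      fin_cases i
      · simp [show p ≠ 0 by omega]
      · simp [show a ≠ 0 by omega]
      · simp [show c ≠ 0 by omega, add_assoc]
    · rw [zpow_add₀ (sign_ne_zero' hε), add_assoc (k : ℂ)]
      ring
  · rw [poleSum, Fin.sum_univ_three, c0, c1, c2, mul_add, mul_add]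
    simp only [hP, he, Matrix.cons_val_zero, Matrix.cons_val_one, Matrix.cons_val, zpow_zero,
      one_mul]
    rw [expansion_zero hm ha hc, expansion_one hε hm hl hlm hp hc, expansion_two hε hm hp ha,
      rhsTerm]
    ring

end Fibre

/-! ### The chambers -/

section Chambers

/-- The twelve linear maps from the open dominant chamber onto the chambers contained in the half
space `m > 0`; the point `(n, l, m)` is encoded as `((l, m), n)`. -/
def chamberMap (i : Fin 12) (k : ℕ × ℕ × ℕ) : (ℤ × ℤ) × ℤ :=
  let x : ℤ := k.1
  let y : ℤ := k.2.1
  let z : ℤ := k.2.2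
  (![((y, z), x), ((x + y, z), -x), ((x, y + z), -(x + y)), ((x, y), -(x + y + z)),
    ((-y, y + z), x + y), ((-(y + z), y), x + y + z), ((-(x + y), x + y + z), y),
    ((-(x + y + z), x + y), y + z), ((-(x + y + z), x), z), ((-x, x + y + z), -y),
    ((-x, x + y), -(y + z)), ((-(x + y), x), -z)] : Fin 12 → (ℤ × ℤ) × ℤ) i

/-- The index of the chamber containing a point with `m > 0` outside all walls. -/
def chamber (x : (ℤ × ℤ) × ℤ) : Fin 12 :=
  let n := x.2
  let l := x.1.1
  let m := x.1.2
  if 0 < n then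
    if 0 < l then 0
    else if 0 < n + l then if 0 < l + m then 4 else 5
    else if 0 < l + m then 6
    else if 0 < n + l + m then 7 else 8
  else if 0 < l then
    if 0 < n + l then 1
    else if 0 < n + l + m then 2 else 3
  else if 0 < l + m then if 0 < n + l + m then 9 else 10
  else 11

theorem chamberMap_injective (i : Fin 12) : Function.Injective (chamberMap i) := by
  rintro ⟨x, y, z⟩ ⟨x', y', z'⟩ h
  fin_cases i <;>
  · simp [chamberMap] at h
    simp only [Prod.mk.injEq]
    omega

theorem chamber_chamberMap (i : Fin 12) {k : ℕ × ℕ × ℕ} (hk : IsPositive k) :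
    chamber (chamberMap i k) = i := by
  obtain ⟨h1, h2, h3⟩ := hk
  fin_cases i <;>
  · simp [chamberMap, chamber]
    split_ifs <;> first | rfl | (exfalso; omega)

theorem exists_chamberMap_eq {n l m : ℤ} (hm : 1 ≤ m) (hn : n ≠ 0) (hl : l ≠ 0) (hnl : n + l ≠ 0)
    (hlm : l + m ≠ 0) (hnlm : n + l + m ≠ 0) :
    ∃ k, IsPositive k ∧ chamberMap (chamber ((l, m), n)) k = ((l, m), n) := by
  simp only [chamber]
  split_ifs
  · refine ⟨(n.toNat, l.toNat, m.toNat), ⟨?_, ?_, ?_⟩, ?_⟩ <;> simp [chamberMap] <;> omega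
  · refine ⟨((n + l).toNat, (-l).toNat, (l + m).toNat), ⟨?_, ?_, ?_⟩, ?_⟩ <;>
      simp [chamberMap] <;> omega
  · refine ⟨((n + l).toNat, m.toNat, (-(l + m)).toNat), ⟨?_, ?_, ?_⟩, ?_⟩ <;>
      simp [chamberMap] <;> omega
  · refine ⟨((-(n + l)).toNat, n.toNat, (l + m).toNat), ⟨?_, ?_, ?_⟩, ?_⟩ <;>
      simp [chamberMap] <;> omega
  · refine ⟨((-(n + l)).toNat, (n + l + m).toNat, (-(l + m)).toNat), ⟨?_, ?_, ?_⟩, ?_⟩ <;>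
      simp [chamberMap] <;> omega
  · refine ⟨(m.toNat, (-(n + l + m)).toNat, n.toNat), ⟨?_, ?_, ?_⟩, ?_⟩ <;>
      simp [chamberMap] <;> omega
  · refine ⟨((-n).toNat, (n + l).toNat, m.toNat), ⟨?_, ?_, ?_⟩, ?_⟩ <;>
      simp [chamberMap] <;> omega
  · refine ⟨(l.toNat, (-(n + l)).toNat, (n + l + m).toNat), ⟨?_, ?_, ?_⟩, ?_⟩ <;>
      simp [chamberMap] <;> omega
  · refine ⟨(l.toNat, m.toNat, (-(n + l + m)).toNat), ⟨?_, ?_, ?_⟩, ?_⟩ <;>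
      simp [chamberMap] <;> omega
  · refine ⟨((-l).toNat, (-n).toNat, (n + l + m).toNat), ⟨?_, ?_, ?_⟩, ?_⟩ <;>
      simp [chamberMap] <;> omega
  · refine ⟨((-l).toNat, (l + m).toNat, (-(n + l + m)).toNat), ⟨?_, ?_, ?_⟩, ?_⟩ <;>
      simp [chamberMap] <;> omega
  · refine ⟨(m.toNat, (-(l + m)).toNat, (-n).toNat), ⟨?_, ?_, ?_⟩, ?_⟩ <;>
      simp [chamberMap] <;> omega

variable {ε s : ℂ} {p q a b c : ℕ}

theorem exists_chamberMap_eq_of_latticeTerm_ne_zero (hp : 1 ≤ p) (hq : 1 ≤ q) (ha : 1 ≤ a)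
    (hb : 1 ≤ b) (hc : 1 ≤ c) {x : (ℤ × ℤ) × ℤ} (hx : latticeTerm ε p q a b c s x ≠ 0) :
    ∃ k, IsPositive k ∧ chamberMap (chamber x) k = x := by
  obtain ⟨⟨l, m⟩, n⟩ := x
  rw [latticeTerm] at hx
  split_ifs at hx with hm
  · simp only [mul_ne_zero_iff, pow_ne_zero_iff (by omega : p ≠ 0),
      pow_ne_zero_iff (by omega : q ≠ 0), pow_ne_zero_iff (by omega : a ≠ 0),
      pow_ne_zero_iff (by omega : b ≠ 0), pow_ne_zero_iff (by omega : c ≠ 0), ne_eq,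
      inv_eq_zero] at hx
    obtain ⟨-, ⟨⟨⟨⟨-, h1⟩, h2⟩, h3⟩, h4⟩, h5⟩ := hx
    exact exists_chamberMap_eq hm (by exact_mod_cast h1) (by exact_mod_cast h2)
      (by exact_mod_cast h3) (by exact_mod_cast h4) (by exact_mod_cast h5)
  · exact absurd rfl hx

theorem sign_zpow_eq_pow (hε : ε = 1 ∨ ε = -1) {z : ℤ} {w : ℕ} (h : (z - w) % 2 = 0) :
    ε ^ z = ε ^ w := by
  obtain ⟨t, ht⟩ := Int.dvd_of_emod_eq_zero h
  rw [show z = w + 2 * t by omega, zpow_add₀ (sign_ne_zero' hε), zpow_mul, zpow_natCast]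
  have : ε ^ (2 : ℤ) = 1 := by rcases hε with rfl | rfl <;> norm_num
  rw [this, one_zpow, mul_one]

/-- The lattice term at a point where the signs and the absolute values of the linear forms are
known. -/
theorem latticeTerm_of_signs {x : (ℤ × ℤ) × ℤ} {M N₀ N₁ N₂ N₃ N₄ σ₀ σ₁ σ₂ σ₃ σ₄ : ℕ} (hM : 1 ≤ M)
    (hm : x.1.2 = M) (h₀ : x.2 = (-1) ^ σ₀ * N₀) (h₁ : x.1.1 = (-1) ^ σ₁ * N₁)
    (h₂ : x.2 + x.1.1 = (-1) ^ σ₂ * N₂) (h₃ : x.1.1 + x.1.2 = (-1) ^ σ₃ * N₃)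
    (h₄ : x.2 + x.1.1 + x.1.2 = (-1) ^ σ₄ * N₄) :
    latticeTerm ε p q a b c s x =
      (-1) ^ (σ₀ * p + σ₁ * q + σ₂ * a + σ₃ * b + σ₄ * c) * (ε ^ (x.2 + x.1.2) /
        ((N₀ : ℂ) ^ p * (N₁ : ℂ) ^ q * (N₂ : ℂ) ^ a * (N₃ : ℂ) ^ b * (N₄ : ℂ) ^ c) *
          (M : ℂ) ^ (-s)) := by
  obtain ⟨⟨l, m⟩, n⟩ := x
  simp only at hm h₀ h₁ h₂ h₃ h₄ ⊢
  have key : ∀ (σ N k : ℕ), ((-1 : ℂ) ^ σ * N)⁻¹ ^ k = (-1) ^ (σ * k) * ((N : ℂ) ^ k)⁻¹ := by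
    intro σ N k
    rw [mul_inv, mul_pow, ← inv_pow, inv_neg, inv_one, pow_mul, inv_pow]
  have e₀ : (n : ℂ) = (-1) ^ σ₀ * N₀ := by exact_mod_cast congrArg (Int.cast : ℤ → ℂ) h₀
  have e₁ : (l : ℂ) = (-1) ^ σ₁ * N₁ := by exact_mod_cast congrArg (Int.cast : ℤ → ℂ) h₁
  have e₂ : (n : ℂ) + l = (-1) ^ σ₂ * N₂ := by exact_mod_cast congrArg (Int.cast : ℤ → ℂ) h₂
  have e₃ : (l : ℂ) + m = (-1) ^ σ₃ * N₃ := by exact_mod_cast congrArg (Int.cast : ℤ → ℂ) h₃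
  have e₄ : (n : ℂ) + l + m = (-1) ^ σ₄ * N₄ := by exact_mod_cast congrArg (Int.cast : ℤ → ℂ) h₄
  rw [latticeTerm, if_pos (by simp only; omega)]
  dsimp only
  rw [e₄, e₃, e₂, e₁, e₀, key, key, key, key, key, Complex.cpow_neg, hm, Int.cast_natCast, pow_add,
    pow_add, pow_add, pow_add, div_eq_mul_inv, mul_inv, mul_inv, mul_inv, mul_inv]
  ring

/-- The signs of the linear forms `n`, `l`, `n + l`, `l + m`, `n + l + m` on the twelve chambers, as
exponents of `-1`. -/
def formSign : Fin 12 → Fin 5 → ℕ :=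
  ![![0, 0, 0, 0, 0], ![1, 0, 0, 0, 0], ![1, 0, 1, 0, 0], ![1, 0, 1, 0, 1], ![0, 1, 0, 0, 0],
    ![0, 1, 0, 1, 0], ![0, 1, 1, 0, 0], ![0, 1, 1, 1, 0], ![0, 1, 1, 1, 1], ![1, 1, 1, 0, 0],
    ![1, 1, 1, 0, 1], ![1, 1, 1, 1, 1]]

/-- The positions of the absolute values of these linear forms among the coroot values. -/
def formIndex : Fin 12 → Fin 5 → Fin 6 :=
  ![![0, 1, 3, 4, 5], ![0, 3, 1, 5, 4], ![3, 0, 1, 5, 2], ![5, 0, 4, 3, 2], ![3, 1, 0, 2, 5],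
    ![5, 4, 0, 2, 3], ![1, 3, 0, 2, 4], ![4, 5, 0, 2, 1], ![2, 5, 3, 4, 1], ![1, 0, 3, 4, 2],
    ![4, 0, 5, 1, 2], ![2, 3, 5, 1, 4]]

/-- On each chamber, the lattice terms are up to sign the terms of a triple zeta-function. -/
theorem latticeTerm_chamberMap (hε : ε = 1 ∨ ε = -1) (i : Fin 12) {k : ℕ × ℕ × ℕ}
    (hk : IsPositive k) :
    latticeTerm ε p q a b c s (chamberMap i k) = (-1) ^ lhsSign p q a b c i *
      (tripleTerm ε (lhsExponent p q a b c i) k *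
        (corootValue k (lhsPosition i) : ℂ) ^ (-s)) := by
  have hM := hk.one_le_corootValue (lhsPosition i)
  rw [tripleTerm_eq, if_pos hk]
  refine (latticeTerm_of_signs (N₀ := corootValue k (formIndex i 0))
    (N₁ := corootValue k (formIndex i 1)) (N₂ := corootValue k (formIndex i 2))
    (N₃ := corootValue k (formIndex i 3)) (N₄ := corootValue k (formIndex i 4))
    (σ₀ := formSign i 0) (σ₁ := formSign i 1) (σ₂ := formSign i 2) (σ₃ := formSign i 3)
    (σ₄ := formSign i 4) hM ?_ ?_ ?_ ?_ ?_ ?_).trans ?_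
  rotate_right
  · -- the exponent of `ε` is congruent to `k₁ + k₃` modulo `2`
    have hsgn : ε ^ ((chamberMap i k).2 + (chamberMap i k).1.2) = ε ^ (k.1 + k.2.2) := by
      refine sign_zpow_eq_pow hε ?_
      fin_cases i <;> simp [chamberMap] <;> omega
    rw [hsgn, ← mul_assoc, ← mul_assoc, mul_div_assoc', mul_div_assoc']
    congr 2
    · congr 1
      fin_cases i <;> simp [formSign, lhsSign, pow_add]
    · fin_cases i <;>
        simp [-mul_eq_mul_right_iff, formIndex, lhsExponent, corootValue] <;> ring
  all_goals
    fin_cases i <;> simp [chamberMap, corootValue, formIndex, formSign, lhsPosition] <;> ring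

/-- The average over the two characters, which selects the points with `n` and `m` of the same
parity. -/
noncomputable def evenLatticeTerm (p q a b c : ℕ) (s : ℂ) (x : (ℤ × ℤ) × ℤ) : ℂ :=
  (latticeTerm 1 p q a b c s x + latticeTerm (-1) p q a b c s x) / 2

theorem hasSum_evenLatticeTerm (hp : 1 ≤ p) (hq : 1 ≤ q) (ha : 1 ≤ a) (hb : 1 ≤ b) (hc : 1 ≤ c)
    (hs : 1 < s.re) :
    HasSum (evenLatticeTerm p q a b c s)
      (∑ i, (-1) ^ lhsSign p q a b c i * zetaSO6 (lhsArg p q a b c i) s) := by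
  have piece : ∀ i, HasSum (fun x => if i = chamber x then evenLatticeTerm p q a b c s x else 0)
      ((-1) ^ lhsSign p q a b c i * zetaSO6 (lhsArg p q a b c i) s) := by
    intro i
    have h := (hasSum_zetaSO6_lhsArg hp hq ha hb hc i hs).mul_left ((-1) ^ lhsSign p q a b c i)
    rw [← hasSum_subtype_iff_of_support_subset (s := {k | IsPositive k})] at h
    · have hinj : Function.Injective fun k : {k | IsPositive k} => chamberMap i k :=
        (chamberMap_injective i).comp Subtype.val_injective
      rw [← hinj.hasSum_iff]
      · refine hasSum_of_eq h (fun k => ?_) rfl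
        have hk : IsPositive k := k.2
        simp only [Function.comp_apply]
        rw [chamber_chamberMap i hk, if_pos rfl, evenLatticeTerm, evenTerm,
          latticeTerm_chamberMap (.inl rfl) i hk, latticeTerm_chamberMap (.inr rfl) i hk]
        ring
      · intro x hx
        rw [ite_eq_right_iff]
        rintro rfl
        have hz : ∀ ε : ℂ, latticeTerm ε p q a b c s x = 0 := by
          intro ε
          by_contra hne
          obtain ⟨k, hk, hkx⟩ := exists_chamberMap_eq_of_latticeTerm_ne_zero hp hq ha hb hc hne
          exact hx ⟨⟨k, hk⟩, hkx⟩
        rw [evenLatticeTerm, hz, hz, add_zero, zero_div]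
    · intro k hk
      by_contra hne
      refine hk ?_
      have : ¬ IsPositive k := hne
      simp [evenTerm, tripleTerm_of_not_isPositive this]
  refine hasSum_of_eq (hasSum_sum fun i _ => piece i) (fun x => ?_) rfl
  simp

/-- The functional relation in the half plane of absolute convergence. -/
theorem functional_relation_of_one_lt_re (hp : 1 ≤ p) (hq : 1 ≤ q) (ha : 1 ≤ a) (hb : 1 ≤ b)
    (hc : 1 ≤ c) (hs : 1 < s.re) :
    ∑ i, (-1) ^ lhsSign p q a b c i * zetaSO6 (lhsArg p q a b c i) s =
      1 / 2 * (J₀ p q a b c s + J₂ p q a b c s) := by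
  have hl := hasSum_evenLatticeTerm hp hq ha hb hc hs
  have h1 := hl.prod_fiberwise fun n =>
    ((hasSum_latticeTerm_fibre (s := s) (.inl rfl) isTwistedZeta_riemannZeta hp hq ha hb hc n).add
      (hasSum_latticeTerm_fibre (.inr rfl) isTwistedZeta_phi hp hq ha hb hc n)).div_const 2
  have h2 := ((hasSum_rhsTerm (h := riemannZeta) (a := a) (.inl rfl) hp hq hb hc hs).add
    (hasSum_rhsTerm (h := phi) (a := a) (.inr rfl) hp hq hb hc hs)).div_const 2
  rw [h1.unique h2, J₀, J₂]
  ring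

end Chambers

/-! ### Analytic continuation of the functional relation -/

section Continuation

variable {ε : ℂ} {h : ℂ → ℂ} {p q a b c : ℕ}

theorem meromorphicAt_polylogT {P Q : ℕ} {x y : ℂ} (hP : 1 ≤ P) (hQ : 1 ≤ Q)
    (hx : x = 1 ∨ x = -1) (hy : y = 1 ∨ y = -1) {g : ℂ → ℂ} {z : ℂ} (hg : AnalyticAt ℂ g z) :
    MeromorphicAt (fun w => polylogT P (g w) Q x y) z :=
  ((continuation_spec (hasContinuationT hP hQ hx hy)).meromorphic.meromorphicOn (g z)
    (Set.mem_univ _)).comp_analyticAt hg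

theorem meromorphicAt_rhs (hε : ε = 1 ∨ ε = -1) (hp : 1 ≤ p) (hq : 1 ≤ q) (hb : 1 ≤ b)
    (hc : 1 ≤ c) (z : ℂ) : MeromorphicAt (rhs h 1 ε ε 1 ε ε ε ε p q a b c) z := by
  have h1 : (1 : ℂ) = 1 ∨ (1 : ℂ) = -1 := .inl rfl
  have hsum : ∀ (A : ℂ) (B : ℕ → ℂ) (C : ℕ → ℕ → ℂ) (n : ℕ) (r : ℕ → ℕ) (T : ℕ → ℕ → ℂ → ℂ),
      (∀ j ∈ range n, ∀ ω ∈ range (r j), MeromorphicAt (T j ω) z) →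
      MeromorphicAt (fun s => A * ∑ j ∈ range n, B j * ∑ ω ∈ range (r j), C j ω * T j ω s) z :=
    fun A B C n r T hT => (MeromorphicAt.const A z).mul <| MeromorphicAt.fun_sum fun j hj =>
      (MeromorphicAt.const (B j) z).mul <| MeromorphicAt.fun_sum fun ω hω =>
        (MeromorphicAt.const (C j ω) z).mul (hT j hj ω hω)
  refine (((hsum _ _ _ _ _ _ fun j hj ω hω => ?_).add (hsum _ _ _ _ _ _ fun j hj ω hω => ?_)).add
    (hsum _ _ _ _ _ _ fun j hj ω hω => ?_)).add (hsum _ _ _ _ _ _ fun j hj ω hω => ?_)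
  all_goals rw [mem_range] at hj hω
  · exact meromorphicAt_polylogT (by omega) (by omega) h1 hε (by fun_prop)
  · exact meromorphicAt_polylogT (by omega) (by omega) hε h1 (by fun_prop)
  · exact meromorphicAt_polylogT (by omega) (by omega) hε hε (by fun_prop)
  · exact meromorphicAt_polylogT (by omega) (by omega) hε hε (by fun_prop)

theorem analyticAt_rhs {x₁ y₁ x₂ y₂ x₃ y₃ x₄ y₄ z : ℂ}
    (hr : RhsRegular x₁ y₁ x₂ y₂ x₃ y₃ x₄ y₄ p q a b c z) :
    AnalyticAt ℂ (rhs h x₁ y₁ x₂ y₂ x₃ y₃ x₄ y₄ p q a b c) z := by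
  have hsum : ∀ (A : ℂ) (B : ℕ → ℂ) (C : ℕ → ℕ → ℂ) (n : ℕ) (r : ℕ → ℕ) (T : ℕ → ℕ → ℂ → ℂ),
      (∀ j ∈ range n, ∀ ω ∈ range (r j), AnalyticAt ℂ (T j ω) z) →
      AnalyticAt ℂ (fun s => A * ∑ j ∈ range n, B j * ∑ ω ∈ range (r j), C j ω * T j ω s) z :=
    fun A B C n r T hT => analyticAt_const.fun_mul <| Finset.analyticAt_fun_sum _ fun j hj =>
      analyticAt_const.fun_mul <| Finset.analyticAt_fun_sum _ fun ω hω =>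
        analyticAt_const.fun_mul (hT j hj ω hω)
  obtain ⟨h1, h2, h3, h4⟩ := hr
  exact (((hsum _ _ _ _ _ _ h1).fun_add (hsum _ _ _ _ _ _ h2)).fun_add
    (hsum _ _ _ _ _ _ h3)).fun_add (hsum _ _ _ _ _ _ h4)

/-- Two meromorphic functions on the plane that agree for `1 < Re s` agree at every point at which
both are analytic. -/
theorem eq_of_meromorphic_of_analyticAt {F G : ℂ → ℂ} (hF : MeromorphicOn F Set.univ)
    (hG : MeromorphicOn G Set.univ) (hFG : ∀ s : ℂ, 1 < s.re → F s = G s) {s : ℂ}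
    (hFs : AnalyticAt ℂ F s) (hGs : AnalyticAt ℂ G s) : F s = G s := by
  have hm := hF.sub hG
  have h2 : meromorphicOrderAt (F - G) 2 = ⊤ := by
    rw [meromorphicOrderAt_eq_top_iff]
    apply Filter.Eventually.filter_mono nhdsWithin_le_nhds
    have h2 : (2 : ℂ) ∈ {z : ℂ | 1 < z.re} := by simp
    filter_upwards [(isOpen_halfPlane 1).mem_nhds h2] with z hz
    simp [hFG z hz]
  have hs : meromorphicOrderAt (F - G) s = ⊤ := by
    by_contra hne
    exact (hm.meromorphicOrderAt_ne_top_of_isPreconnected isPreconnected_univ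
      (Set.mem_univ s) (Set.mem_univ (2 : ℂ)) hne) h2
  have h3 := ((hFs.sub hGs).frequently_eq_iff_eventually_eq analyticAt_const).1
    (meromorphicOrderAt_eq_top_iff.1 hs).frequently
  exact sub_eq_zero.1 h3.self_of_nhds

theorem functional_relation (hp : 1 ≤ p) (hq : 1 ≤ q) (ha : 1 ≤ a) (hb : 1 ≤ b) (hc : 1 ≤ c)
    {s : ℂ} (hl : ∀ i, AnalyticAt ℂ (zetaSO6 (lhsArg p q a b c i)) s)
    (h₀ : RhsRegular 1 1 1 1 1 1 1 1 p q a b c s)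
    (h₂ : RhsRegular 1 (-1) (-1) 1 (-1) (-1) (-1) (-1) p q a b c s) :
    ∑ i, (-1) ^ lhsSign p q a b c i * zetaSO6 (lhsArg p q a b c i) s =
      1 / 2 * (J₀ p q a b c s + J₂ p q a b c s) := by
  refine eq_of_meromorphic_of_analyticAt
    (F := fun s => ∑ i, (-1) ^ lhsSign p q a b c i * zetaSO6 (lhsArg p q a b c i) s)
    (G := fun s => 1 / 2 * (J₀ p q a b c s + J₂ p q a b c s)) (fun z _ => ?_) (fun z _ => ?_)
    (fun z hz => functional_relation_of_one_lt_re hp hq ha hb hc hz) ?_ ?_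
  · exact MeromorphicAt.fun_sum fun i _ => (MeromorphicAt.const _ z).mul
      ((continuation_spec (hasContinuationSO6_lhsArg hp hq ha hb hc i)).meromorphic.meromorphicOn z
        (Set.mem_univ z))
  · exact (MeromorphicAt.const _ z).mul ((meromorphicAt_rhs (.inl rfl) hp hq hb hc z).add
      (meromorphicAt_rhs (.inr rfl) hp hq hb hc z))
  · exact Finset.analyticAt_fun_sum _ fun i _ => analyticAt_const.fun_mul (hl i)
  · exact analyticAt_const.fun_mul ((analyticAt_rhs h₀).fun_add (analyticAt_rhs h₂))

end Continuation

end WeightLatticeZeta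

theorem mainTheorem5 (p q a b c : ℕ) (hp : 1 ≤ p) (hq : 1 ≤ q) (ha : 1 ≤ a) (hb : 1 ≤ b)
    (hc : 1 ≤ c) :
    (∀ i, WeightLatticeZeta.HasContinuationSO6 (WeightLatticeZeta.lhsArg p q a b c i)) ∧
    (∀ m n : ℕ, 1 ≤ m → 1 ≤ n → ∀ x ∈ ({1, -1} : Set ℂ), ∀ y ∈ ({1, -1} : Set ℂ),
      WeightLatticeZeta.HasContinuationT m n x y) ∧
    ∀ s : ℂ,
      (∀ i, AnalyticAt ℂ (WeightLatticeZeta.zetaSO6 (WeightLatticeZeta.lhsArg p q a b c i)) s) →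
      WeightLatticeZeta.RhsRegular 1 1 1 1 1 1 1 1 p q a b c s →
      WeightLatticeZeta.RhsRegular 1 (-1) (-1) 1 (-1) (-1) (-1) (-1) p q a b c s →
      ∑ i, (-1) ^ WeightLatticeZeta.lhsSign p q a b c i *
          WeightLatticeZeta.zetaSO6 (WeightLatticeZeta.lhsArg p q a b c i) s =
        1 / 2 * (WeightLatticeZeta.J₀ p q a b c s + WeightLatticeZeta.J₂ p q a b c s) :=
  ⟨WeightLatticeZeta.hasContinuationSO6_lhsArg hp hq ha hb hc,
    fun _ _ hm hn _ hx _ hy => WeightLatticeZeta.hasContinuationT hm hn hx hy,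
    fun _ => WeightLatticeZeta.functional_relation hp hq ha hb hc⟩
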